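/- Let $E$ be a countable set. A reversible Markov chain on $E$ consists of the following data: a totally stable, conservative $Q$-matrix $Q=(q_{ij})$ (that is, $q_{ij}\ge 0$ for $i\ne j$ and $\sum_{j\ne i}q_{ij}=-q_{ii}<\infty$); a probability distribution $\pi$ on $E$ with $\pi_i>0$ and $\pi_iq_{ij}=\pi_jq_{ji}$ for all $i,j$; and the transition function $p_t(i,j)$, $t\ge 0$, of the symmetric Markov semigroup $P_tf(i)=\sum_j p_t(i,j)f(j)$ on $L^2(\pi)$ determined by the symmetric form $$D(f)=\tfrac12\sum_{i,j}\pi_iq_{ij}(f_j-f_i)^2,\qquad \mathcal D(D)=\{f\in L^2(\pi):D(f)<\infty\},$$ i.e. $D(f)=\lim_{t\downarrow 0}t^{-1}\langle f-P_tf,f\rangle_{\pi}\in[0,\infty]$ for every $f\in L^2(\pi)$. Write $\pi(f)=\sum_i\pi_if_i$, $\mathrm{Var}(f)=\pi(f^2)-\pi(f)^2$, $\|f\|=\|f\|_{L^2(\pi)}$, $\|f\|_1=\pi(|f|)$, and let $\|\cdot\|_{\mathrm{Var}}$ be the total variation norm. Consider the following properties of such a chain. - Nash inequality: for some constant $C$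 and some $1<p,q<\infty$ with $1/p+1/q=1$, $\mathrm{Var}(f)\le C\,D(f)^{1/p}\|f\|_1^{2/q}$ for all $f\in L^2(\pi)$. - Logarithmic Sobolev inequality: for some constant $C$, $\int f^2\log(f^2/\|f\|^2)\,d\pi\le C\,D(f)$ for all $f\in L^2(\pi)$. - Poincaré inequality: for some constant $C$, $\mathrm{Var}(f)\le C\,D(f)$ for all $f\in L^2(\pi)$. - Strong ergodicity: $\lim_{t\to\infty}\sup_x\|p_t(x,\cdot)-\pi\|_{\mathrm{Var}}=0$. - Exponential ergodicity: for some $\varepsilon>0$ and some function $C(x)<\infty$, $\|p_t(x,\cdot)-\pi\|_{\mathrm{Var}}\le C(x)e^{-\varepsilon t}$ for all $x$ and all $t\ge0$. - $L^2$-algebraic ergodicity: there are $C<\infty$, $q>1$ and $V:L^2(\pi)\to[0,\infty]$ with $V(c_1f+c_2)=c_1^2V(f)$ for $c_1,c_2\in\mathbb R$ (where $0\cdot\infty=0$) and $V(f)<\infty$ for all $f$ with finite support, such that $\mathrm{Var}(P_tf)\le C\,V(f)/t^{q-1}$ for all $t>0$ and $f\in L^2(\pi)$. - Ordinary ergodicity: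 $\lim_{t\to\infty}\|p_t(x,\cdot)-\pi\|_{\mathrm{Var}}=0$ for every $x$. **Theorem.** (a) For every reversible Markov chain on a countable set: 1. the Nash inequality implies the logarithmic Sobolev inequality, and it implies strong ergodicity; 2. the logarithmic Sobolev inequality implies the Poincaré inequality, and strong ergodicity implies exponential ergodicity; 3. the Poincaré inequality is equivalent to exponential ergodicity; 4. the Poincaré inequality implies $L^2$-algebraic ergodicity, which implies ordinary ergodicity. (b) None of the six one-way implications in 1, 2 and 4 can be reversed: for each of them there is a reversible Markov chain on $\mathbb N$ that has the implied property but not the implying one. (c) The logarithmic Sobolev inequality and strong ergodicity are not comparable: some reversible Markov chain on $\mathbb N$ satisfies the logarithmic Sobolev inequality but is not strongly ergodic, and some reversible Markov chain on $\mathbb N$ is strongly ergodic but does not satisfy the logarithmic Sobolev inequality. -/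

import Mathlib

open Filter Topology
open scoped ENNReal

noncomputable section

namespace MarkovChain

/-- `q` is a totally stable and conservative Q-matrix on `E`: the off-diagonal entries are
nonnegative and every row sums (absolutely) to `0`, that is `-q i i = ∑_{j ≠ i} q i j < ∞`. -/
structure IsQMatrix {E : Type*} (q : E → E → ℝ) : Prop where
  nonneg_of_ne : ∀ i j, i ≠ j → 0 ≤ q i j
  hasSum_row : ∀ i, HasSum (q i) 0

/-- `p t i j` (for `t ≥ 0`) is a standard, honest transition function on `E`.
Values at negative times are irrelevant. -/
structure IsTransitionFunction {E : Type*} (p : ℝ → E → E → ℝ) : Prop where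
  nonneg : ∀ t, 0 ≤ t → ∀ i j, 0 ≤ p t i j
  hasSum_row : ∀ t, 0 ≤ t → ∀ i, HasSum (p t i) 1
  zero_self : ∀ i, p 0 i i = 1
  zero_of_ne : ∀ i j, i ≠ j → p 0 i j = 0
  chapman_kolmogorov : ∀ s t, 0 ≤ s → 0 ≤ t → ∀ i j,
    HasSum (fun k => p s i k * p t k j) (p (s + t) i j)
  tendsto_zero : ∀ i, Tendsto (fun t => p t i i) (𝓝[>] 0) (𝓝 1)

section Functions

variable {E : Type*}

/-- `f ∈ L²(π)` (on a discrete space with weights `π`). -/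
def IsL2 (π : E → ℝ) (f : E → ℝ) : Prop := Summable fun i => π i * f i ^ 2

/-- `π(f) = ∫ f dπ`. -/
def mean (π : E → ℝ) (f : E → ℝ) : ℝ := ∑' i, π i * f i

/-- `Var(f) = π(f²) - π(f)²`. -/
def variance (π : E → ℝ) (f : E → ℝ) : ℝ := mean π (fun i => f i ^ 2) - mean π f ^ 2

/-- `‖f‖₁` in `L¹(π)`. -/
def normOne (π : E → ℝ) (f : E → ℝ) : ℝ := mean π fun i => |f i|

/-- The symmetric form `D(f) = ½ ∑_{i,j} π_i q_ij (f_j - f_i)² ∈ [0, ∞]`. Its domain is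
the set of all `f ∈ L²(π)` with `D(f) < ∞`. The diagonal terms vanish. -/
def form (q : E → E → ℝ) (π : E → ℝ) (f : E → ℝ) : ℝ≥0∞ :=
  2⁻¹ * ∑' i, ∑' j, ENNReal.ofReal (π i * q i j * (f j - f i) ^ 2)

/-- `(P_t f)(i) = ∑_j p_t(i, j) f(j)`. -/
def semigroup (p : ℝ → E → E → ℝ) (t : ℝ) (f : E → ℝ) : E → ℝ :=
  fun i => ∑' j, p t i j * f j

/-- The total variation norm `‖μ - ν‖_Var` of the difference of two discrete
probability distributions. -/
def tvNorm (μ ν : E → ℝ) : ℝ := ∑' j, |μ j - ν j|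

end Functions

/-- A reversible continuous-time Markov chain on `E`: a reversible Q-matrix `q` with reversible
probability `π > 0`, and the transition function `p` of the symmetric Markov semigroup
on `L²(π)` determined by the form `D` with its domain `{f ∈ L²(π) : D(f) < ∞}`.
The last field is the usual correspondence between symmetric semigroups and closed forms:
`D(f) = lim_{t → 0+} t⁻¹ ⟨f - P_t f, f⟩_π` in `[0, ∞]`, for every `f ∈ L²(π)`. -/
structure ReversibleChain (E : Type*) where
  /-- the Q-matrix -/
  q : E → E → ℝ
  /-- the reversible probability distribution -/
  π : E → ℝ
  /-- the transition function -/
  p : ℝ → E → E → ℝ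
  isQMatrix : IsQMatrix q
  π_pos : ∀ i, 0 < π i
  π_hasSum : HasSum π 1
  q_reversible : ∀ i j, π i * q i j = π j * q j i
  isTransitionFunction : IsTransitionFunction p
  p_reversible : ∀ t, 0 ≤ t → ∀ i j, π i * p t i j = π j * p t j i
  form_eq_limit : ∀ f : E → ℝ, IsL2 π f →
    Tendsto (fun t : ℝ => ENNReal.ofReal (t⁻¹ * mean π fun i => (f i - semigroup p t f i) * f i))
      (𝓝[>] 0) (𝓝 (form q π f))

namespace ReversibleChain

variable {E : Type*}

/-- Nash inequality: `Var(f) ≤ C D(f)^{1/a} ‖f‖₁^{2/b}` on `L²(π)`, for some constant `C` and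
some conjugate exponents `1 < a, b < ∞`. (It is trivial where `D(f) = ∞`.) -/
def Nash (X : ReversibleChain E) : Prop :=
  ∃ C a b : ℝ, 0 < C ∧ a.HolderConjugate b ∧
    ∀ f : E → ℝ, IsL2 X.π f → form X.q X.π f < ∞ →
      variance X.π f ≤ C * (form X.q X.π f).toReal ^ (1 / a) * normOne X.π f ^ (2 / b)

/-- Logarithmic Sobolev inequality: `∫ f² log(f² / ‖f‖²) dπ ≤ C D(f)` on `L²(π)`.
The integral, whose negative part is always finite, is in particular finite when `D(f) < ∞`. -/
def LogSobolev (X : ReversibleChain E) : Prop :=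
  ∃ C : ℝ, 0 < C ∧ ∀ f : E → ℝ, IsL2 X.π f → form X.q X.π f < ∞ →
    Summable (fun i => X.π i * (f i ^ 2 * Real.log (f i ^ 2 / mean X.π fun k => f k ^ 2))) ∧
    mean X.π (fun i => f i ^ 2 * Real.log (f i ^ 2 / mean X.π fun k => f k ^ 2))
      ≤ C * (form X.q X.π f).toReal

/-- Poincaré inequality: `Var(f) ≤ C D(f)` on `L²(π)`. -/
def Poincare (X : ReversibleChain E) : Prop :=
  ∃ C : ℝ, 0 < C ∧ ∀ f : E → ℝ, IsL2 X.π f → form X.q X.π f < ∞ →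
    variance X.π f ≤ C * (form X.q X.π f).toReal

/-- Ordinary ergodicity: `‖p_t(x, ·) - π‖_Var → 0` for every `x`. -/
def OrdinarilyErgodic (X : ReversibleChain E) : Prop :=
  ∀ x, Tendsto (fun t => tvNorm (X.p t x) X.π) atTop (𝓝 0)

/-- Exponential ergodicity: `‖p_t(x, ·) - π‖_Var ≤ C(x) e^{-εt}` for some `ε > 0`. -/
def ExponentiallyErgodic (X : ReversibleChain E) : Prop :=
  ∃ ε : ℝ, 0 < ε ∧ ∃ C : E → ℝ, ∀ x t, 0 ≤ t →
    tvNorm (X.p t x) X.π ≤ C x * Real.exp (-ε * t)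

/-- Strong ergodicity: `sup_x ‖p_t(x, ·) - π‖_Var → 0`.
(The supremum is over a nonempty family bounded by `2`.) -/
def StronglyErgodic (X : ReversibleChain E) : Prop :=
  Tendsto (fun t => ⨆ x, tvNorm (X.p t x) X.π) atTop (𝓝 0)

/-- `L²`-algebraic ergodicity: `Var(P_t f) ≤ C V(f) / t^{b-1}` for all `t > 0`, `f ∈ L²(π)`, for
some `C`, some `b > 1` and some `V : L²(π) → [0, ∞]` which is homogeneous of degree two,
`V(c₁ f + c₂) = c₁² V(f)` (with `0 · ∞ = 0`), and finite on functions of finite support. -/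
def L2AlgebraicallyErgodic (X : ReversibleChain E) : Prop :=
  ∃ (V : (E → ℝ) → ℝ≥0∞) (C b : ℝ), 0 < C ∧ 1 < b ∧
    (∀ f, IsL2 X.π f → ∀ c₁ c₂ : ℝ,
      V (fun i => c₁ * f i + c₂) = ENNReal.ofReal (c₁ ^ 2) * V f) ∧
    (∀ f : E → ℝ, f.support.Finite → V f < ∞) ∧
    ∀ f, IsL2 X.π f → ∀ t : ℝ, 0 < t →
      ENNReal.ofReal (variance X.π (semigroup X.p t f))
        ≤ ENNReal.ofReal C * V f / ENNReal.ofReal (t ^ (b - 1))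

end ReversibleChain

end MarkovChain

end

/-! ### Inner product, mean and variance in `L²(π)` on a discrete probability space -/

namespace MarkovChain

/-! The implications rest on two consequences of reversibility. Since `⟨P_t f, f⟩ = ‖P_{t/2} f‖²`,
the function `t ↦ ⟨P_t f, f⟩` is convex, whence `‖f‖² - ⟨P_t f, f⟩ ≤ t D(f)` and `2 s D(P_s f) ≤ Var
f - Var (P_s f)` (`ip_sub_semigroup_le`, `form_semigroup_le`). No spectral theorem and no
differentiation of the semigroup at positive times is needed. The bridge to total variation is that
`p_t(x, ·)/π = P_t (δ_x/π_x)`, so the squared distance to `π` is at most the variance of this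
density (`tvNorm_sq_le`).

Poincaré makes the variance contract by a fixed factor per unit time, which gives exponential and
algebraic ergodicity. Conversely, exponential ergodicity makes the centered correlation of a
finitely supported function decay exponentially with an unknown constant. Log-convexity replaces
this constant by the variance; one then passes to all of `L²` and lets `t → 0`. Nash gives strong
ergodicity because the bound `s^κ Var (P_s f) ≤ B` reproduces itself when `s` is doubled, with `B`
independent of `f` as long as `‖f‖₁ ≤ 1`. Nash gives log-Sobolev by applying it to the truncations
`(|g| - 2^k ‖g‖)⁺`: their squared norms decay geometrically in `k`, which beats the linear growth of
the logarithm over the layers. Log-Sobolev gives Poincaré by expansion at the constant function `1`.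

The separating examples are all reversible for the geometric distribution. Resampling from `π` at
rate one is strongly ergodic, but indicators of rare points violate log-Sobolev. The birth–death
chain with rates `i + 1` and `2 i` satisfies a Hardy inequality with weight `i + 1`, which absorbs
the logarithm, while its descent from far away takes arbitrarily long. Resampling with
site-dependent speeds tending to zero violates Poincaré. Speeds `1/(i+1)` still give algebraic
decay, by a Nash type inequality in terms of the oscillation; speeds `2^{-(i+1)²}` hold the chain so
long in rare sites that no power of `t` bounds the variance, although every start converges.

A chain here includes its transition function and the identification of its form, so the examples
have to be constructed. For resampling everything is explicit. Otherwise the transition function is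
the increasing limit of the matrix exponentials of the restrictions to `[0, n)`. When the mean jump
rate `-∑ π_i q_ii` is finite, the energies of the cutoffs `1_{[0,n)}` tend to zero. This gives both
honesty and the form on the maximal domain. -/

theorem hasSum_of_eq {α : Type*} {f g : α → ℝ} {a b : ℝ} (hf : HasSum f a) (h : ∀ i, g i = f i)
    (hab : b = a) : HasSum g b := by
  rw [hab, funext h]; exact hf

/-- A Fubini criterion for nonnegative families. -/
theorem hasSum_prod_of_nonneg {α β : Type*} {F : α × β → ℝ} (h0 : ∀ x, 0 ≤ F x) {g : α → ℝ}
    (h1 : ∀ a, HasSum (fun b => F (a, b)) (g a)) {s : ℝ} (h2 : HasSum g s) : HasSum F s := by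
  have hs : Summable F := by
    refine (summable_prod_of_nonneg h0).2 ⟨fun a => (h1 a).summable, ?_⟩
    have : (fun a => ∑' b, F (a, b)) = g := funext fun a => (h1 a).tsum_eq
    rw [this]; exact h2.summable
  have h3 := hs.hasSum.prod_fiberwise h1
  rw [← h3.unique h2]; exact hs.hasSum

/-- The inner product of `L²(π)`. -/
noncomputable def ip {E : Type*} (π f g : E → ℝ) : ℝ := mean π fun i => f i * g i

section L2

variable {E : Type*} {π f g h : E → ℝ}

theorem IsL2.summable_mul (hπ : ∀ i, 0 ≤ π i) (hf : IsL2 π f) (hg : IsL2 π g) :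
    Summable fun i => π i * (f i * g i) := by
  refine Summable.of_norm_bounded (hf.add hg) fun i => ?_
  rw [Real.norm_eq_abs, abs_mul, abs_of_nonneg (hπ i), ← mul_add]
  refine mul_le_mul_of_nonneg_left ?_ (hπ i)
  rw [abs_le]
  constructor <;> nlinarith [sq_nonneg (f i + g i), sq_nonneg (f i - g i), sq_nonneg (f i),
    sq_nonneg (g i)]

theorem IsL2.mono (hπ : ∀ i, 0 ≤ π i) (hf : IsL2 π f) (hgf : ∀ i, |g i| ≤ |f i|) : IsL2 π g :=
  Summable.of_nonneg_of_le (fun i => mul_nonneg (hπ i) (sq_nonneg _))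
    (fun i => mul_le_mul_of_nonneg_left (sq_le_sq.2 (hgf i)) (hπ i)) hf

theorem IsL2.const_mul (hf : IsL2 π f) (c : ℝ) : IsL2 π fun i => c * f i := by
  have := Summable.mul_left (c ^ 2) hf
  refine this.congr fun i => ?_
  ring

theorem IsL2.add (hπ : ∀ i, 0 ≤ π i) (hf : IsL2 π f) (hg : IsL2 π g) :
    IsL2 π fun i => f i + g i := by
  have := (Summable.add hf hg).add ((hf.summable_mul hπ hg).mul_left 2)
  refine this.congr fun i => ?_
  ring

theorem IsL2.sub (hπ : ∀ i, 0 ≤ π i) (hf : IsL2 π f) (hg : IsL2 π g) :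
    IsL2 π fun i => f i - g i := by
  have := hf.add hπ (hg.const_mul (-1))
  simpa [sub_eq_add_neg] using this

theorem isL2_const (hπ : Summable π) (c : ℝ) : IsL2 π fun _ => c := hπ.mul_right _

theorem isL2_of_bounded (hπ : ∀ i, 0 ≤ π i) (hs : Summable π) {M : ℝ} (hM : ∀ i, |f i| ≤ M) :
    IsL2 π f :=
  (isL2_const hs M).mono hπ fun i => (hM i).trans (le_abs_self M)

theorem isL2_of_finite_support (hf : f.support.Finite) : IsL2 π f :=
  summable_of_hasFiniteSupport (hf.subset fun i hi => by
    simp only [Function.mem_support] at hi ⊢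
    intro h
    simp [h] at hi)

theorem ip_comm : ip π f g = ip π g f := by simp only [ip, mul_comm (f _)]

theorem ip_sub_left (hπ : ∀ i, 0 ≤ π i) (hf : IsL2 π f) (hg : IsL2 π g) (hh : IsL2 π h) :
    ip π (fun i => f i - g i) h = ip π f h - ip π g h := by
  simp only [ip, mean]
  rw [← (hf.summable_mul hπ hh).tsum_sub (hg.summable_mul hπ hh)]
  exact tsum_congr fun i => by ring

theorem ip_sub_right (hπ : ∀ i, 0 ≤ π i) (hf : IsL2 π f) (hg : IsL2 π g) (hh : IsL2 π h) :
    ip π h (fun i => f i - g i) = ip π h f - ip π h g := by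
  rw [ip_comm, ip_sub_left hπ hf hg hh, ip_comm, ip_comm (f := g)]

theorem ip_smul_left (c : ℝ) : ip π (fun i => c * f i) g = c * ip π f g := by
  simp only [ip, mean]
  rw [← tsum_mul_left]
  exact tsum_congr fun i => by ring

theorem ip_self_nonneg (hπ : ∀ i, 0 ≤ π i) : 0 ≤ ip π f f :=
  tsum_nonneg fun i => mul_nonneg (hπ i) (mul_self_nonneg _)

theorem ip_one_left : ip π (fun _ => 1) f = mean π f := by simp [ip]

theorem ip_self_eq : ip π f f = mean π fun i => f i ^ 2 := by simp [ip, sq]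

theorem variance_eq_ip : variance π f = ip π f f - mean π f ^ 2 := by
  rw [variance, ip_self_eq]

/-- Cauchy–Schwarz: `‖f - c g‖²` is nonnegative for every real `c`, so its discriminant as a
quadratic in `c` is nonpositive. -/
theorem ip_mul_self_le (hπ : ∀ i, 0 ≤ π i) (hf : IsL2 π f) (hg : IsL2 π g) :
    ip π f g ^ 2 ≤ ip π f f * ip π g g := by
  have key : ∀ c : ℝ, 0 ≤ ip π g g * (c * c) + (-2 * ip π f g) * c + ip π f f := by
    intro c
    have h0 := ip_self_nonneg (f := fun i => f i - c * g i) hπ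
    have hc := hg.const_mul c
    rw [ip_sub_left hπ hf hc (hf.sub hπ hc), ip_sub_right hπ hf hc hf, ip_smul_left,
      ip_sub_right hπ hf hc hg, ip_comm (g := fun i => c * g i), ip_smul_left,
      ip_comm (f := g) (g := fun i => c * g i), ip_smul_left, ip_comm (f := g) (g := f)] at h0
    linarith
  have := discrim_le_zero key
  rw [discrim] at this
  nlinarith

theorem IsL2.summable (hπ : ∀ i, 0 ≤ π i) (hs : Summable π) (hf : IsL2 π f) :
    Summable fun i => π i * f i := by
  simpa using hf.summable_mul hπ (isL2_const hs 1)

theorem mean_sub_const (hπ : HasSum π 1) (hf : Summable fun i => π i * f i) (c : ℝ) :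
    mean π (fun i => f i - c) = mean π f - c := by
  have h := hf.hasSum.sub (hπ.mul_right c)
  rw [one_mul] at h
  have : HasSum (fun i => π i * (f i - c)) (mean π f - c) :=
    hasSum_of_eq h (fun i => by ring) rfl
  exact this.tsum_eq

theorem mean_const (hπ : HasSum π 1) (c : ℝ) : mean π (fun _ => c) = c := by
  have := (hπ.mul_right c).tsum_eq
  rwa [one_mul] at this

theorem mean_mono (hf : Summable fun i => π i * f i) (hg : Summable fun i => π i * g i)
    (hπ : ∀ i, 0 ≤ π i) (h : ∀ i, f i ≤ g i) : mean π f ≤ mean π g :=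
  hf.tsum_le_tsum (fun i => mul_le_mul_of_nonneg_left (h i) (hπ i)) hg

theorem ip_sub_const_self (hπ : ∀ i, 0 ≤ π i) (hs : HasSum π 1) (hf : IsL2 π f) (c : ℝ) :
    ip π (fun i => f i - c) (fun i => f i - c) = variance π f + (mean π f - c) ^ 2 := by
  have h := (Summable.hasSum hf).sub ((hf.summable hπ hs.summable).hasSum.mul_left (2 * c))
  have h' := h.add (hs.mul_right (c ^ 2))
  have : HasSum (fun i => π i * ((f i - c) * (f i - c)))
      (mean π (fun i => f i ^ 2) - 2 * c * mean π f + 1 * c ^ 2) :=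
    hasSum_of_eq h' (fun i => by ring) rfl
  rw [ip, mean, this.tsum_eq, variance]
  ring

theorem variance_eq_ip_centered (hπ : ∀ i, 0 ≤ π i) (hs : HasSum π 1) (hf : IsL2 π f) :
    variance π f = ip π (fun i => f i - mean π f) (fun i => f i - mean π f) := by
  rw [ip_sub_const_self hπ hs hf]; ring

theorem variance_nonneg (hπ : ∀ i, 0 ≤ π i) (hs : HasSum π 1) (hf : IsL2 π f) :
    0 ≤ variance π f := by
  rw [variance_eq_ip_centered hπ hs hf]; exact ip_self_nonneg hπ

theorem variance_sub_const (hπ : ∀ i, 0 ≤ π i) (hs : HasSum π 1) (hf : IsL2 π f) (c : ℝ) :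
    variance π (fun i => f i - c) = variance π f := by
  rw [variance_eq_ip, ip_sub_const_self hπ hs hf, mean_sub_const hs (hf.summable hπ hs.summable)]
  ring

theorem variance_le_ip_sub_const (hπ : ∀ i, 0 ≤ π i) (hs : HasSum π 1) (hf : IsL2 π f) (c : ℝ) :
    variance π f ≤ ip π (fun i => f i - c) (fun i => f i - c) := by
  rw [ip_sub_const_self hπ hs hf]
  nlinarith [sq_nonneg (mean π f - c)]

theorem sq_mean_le (hπ : ∀ i, 0 ≤ π i) (hs : HasSum π 1) (hf : IsL2 π f) :
    mean π f ^ 2 ≤ ip π f f := by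
  have := variance_nonneg hπ hs hf
  rw [variance_eq_ip] at this
  linarith

theorem normOne_sq_le (hπ : ∀ i, 0 ≤ π i) (hs : HasSum π 1) (hf : IsL2 π f) :
    normOne π f ^ 2 ≤ ip π f f := by
  have := sq_mean_le hπ hs (hf.mono hπ (g := fun i => |f i|) fun i => by simp)
  simpa [normOne, ip] using this

theorem normOne_nonneg (hπ : ∀ i, 0 ≤ π i) : 0 ≤ normOne π f :=
  tsum_nonneg fun i => mul_nonneg (hπ i) (abs_nonneg _)

/-- Dominated convergence in `L²(π)`. -/
theorem tendsto_ip_of_dominated {ι : Type*} {l : Filter ι} {F G : ι → E → ℝ}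
    (hπ : ∀ i, 0 ≤ π i) {u v : E → ℝ} (hu : IsL2 π u) (hv : IsL2 π v)
    (hF : ∀ n i, |F n i| ≤ u i) (hG : ∀ n i, |G n i| ≤ v i)
    (hf : ∀ i, Tendsto (fun n => F n i) l (𝓝 (f i)))
    (hg : ∀ i, Tendsto (fun n => G n i) l (𝓝 (g i))) :
    Tendsto (fun n => ip π (F n) (G n)) l (𝓝 (ip π f g)) := by
  refine tendsto_tsum_of_dominated_convergence (hu.summable_mul hπ hv)
    (fun i => ((hf i).mul (hg i)).const_mul _) (Eventually.of_forall fun n i => ?_)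
  rw [Real.norm_eq_abs, abs_mul, abs_mul, abs_of_nonneg (hπ i)]
  exact mul_le_mul_of_nonneg_left
    (mul_le_mul (hF n i) (hG n i) (abs_nonneg _) ((abs_nonneg _).trans (hF n i))) (hπ i)

end L2

/-! ### Markov kernels in detailed balance, acting on `L²(π)` -/

/-- The action of a kernel on functions. -/
noncomputable def kernelMap {E : Type*} (k : E → E → ℝ) (f : E → ℝ) (i : E) : ℝ :=
  ∑' j, k i j * f j

/-- `k` is a Markov kernel in detailed balance with the probability distribution `π`. -/
structure IsReversibleKernel {E : Type*} (π : E → ℝ) (k : E → E → ℝ) : Prop where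
  pos : ∀ i, 0 < π i
  hasSum : HasSum π 1
  nonneg : ∀ i j, 0 ≤ k i j
  hasSum_row : ∀ i, HasSum (k i) 1
  balance : ∀ i j, π i * k i j = π j * k j i

namespace IsReversibleKernel

variable {E : Type*} {π : E → ℝ} {k l : E → E → ℝ} {f g : E → ℝ}

theorem pos' (K : IsReversibleKernel π k) (i : E) : 0 ≤ π i := (K.pos i).le

theorem hasSum_sq_left (K : IsReversibleKernel π k) (hf : IsL2 π f) :
    HasSum (fun x : E × E => π x.1 * k x.1 x.2 * f x.1 ^ 2) (ip π f f) := by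
  refine hasSum_prod_of_nonneg
    (fun x => mul_nonneg (mul_nonneg (K.pos' _) (K.nonneg _ _)) (sq_nonneg _))
    (g := fun i => π i * f i ^ 2) (fun i => ?_) ?_
  · have := ((K.hasSum_row i).mul_left (π i)).mul_right (f i ^ 2)
    simpa using this
  · rw [ip_self_eq]; exact Summable.hasSum hf

/-- By detailed balance the measure `π_i k(i, j)` on pairs is symmetric, so its second marginal is
`π` as well. -/
theorem hasSum_sq_right (K : IsReversibleKernel π k) (hf : IsL2 π f) :
    HasSum (fun x : E × E => π x.1 * k x.1 x.2 * f x.2 ^ 2) (ip π f f) := by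
  rw [← (Equiv.prodComm E E).hasSum_iff]
  refine hasSum_of_eq (K.hasSum_sq_left hf) (fun x => ?_) rfl
  simp only [Function.comp, Equiv.prodComm_apply, Prod.fst_swap, Prod.snd_swap]
  rw [K.balance]

theorem summable_mul (K : IsReversibleKernel π k) (hf : IsL2 π f) (hg : IsL2 π g) :
    Summable fun x : E × E => π x.1 * k x.1 x.2 * (f x.1 * g x.2) := by
  refine Summable.of_norm_bounded
    ((K.hasSum_sq_left hf).summable.add (K.hasSum_sq_right hg).summable) fun x => ?_
  have h := mul_nonneg (K.pos' x.1) (K.nonneg x.1 x.2)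
  rw [Real.norm_eq_abs, abs_mul, abs_of_nonneg h, ← mul_add]
  refine mul_le_mul_of_nonneg_left ?_ h
  rw [abs_le]
  constructor <;> nlinarith [sq_nonneg (f x.1 + g x.2), sq_nonneg (f x.1 - g x.2),
    sq_nonneg (f x.1), sq_nonneg (g x.2)]

theorem summable_row (K : IsReversibleKernel π k) (hf : IsL2 π f) (i : E) :
    Summable fun j => k i j * f j := by
  have h := (K.summable_mul (isL2_const K.hasSum.summable 1) hf).prod_factor i
  have := h.mul_left (π i)⁻¹
  refine this.congr fun j => ?_
  have := (K.pos i).ne'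
  field_simp

theorem hasSum_map (K : IsReversibleKernel π k) (hf : IsL2 π f) (i : E) :
    HasSum (fun j => k i j * f j) (kernelMap k f i) := (K.summable_row hf i).hasSum

theorem map_sub (K : IsReversibleKernel π k) (hf : IsL2 π f) (hg : IsL2 π g) :
    kernelMap k (fun i => f i - g i) = fun i => kernelMap k f i - kernelMap k g i := by
  funext i
  rw [← ((K.hasSum_map hf i).sub (K.hasSum_map hg i)).tsum_eq]
  exact tsum_congr fun j => by ring

theorem map_const (K : IsReversibleKernel π k) (c : ℝ) :
    kernelMap k (fun _ => c) = fun _ => c := by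
  funext i
  have := (K.hasSum_row i).mul_right c
  rw [one_mul] at this
  exact this.tsum_eq

theorem summable_row_sq (K : IsReversibleKernel π k) (hf : IsL2 π f) (i : E) :
    Summable fun j => k i j * f j ^ 2 := by
  have := ((K.hasSum_sq_right hf).summable.prod_factor i).mul_left (π i)⁻¹
  refine this.congr fun j => ?_
  have := (K.pos i).ne'
  field_simp

/-- Jensen's inequality at the point `i`, from `∑_j k(i, j) (f j - c)² ≥ 0` with `c` the mean of `f`
under `k(i, ·)`. -/
theorem map_sq_le (K : IsReversibleKernel π k) (hf : IsL2 π f) (i : E) :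
    kernelMap k f i ^ 2 ≤ ∑' j, k i j * f j ^ 2 := by
  set c := kernelMap k f i
  have h1 := (K.summable_row_sq hf i).hasSum.sub ((K.hasSum_map hf i).mul_left (2 * c))
  have h2 := h1.add ((K.hasSum_row i).mul_right (c ^ 2))
  have h3 := h2.nonneg fun j => by
    have := mul_nonneg (K.nonneg i j) (sq_nonneg (f j - c))
    linarith
  have : c = kernelMap k f i := rfl
  rw [← this] at h3
  linarith

theorem hasSum_sq_iter (K : IsReversibleKernel π k) (hf : IsL2 π f) :
    HasSum (fun i => π i * ∑' j, k i j * f j ^ 2) (ip π f f) := by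
  refine (K.hasSum_sq_right hf).prod_fiberwise fun i => ?_
  simpa [mul_assoc] using (K.summable_row_sq hf i).hasSum.mul_left (π i)

theorem isL2_map (K : IsReversibleKernel π k) (hf : IsL2 π f) : IsL2 π (kernelMap k f) :=
  Summable.of_nonneg_of_le (fun i => mul_nonneg (K.pos' i) (sq_nonneg _))
    (fun i => mul_le_mul_of_nonneg_left (K.map_sq_le hf i) (K.pos' i))
    (K.hasSum_sq_iter hf).summable

theorem ip_map_self_le (K : IsReversibleKernel π k) (hf : IsL2 π f) :
    ip π (kernelMap k f) (kernelMap k f) ≤ ip π f f := by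
  rw [ip_self_eq, ← (K.hasSum_sq_iter hf).tsum_eq]
  exact Summable.tsum_le_tsum (fun i => mul_le_mul_of_nonneg_left (K.map_sq_le hf i) (K.pos' i))
    (K.isL2_map hf) (K.hasSum_sq_iter hf).summable

theorem hasSum_ip_map (K : IsReversibleKernel π k) (hf : IsL2 π f) (hg : IsL2 π g) :
    HasSum (fun x : E × E => π x.1 * k x.1 x.2 * (f x.1 * g x.2)) (ip π f (kernelMap k g)) := by
  have hs := K.summable_mul hf hg
  have h := hs.hasSum.prod_fiberwise (g := fun i => π i * (f i * kernelMap k g i)) fun i => by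
    have := (K.hasSum_map hg i).mul_left (π i * f i)
    exact hasSum_of_eq this (fun j => by ring) (by ring)
  have h' : ip π f (kernelMap k g) = _ := h.tsum_eq
  rw [h']
  exact hs.hasSum

theorem ip_map_comm (K : IsReversibleKernel π k) (hf : IsL2 π f) (hg : IsL2 π g) :
    ip π (kernelMap k f) g = ip π f (kernelMap k g) := by
  have h1 := K.hasSum_ip_map hg hf
  rw [← (Equiv.prodComm E E).hasSum_iff] at h1
  rw [ip_comm]
  refine h1.unique (hasSum_of_eq (K.hasSum_ip_map hf hg) (fun x => ?_) rfl)
  simp only [Function.comp, Equiv.prodComm_apply, Prod.fst_swap, Prod.snd_swap]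
  rw [K.balance]; ring

theorem mean_map (K : IsReversibleKernel π k) (hf : IsL2 π f) :
    mean π (kernelMap k f) = mean π f := by
  rw [← ip_one_left, ← K.ip_map_comm (isL2_const K.hasSum.summable 1) hf, K.map_const, ip_one_left]

/-- Expand the square; both marginals of `π_i k(i, j)` are `π`. This writes `⟨f - P_t f, f⟩` as a
sum over pairs, which can be compared with the form term by term. -/
theorem hasSum_energy (K : IsReversibleKernel π k) (hf : IsL2 π f) :
    HasSum (fun x : E × E => π x.1 * k x.1 x.2 * (f x.2 - f x.1) ^ 2)
      (2 * ip π (fun i => f i - kernelMap k f i) f) := by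
  have h := ((K.hasSum_sq_left hf).add (K.hasSum_sq_right hf)).sub
    ((K.hasSum_ip_map hf hf).mul_left 2)
  rw [ip_sub_left K.pos' hf (K.isL2_map hf) hf, ip_comm (f := kernelMap k f)]
  exact hasSum_of_eq h (fun x => by ring) (by ring)

theorem normOne_map_le (K : IsReversibleKernel π k) (hf : IsL2 π f) :
    normOne π (kernelMap k f) ≤ normOne π f := by
  have ha : IsL2 π fun i => |f i| := hf.mono K.pos' fun i => by simp
  have hb : IsL2 π fun i => |kernelMap k f i| := (K.isL2_map hf).mono K.pos' fun i => by simp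
  rw [normOne, normOne, ← K.mean_map ha]
  refine mean_mono (hb.summable K.pos' K.hasSum.summable)
    ((K.isL2_map ha).summable K.pos' K.hasSum.summable) K.pos' fun i => ?_
  have h := norm_tsum_le_tsum_norm (K.summable_row hf i).norm
  simpa [abs_mul, abs_of_nonneg (K.nonneg _ _), kernelMap] using h

theorem variance_map_le (K : IsReversibleKernel π k) (hf : IsL2 π f) :
    variance π (kernelMap k f) ≤ variance π f := by
  rw [variance_eq_ip, variance_eq_ip, K.mean_map hf]
  linarith [K.ip_map_self_le hf]

theorem map_le_of_le (K : IsReversibleKernel π k) (hf : IsL2 π f) {c : ℝ} (h : ∀ i, f i ≤ c)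
    (i : E) : kernelMap k f i ≤ c := by
  have := hasSum_le (fun j => mul_le_mul_of_nonneg_left (h j) (K.nonneg i j)) (K.hasSum_map hf i)
    ((K.hasSum_row i).mul_right c)
  simpa using this

theorem le_map_of_le (K : IsReversibleKernel π k) (hf : IsL2 π f) {c : ℝ} (h : ∀ i, c ≤ f i)
    (i : E) : c ≤ kernelMap k f i := by
  have := hasSum_le (fun j => mul_le_mul_of_nonneg_left (h j) (K.nonneg i j))
    ((K.hasSum_row i).mul_right c) (K.hasSum_map hf i)
  simpa using this

/-- The interchange of sums is justified by running the nonnegative Fubini criterion with `|f|`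
first. -/
theorem map_map {m : E → E → ℝ} (K : IsReversibleKernel π k) (L : IsReversibleKernel π l)
    (M : IsReversibleKernel π m) (hm : ∀ i j, HasSum (fun n => k i n * l n j) (m i j))
    (hf : IsL2 π f) : kernelMap k (kernelMap l f) = kernelMap m f := by
  funext i
  have ha : IsL2 π fun i => |f i| := hf.mono K.pos' fun i => by simp
  have hs : Summable fun x : E × E => k i x.2 * l x.2 x.1 * f x.1 := by
    have := hasSum_prod_of_nonneg (F := fun x : E × E => k i x.2 * l x.2 x.1 * |f x.1|)
      (fun x => mul_nonneg (mul_nonneg (K.nonneg _ _) (L.nonneg _ _)) (abs_nonneg _))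
      (fun j => (hm i j).mul_right |f j|) (M.hasSum_map ha i)
    refine Summable.of_norm (this.summable.congr fun x => ?_)
    rw [Real.norm_eq_abs, abs_mul, abs_of_nonneg (mul_nonneg (K.nonneg _ _) (L.nonneg _ _))]
  have h1 := hs.hasSum.prod_fiberwise (fun j => (hm i j).mul_right (f j))
  have h2 := ((Equiv.prodComm E E).hasSum_iff.2 hs.hasSum).prod_fiberwise
    (g := fun n => k i n * kernelMap l f n) (fun n => by
      have := (L.hasSum_map hf n).mul_left (k i n)
      simpa [Function.comp_def, mul_assoc] using this)
  rw [kernelMap, h2.tsum_eq, kernelMap, h1.tsum_eq]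

end IsReversibleKernel

end MarkovChain

/-! ### Indicators of points and the symmetric form -/

namespace MarkovChain

section PointFunction

variable {E : Type*} {π : E → ℝ}

/-- The indicator function of the point `x`. -/
noncomputable def pointFn {E : Type*} (x : E) : E → ℝ := Set.indicator {x} fun _ => 1

theorem pointFn_self (x : E) : pointFn x x = 1 := by simp [pointFn]

theorem pointFn_of_ne {x y : E} (h : y ≠ x) : pointFn x y = 0 := by simp [pointFn, h]

theorem pointFn_support_finite (x : E) : (pointFn x).support.Finite :=
  (Set.finite_singleton x).subset (by
    intro y hy
    by_contra h
    exact hy (pointFn_of_ne h))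

theorem pointFn_nonneg (x y : E) : 0 ≤ pointFn x y :=
  Set.indicator_nonneg (fun _ _ => zero_le_one) y

theorem isL2_pointFn (x : E) : IsL2 π (pointFn x) :=
  isL2_of_finite_support (pointFn_support_finite x)

theorem tsum_mul_pointFn (a : E → ℝ) (x : E) : ∑' y, a y * pointFn x y = a x := by
  rw [tsum_eq_single x fun y hy => by rw [pointFn_of_ne hy, mul_zero], pointFn_self, mul_one]

theorem mean_pointFn (x : E) : mean π (pointFn x) = π x := tsum_mul_pointFn _ _

theorem normOne_pointFn (x : E) : normOne π (pointFn x) = π x := by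
  rw [normOne, ← mean_pointFn (π := π) x]
  congr 1
  funext y
  exact abs_of_nonneg (pointFn_nonneg x y)

theorem ip_pointFn_right (f : E → ℝ) (x : E) : ip π f (pointFn x) = π x * f x := by
  rw [ip, mean, ← tsum_mul_pointFn (fun y => π y * f y)]
  exact tsum_congr fun y => by ring

theorem kernelMap_pointFn (k : E → E → ℝ) (i x : E) : kernelMap k (pointFn x) i = k i x :=
  tsum_mul_pointFn _ _

end PointFunction

section Form

variable {E : Type*} {q : E → E → ℝ} {π f g : E → ℝ}

/-- The contraction property of the form, used for truncations. The diagonal rates are negative, but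
their terms vanish. -/
theorem form_mono (hq : IsQMatrix q) (hπ : ∀ i, 0 ≤ π i)
    (h : ∀ i j, |g j - g i| ≤ |f j - f i|) : form q π g ≤ form q π f := by
  refine mul_le_mul_right (ENNReal.tsum_le_tsum fun i => ENNReal.tsum_le_tsum fun j => ?_) _
  refine ENNReal.ofReal_le_ofReal ?_
  by_cases hij : i = j
  · simp [hij]
  · exact mul_le_mul_of_nonneg_left (sq_le_sq.2 (h i j))
      (mul_nonneg (hπ i) (hq.nonneg_of_ne i j hij))

theorem form_sub_const (c : ℝ) : form q π (fun i => f i - c) = form q π f := by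
  simp [form]

theorem form_const_mul (c : ℝ) :
    form q π (fun i => c * f i) = ENNReal.ofReal (c ^ 2) * form q π f := by
  simp only [form]
  rw [mul_left_comm]
  congr 1
  rw [← ENNReal.tsum_mul_left]
  refine tsum_congr fun i => ?_
  rw [← ENNReal.tsum_mul_left]
  refine tsum_congr fun j => ?_
  rw [← ENNReal.ofReal_mul (sq_nonneg c)]
  congr 1
  ring

/-- Every unordered pair occurs twice in the double sum, which cancels the factor one half. -/
theorem ofReal_term_le_form (i j : E) (hrev : ∀ i j, π i * q i j = π j * q j i) :
    ENNReal.ofReal (π i * q i j * (f j - f i) ^ 2) ≤ form q π f := by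
  by_cases hij : i = j
  · simp [hij]
  set F : E → E → ℝ≥0∞ := fun i j => ENNReal.ofReal (π i * q i j * (f j - f i) ^ 2)
  have hsymm : F j i = F i j := by
    simp only [F]
    rw [hrev]; congr 1; ring
  have h2 : F i j + F j i ≤ ∑' a, ∑' b, F a b := by
    calc F i j + F j i ≤ (∑' b, F i b) + ∑' b, F j b :=
          add_le_add (ENNReal.le_tsum j) (ENNReal.le_tsum i)
      _ = ∑ a ∈ ({i, j} : Set E).toFinite.toFinset, ∑' b, F a b := by
          classical
          have : ({i, j} : Set E).toFinite.toFinset = {i, j} := by ext; simp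
          rw [this, Finset.sum_pair hij]
      _ ≤ _ := ENNReal.sum_le_tsum _
  rw [hsymm, ← two_mul] at h2
  calc F i j = 2⁻¹ * (2 * F i j) := by
        rw [← mul_assoc, ENNReal.inv_mul_cancel (by norm_num) (by norm_num), one_mul]
    _ ≤ _ := mul_le_mul_right h2 _

/-- The form on functions of finite support. -/
theorem form_of_support_subset (hq : IsQMatrix q) (hπ : ∀ i, 0 ≤ π i)
    (hrev : ∀ i j, π i * q i j = π j * q j i) (s : Finset E) (hf : ∀ i, i ∉ s → f i = 0) :
    form q π f = ENNReal.ofReal (-∑ i ∈ s, ∑ j ∈ s, π i * q i j * (f i * f j)) := by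
  have hsum : ∀ (i : E) (g : E → ℝ), (∀ j, j ∉ s → g j = 0) →
      HasSum (fun j => q i j * g j) (∑ j ∈ s, q i j * g j) := fun i g hg =>
    hasSum_sum_of_ne_finset_zero fun j hj => by rw [hg j hj, mul_zero]
  have h1 : ∀ i, HasSum (fun j => π i * q i j * (f j - f i) ^ 2)
      (π i * (∑ j ∈ s, q i j * f j ^ 2 - 2 * f i * ∑ j ∈ s, q i j * f j)) := fun i => by
    have := (((hsum i (fun j => f j ^ 2) fun j hj => by simp [hf j hj]).sub
      ((hsum i f hf).mul_left (2 * f i))).add ((hq.hasSum_row i).mul_left (f i ^ 2))).mul_left (π i)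
    exact hasSum_of_eq this (fun j => by ring) (by ring)
  have hnn : ∀ i j, 0 ≤ π i * q i j * (f j - f i) ^ 2 := fun i j => by
    by_cases hij : i = j
    · simp [hij]
    · exact mul_nonneg (mul_nonneg (hπ i) (hq.nonneg_of_ne i j hij)) (sq_nonneg _)
  -- Moving the rates by reversibility turns this into row sums, which vanish. With the zero row
  -- sums used in `h1`, only the cross terms of the squares survive.
  have h2 : HasSum (fun i => π i * ∑ j ∈ s, q i j * f j ^ 2) 0 := by
    have : HasSum (fun i => ∑ j ∈ s, f j ^ 2 * (π j * q j i)) (∑ j ∈ s, f j ^ 2 * (π j * 0)) :=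
      hasSum_sum fun j _ => ((hq.hasSum_row j).mul_left _).mul_left _
    refine hasSum_of_eq this (fun i => ?_) (by simp)
    rw [Finset.mul_sum]
    refine Finset.sum_congr rfl fun j _ => ?_
    rw [← hrev]; ring
  have h3 : HasSum (fun i => π i * (2 * f i * ∑ j ∈ s, q i j * f j))
      (∑ i ∈ s, π i * (2 * f i * ∑ j ∈ s, q i j * f j)) :=
    hasSum_sum_of_ne_finset_zero fun i hi => by simp [hf i hi]
  have h4 := hasSum_of_eq (h2.sub h3)
    (g := fun i => π i * (∑ j ∈ s, q i j * f j ^ 2 - 2 * f i * ∑ j ∈ s, q i j * f j))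
    (fun i => by ring) rfl
  have h5 : form q π f = 2⁻¹ * ENNReal.ofReal
      (0 - ∑ i ∈ s, π i * (2 * f i * ∑ j ∈ s, q i j * f j)) := by
    rw [form, ← h4.tsum_eq, ENNReal.ofReal_tsum_of_nonneg (fun i => ?_) h4.summable]
    · congr 1
      refine tsum_congr fun i => ?_
      rw [← (h1 i).tsum_eq, ENNReal.ofReal_tsum_of_nonneg (hnn i) (h1 i).summable]
    · rw [← (h1 i).tsum_eq]
      exact tsum_nonneg (hnn i)
  have h6 : ∑ i ∈ s, π i * (2 * f i * ∑ j ∈ s, q i j * f j)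
      = 2 * ∑ i ∈ s, ∑ j ∈ s, π i * q i j * (f i * f j) := by
    rw [Finset.mul_sum]
    refine Finset.sum_congr rfl fun i _ => ?_
    rw [Finset.mul_sum, Finset.mul_sum, Finset.mul_sum]
    refine Finset.sum_congr rfl fun j _ => by ring
  have h7 : (2⁻¹ : ℝ≥0∞) = ENNReal.ofReal 2⁻¹ := by
    rw [ENNReal.ofReal_inv_of_pos (by norm_num)]; simp
  rw [h5, h7, ← ENNReal.ofReal_mul (by norm_num), h6]
  congr 1
  ring

theorem form_pointFn (hq : IsQMatrix q) (hπ : ∀ i, 0 ≤ π i)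
    (hrev : ∀ i j, π i * q i j = π j * q j i) (x : E) :
    form q π (pointFn x) = ENNReal.ofReal (π x * -q x x) := by
  rw [form_of_support_subset hq hπ hrev {x} fun i hi => pointFn_of_ne (by simpa using hi)]
  simp [pointFn_self]

end Form

/-! ### Convexity of `t ↦ ⟨P_t f, f⟩` and energy estimates for the semigroup -/

namespace ReversibleChain

variable {E : Type*} (X : ReversibleChain E) {f g : E → ℝ}

theorem isReversibleKernel {t : ℝ} (ht : 0 ≤ t) : IsReversibleKernel X.π (X.p t) where
  pos := X.π_pos
  hasSum := X.π_hasSum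
  nonneg := X.isTransitionFunction.nonneg t ht
  hasSum_row := X.isTransitionFunction.hasSum_row t ht
  balance := X.p_reversible t ht

theorem π_nonneg (i : E) : 0 ≤ X.π i := (X.π_pos i).le

theorem semigroup_add {s t : ℝ} (hs : 0 ≤ s) (ht : 0 ≤ t) (hf : IsL2 X.π f) :
    semigroup X.p s (semigroup X.p t f) = semigroup X.p (s + t) f :=
  (X.isReversibleKernel hs).map_map (X.isReversibleKernel ht)
    (X.isReversibleKernel (add_nonneg hs ht))
    (X.isTransitionFunction.chapman_kolmogorov s t hs ht) hf

theorem semigroup_zero : semigroup X.p 0 f = f := by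
  funext i
  rw [semigroup, tsum_eq_single i fun j hj => by
    rw [X.isTransitionFunction.zero_of_ne i j hj.symm, zero_mul], X.isTransitionFunction.zero_self,
    one_mul]

theorem isL2_semigroup {t : ℝ} (ht : 0 ≤ t) (hf : IsL2 X.π f) : IsL2 X.π (semigroup X.p t f) :=
  (X.isReversibleKernel ht).isL2_map hf

theorem ip_semigroup_semigroup {s t : ℝ} (hs : 0 ≤ s) (ht : 0 ≤ t) (hf : IsL2 X.π f)
    (hg : IsL2 X.π g) :
    ip X.π (semigroup X.p s f) (semigroup X.p t g) = ip X.π (semigroup X.p (t + s) f) g := by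
  rw [← X.semigroup_add ht hs hf]
  exact ((X.isReversibleKernel ht).ip_map_comm (X.isL2_semigroup hs hf) hg).symm

theorem mean_semigroup {t : ℝ} (ht : 0 ≤ t) (hf : IsL2 X.π f) :
    mean X.π (semigroup X.p t f) = mean X.π f := (X.isReversibleKernel ht).mean_map hf

/-- `t ↦ ⟨P_t f, f⟩` is convex on arithmetic progressions. -/
theorem ip_semigroup_convex {t h : ℝ} (ht : 0 ≤ t) (hh : 0 ≤ h) (hf : IsL2 X.π f) :
    ip X.π (semigroup X.p (t + h) f) f - ip X.π (semigroup X.p (t + h + h) f) f ≤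
      ip X.π (semigroup X.p t f) f - ip X.π (semigroup X.p (t + h) f) f := by
  have ht2 : 0 ≤ t / 2 := by positivity
  have hth : 0 ≤ t / 2 + h := by positivity
  have ha := X.isL2_semigroup ht2 hf
  have hb := X.isL2_semigroup hth hf
  -- Convexity is the nonnegativity of `‖P_{t/2} f - P_{t/2+h} f‖²`: by self-adjointness and the
  -- semigroup law the expansion involves only the times `t`, `t + h` and `t + 2h`.
  have h0 := ip_self_nonneg (π := X.π)
    (f := fun i => semigroup X.p (t / 2) f i - semigroup X.p (t / 2 + h) f i) X.π_nonneg
  rw [ip_sub_left X.π_nonneg ha hb (ha.sub X.π_nonneg hb), ip_sub_right X.π_nonneg ha hb ha,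
    ip_sub_right X.π_nonneg ha hb hb, X.ip_semigroup_semigroup ht2 ht2 hf hf,
    X.ip_semigroup_semigroup ht2 hth hf hf, X.ip_semigroup_semigroup hth ht2 hf hf,
    X.ip_semigroup_semigroup hth hth hf hf] at h0
  rw [show t / 2 + t / 2 = t by ring, show t / 2 + h + t / 2 = t + h by ring,
    show t / 2 + (t / 2 + h) = t + h by ring,
    show t / 2 + h + (t / 2 + h) = t + h + h by ring] at h0
  linarith

theorem ip_semigroup_decrement_antitone {h : ℝ} (hh : 0 ≤ h) (hf : IsL2 X.π f) :
    Antitone fun n : ℕ => ip X.π (semigroup X.p (n * h) f) f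
      - ip X.π (semigroup X.p ((n + 1 : ℕ) * h) f) f := by
  refine antitone_nat_of_succ_le fun n => ?_
  have := X.ip_semigroup_convex (t := n * h) (by positivity) hh hf
  rw [show (n : ℝ) * h + h = (n + 1 : ℕ) * h by push_cast; ring,
    show ((n + 1 : ℕ) : ℝ) * h + h = (n + 1 + 1 : ℕ) * h by push_cast; ring] at this
  exact this

/-- Telescope over `n` steps of length `h`. As the decrements decrease, each of them lies between
the one that starts at time `n h` and the one that starts at time `0`. -/
theorem ip_semigroup_bounds {h : ℝ} (hh : 0 ≤ h) (hf : IsL2 X.π f) (n : ℕ) :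
    n * (ip X.π (semigroup X.p (n * h) f) f - ip X.π (semigroup X.p (n * h + h) f) f) ≤
        ip X.π f f - ip X.π (semigroup X.p (n * h) f) f ∧
      ip X.π f f - ip X.π (semigroup X.p (n * h) f) f ≤
        n * (ip X.π f f - ip X.π (semigroup X.p h f) f) := by
  have hanti := X.ip_semigroup_decrement_antitone hh hf
  have htel := Finset.sum_range_sub' (fun n : ℕ => ip X.π (semigroup X.p (n * h) f) f) n
  simp only [Nat.cast_zero, zero_mul, X.semigroup_zero] at htel
  constructor
  · rw [← htel]
    have : ∀ k ∈ Finset.range n, ip X.π (semigroup X.p (n * h) f) f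
        - ip X.π (semigroup X.p (n * h + h) f) f ≤ ip X.π (semigroup X.p (k * h) f) f
      - ip X.π (semigroup X.p ((k + 1 : ℕ) * h) f) f := fun k hk => by
      have := hanti (Finset.mem_range.1 hk).le
      simp only at this
      rwa [show ((n + 1 : ℕ) : ℝ) * h = n * h + h by push_cast; ring] at this
    simpa using Finset.card_nsmul_le_sum _ _ _ this
  · rw [← htel]
    have : ∀ k ∈ Finset.range n, ip X.π (semigroup X.p (k * h) f) f
      - ip X.π (semigroup X.p ((k + 1 : ℕ) * h) f) f ≤
        ip X.π f f - ip X.π (semigroup X.p h f) f := fun k hk => by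
      have := hanti (Nat.zero_le k)
      simpa [X.semigroup_zero] using this
    simpa using Finset.sum_le_card_nsmul _ _ _ this

theorem tendsto_energy (hf : IsL2 X.π f) (hD : form X.q X.π f < ∞) :
    Tendsto (fun t : ℝ => t⁻¹ * (ip X.π f f - ip X.π (semigroup X.p t f) f)) (𝓝[>] 0)
      (𝓝 (form X.q X.π f).toReal) := by
  have h := (ENNReal.tendsto_toReal hD.ne).comp (X.form_eq_limit f hf)
  refine h.congr' ?_
  filter_upwards [self_mem_nhdsWithin] with t ht
  have ht' : 0 ≤ t := le_of_lt ht
  have h1 := ip_sub_left X.π_nonneg hf (X.isL2_semigroup ht' hf) hf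
  simp only [Function.comp]
  rw [← h1, ENNReal.toReal_ofReal]
  · rfl
  · refine mul_nonneg (inv_nonneg.2 ht') ?_
    change 0 ≤ ip X.π (fun i => f i - semigroup X.p t f i) f
    have := ((X.isReversibleKernel ht').hasSum_energy hf).nonneg fun x =>
      mul_nonneg (mul_nonneg (X.π_nonneg _) ((X.isReversibleKernel ht').nonneg _ _)) (sq_nonneg _)
    exact nonneg_of_mul_nonneg_right this two_pos

theorem tendsto_div_natCast {t : ℝ} (ht : 0 < t) :
    Tendsto (fun n : ℕ => t / (n + 1 : ℕ)) atTop (𝓝[>] 0) := by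
  refine tendsto_nhdsWithin_iff.2 ⟨?_, Eventually.of_forall fun n => by
    simp only [Set.mem_Ioi]; positivity⟩
  exact (tendsto_const_div_atTop_nhds_zero_nat t).comp (tendsto_add_atTop_nat 1)

/-- By convexity the difference quotient over `[0, t]` is at most the one over `[0, t/(n+1)]`, which
tends to the energy. -/
theorem ip_sub_semigroup_le {t : ℝ} (ht : 0 < t) (hf : IsL2 X.π f) (hD : form X.q X.π f < ∞) :
    ip X.π f f - ip X.π (semigroup X.p t f) f ≤ t * (form X.q X.π f).toReal := by
  have h := ((X.tendsto_energy hf hD).comp (tendsto_div_natCast ht)).const_mul t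
  refine ge_of_tendsto' h fun n => ?_
  have hn : (0 : ℝ) < (n + 1 : ℕ) := by positivity
  have := (X.ip_semigroup_bounds (h := t / (n + 1 : ℕ)) (by positivity) hf (n + 1)).2
  rw [mul_div_cancel₀ _ hn.ne'] at this
  refine this.trans (le_of_eq ?_)
  simp only [Function.comp]
  field_simp

/-- Regularization: `2 s D(P_s f) ≤ ‖f‖² - ‖P_s f‖²`. -/
theorem form_semigroup_le {s : ℝ} (hs : 0 < s) (hf : IsL2 X.π f) :
    form X.q X.π (semigroup X.p s f) ≤ ENNReal.ofReal ((variance X.π f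
      - variance X.π (semigroup X.p s f)) / (2 * s)) := by
  have hg := X.isL2_semigroup hs.le hf
  have h := (X.form_eq_limit _ hg).comp (tendsto_div_natCast (mul_pos two_pos hs))
  refine le_of_tendsto' h fun n => ENNReal.ofReal_le_ofReal ?_
  have hn : (0 : ℝ) < (n + 1 : ℕ) := by positivity
  -- Here `n + 1` steps of length `h` fill `[0, 2s]`. Since `‖P_s f‖² = ⟨P_{2s} f, f⟩`, the
  -- decrement just after time `2s` is the one that defines the energy of `P_s f` at scale `h`.
  set h := 2 * s / (n + 1 : ℕ) with hh
  have hh0 : 0 < h := by positivity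
  have := (X.ip_semigroup_bounds hh0.le hf (n + 1)).1
  rw [show ((n + 1 : ℕ) : ℝ) * h = 2 * s by rw [hh]; field_simp] at this
  change h⁻¹ * ip X.π (fun i => semigroup X.p s f i - semigroup X.p h (semigroup X.p s f) i)
    (semigroup X.p s f) ≤ _
  rw [ip_sub_left X.π_nonneg hg (X.isL2_semigroup hh0.le hg) hg,
    X.semigroup_add hh0.le hs.le hf, X.ip_semigroup_semigroup hs.le hs.le hf hf,
    X.ip_semigroup_semigroup (add_pos hh0 hs).le hs.le hf hf, variance_eq_ip, variance_eq_ip,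
    X.mean_semigroup hs.le hf, X.ip_semigroup_semigroup hs.le hs.le hf hf,
    show s + s = 2 * s by ring, show s + (h + s) = 2 * s + h by ring]
  rw [le_div_iff₀ (by positivity), hh, inv_div]
  rw [hh] at this
  have h2 : ∀ a : ℝ, ((n + 1 : ℕ) : ℝ) / (2 * s) * a * (2 * s) = (n + 1 : ℕ) * a := fun a => by
    field_simp
  rw [h2]
  linarith

theorem form_semigroup_lt_top {s : ℝ} (hs : 0 < s) (hf : IsL2 X.π f) :
    form X.q X.π (semigroup X.p s f) < ∞ :=
  (X.form_semigroup_le hs hf).trans_lt ENNReal.ofReal_lt_top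

theorem toReal_form_semigroup_le {s : ℝ} (hs : 0 < s) (hf : IsL2 X.π f) :
    2 * s * (form X.q X.π (semigroup X.p s f)).toReal ≤
      variance X.π f - variance X.π (semigroup X.p s f) := by
  have h0 : 0 ≤ variance X.π f - variance X.π (semigroup X.p s f) :=
    sub_nonneg.2 ((X.isReversibleKernel hs.le).variance_map_le hf)
  have := ENNReal.toReal_le_of_le_ofReal (by positivity) (X.form_semigroup_le hs hf)
  rw [le_div_iff₀ (by positivity)] at this
  linarith

theorem form_pointFn_lt_top (x : E) : form X.q X.π (pointFn x) < ∞ := by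
  rw [form_pointFn X.isQMatrix X.π_nonneg X.q_reversible]; exact ENNReal.ofReal_lt_top

/-- `P_t (δ_x / π_x) = p_t(x, ·) / π`. -/
theorem semigroup_pointFn_div {t : ℝ} (ht : 0 ≤ t) (x y : E) :
    semigroup X.p t (fun z => (X.π x)⁻¹ * pointFn x z) y = X.p t x y / X.π y := by
  have h1 : semigroup X.p t (fun z => (X.π x)⁻¹ * pointFn x z) y = X.p t y x * (X.π x)⁻¹ := by
    rw [← tsum_mul_pointFn (fun z => X.p t y z * (X.π x)⁻¹)]
    exact tsum_congr fun z => by ring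
  rw [h1]
  have := X.p_reversible t ht x y
  have hx := (X.π_pos x).ne'
  have hy := (X.π_pos y).ne'
  field_simp
  linarith

theorem tvNorm_nonneg {μ ν : E → ℝ} : 0 ≤ tvNorm μ ν := tsum_nonneg fun _ => abs_nonneg _

/-- The total variation distance is the `L¹(π)` norm of the density `p_t(x, ·)/π` minus its mean
`1`, and the `L¹` norm is at most the `L²` norm. -/
theorem tvNorm_sq_le {t : ℝ} (ht : 0 ≤ t) (x : E) :
    tvNorm (X.p t x) X.π ^ 2 ≤
      variance X.π (semigroup X.p t fun z => (X.π x)⁻¹ * pointFn x z) := by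
  set f : E → ℝ := fun z => (X.π x)⁻¹ * pointFn x z with hf
  have hf2 : IsL2 X.π f := (isL2_pointFn x).const_mul _
  have hm : mean X.π f = 1 := by
    have : mean X.π f = (X.π x)⁻¹ * mean X.π (pointFn x) := by
      rw [mean, mean, ← tsum_mul_left]
      exact tsum_congr fun i => by simp only [hf]; ring
    rw [this, mean_pointFn, inv_mul_cancel₀ (X.π_pos x).ne']
  have hg := X.isL2_semigroup ht hf2
  have htv : tvNorm (X.p t x) X.π = normOne X.π fun i => semigroup X.p t f i - 1 := by
    refine tsum_congr fun y => ?_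
    have hy := X.π_pos y
    change _ = X.π y * |semigroup X.p t f y - 1|
    rw [hf, X.semigroup_pointFn_div ht]
    rw [← abs_of_pos hy, ← abs_mul, abs_of_pos hy]
    congr 1
    field_simp
  rw [htv, variance_eq_ip_centered X.π_nonneg X.π_hasSum hg, X.mean_semigroup ht hf2, hm]
  exact normOne_sq_le X.π_nonneg X.π_hasSum
    (hg.sub X.π_nonneg (isL2_const X.π_hasSum.summable 1))

theorem variance_semigroup_antitone {s t : ℝ} (hs : 0 ≤ s) (hst : s ≤ t) (hf : IsL2 X.π f) :
    variance X.π (semigroup X.p t f) ≤ variance X.π (semigroup X.p s f) := by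
  have := (X.isReversibleKernel (sub_nonneg.2 hst)).variance_map_le (X.isL2_semigroup hs hf)
  have h2 := X.semigroup_add (sub_nonneg.2 hst) hs hf
  rw [sub_add_cancel] at h2
  rw [← h2]
  exact this

end ReversibleChain

end MarkovChain

/-! ### Poincaré, exponential, strong, algebraic and ordinary ergodicity; Nash implies strong
ergodicity -/

namespace MarkovChain

/-- Turns decay along integer multiples of a time step into decay in continuous time, at the cost of
one factor `r⁻¹`. -/
theorem pow_floor_le_exp {r : ℝ} (hr0 : 0 < r) (hr1 : r ≤ 1) (x : ℝ) :
    r ^ ⌊x⌋₊ ≤ r⁻¹ * Real.exp (Real.log r * x) := by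
  have h1 : r⁻¹ = Real.exp (-Real.log r) := by rw [Real.exp_neg, Real.exp_log hr0]
  have h2 : r ^ ⌊x⌋₊ = Real.exp (Real.log r * ⌊x⌋₊) := by
    rw [mul_comm, Real.exp_nat_mul, Real.exp_log hr0]
  rw [h1, h2, ← Real.exp_add, Real.exp_le_exp]
  nlinarith [Nat.lt_floor_add_one x, Real.log_nonpos hr0.le hr1]

theorem hasSum_prod_swap {α β : Type*} {F : α → β → ℝ} {a : ℝ}
    (h : HasSum (fun x : α × β => F x.1 x.2) a) : HasSum (fun x : β × α => F x.2 x.1) a :=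
  (Equiv.prodComm β α).hasSum_iff.2 h

theorem mean_const_mul {E : Type*} (π : E → ℝ) (c : ℝ) (f : E → ℝ) :
    mean π (fun i => c * f i) = c * mean π f := by
  rw [mean, mean, ← tsum_mul_left]
  exact tsum_congr fun i => by ring

/-- A log-convex sequence with geometric decay of rate `ρ` decays at that rate from the start. -/
theorem le_of_logConvex_of_le_geometric {a : ℕ → ℝ} (h0 : ∀ n, 0 ≤ a n)
    (hlc : ∀ n, a (n + 1) ^ 2 ≤ a n * a (n + 2)) {K ρ : ℝ} (hρ : 0 < ρ)
    (hK : ∀ n, a n ≤ K * ρ ^ n) : a 1 ≤ ρ * a 0 := by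
  by_contra! hlt
  have ha1 : 0 < a 1 := lt_of_le_of_lt (mul_nonneg hρ.le (h0 0)) hlt
  have ha0 : 0 < a 0 := by
    refine (h0 0).lt_of_ne fun h => ?_
    have := hlc 0
    rw [← h] at this
    nlinarith
  -- By log-convexity the successive ratios are nondecreasing, so an initial ratio `r > ρ` would
  -- force `a n ≥ a 0 * r ^ n`, against the geometric bound.
  set r := a 1 / a 0 with hr
  have hρr : ρ < r := by rw [hr, lt_div_iff₀ ha0]; exact hlt
  have hr0 : 0 < r := hρ.trans hρr
  have hstep : ∀ n, 0 < a n ∧ r * a n ≤ a (n + 1) := by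
    intro n
    induction n with
    | zero => exact ⟨ha0, by rw [hr]; field_simp; rfl⟩
    | succ n ih =>
      have hpos : 0 < a (n + 1) := lt_of_lt_of_le (mul_pos hr0 ih.1) ih.2
      refine ⟨hpos, ?_⟩
      have h1 := hlc n
      have h2 : r * a n * a (n + 1) ≤ a n * a (n + 2) := by nlinarith
      have h3 : a n * (r * a (n + 1)) ≤ a n * a (n + 2) := by linarith
      exact le_of_mul_le_mul_left h3 ih.1
  have hgeo : ∀ n, a 0 * r ^ n ≤ a n := by
    intro n
    induction n with
    | zero => simp
    | succ n ih =>
      refine le_trans ?_ (hstep n).2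
      rw [pow_succ]
      nlinarith
  have h1 : ∀ n, a 0 * (r / ρ) ^ n ≤ K := fun n => by
    have := (hgeo n).trans (hK n)
    rw [div_pow, ← mul_div_assoc, div_le_iff₀ (by positivity)]
    exact this
  have h2 : Tendsto (fun n : ℕ => a 0 * (r / ρ) ^ n) atTop atTop :=
    (tendsto_pow_atTop_atTop_of_one_lt ((one_lt_div hρ).2 hρr)).const_mul_atTop ha0
  obtain ⟨n, hn⟩ := (h2.eventually_gt_atTop K).exists
  exact absurd (h1 n) (not_le.2 hn)

/-- Dominated convergence for the quadratic form of a reversible kernel. -/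
theorem IsReversibleKernel.tendsto_ip_map {E ι : Type*} {π : E → ℝ} {k : E → E → ℝ}
    (K : IsReversibleKernel π k) {l : Filter ι} {F : ι → E → ℝ} {f u : E → ℝ}
    (hu : IsL2 π u) (hF : ∀ n i, |F n i| ≤ u i) (hf : ∀ i, Tendsto (fun n => F n i) l (𝓝 (f i))) :
    Tendsto (fun n => ip π (kernelMap k (F n)) (F n)) l (𝓝 (ip π (kernelMap k f) f)) := by
  refine tendsto_ip_of_dominated K.pos' (K.isL2_map hu) hu (fun n i => ?_) hF (fun i => ?_) hf
  · have h1 : ∀ j, ‖k i j * F n j‖ ≤ k i j * u j := fun j => by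
      rw [Real.norm_eq_abs, abs_mul, abs_of_nonneg (K.nonneg i j)]
      exact mul_le_mul_of_nonneg_left (hF n j) (K.nonneg i j)
    exact tsum_of_norm_bounded (K.hasSum_map hu i) h1
  · refine tendsto_tsum_of_dominated_convergence (K.summable_row hu i)
      (fun j => (hf j).const_mul _) (Eventually.of_forall fun n j => ?_)
    rw [Real.norm_eq_abs, abs_mul, abs_of_nonneg (K.nonneg i j)]
    exact mul_le_mul_of_nonneg_left (hF n j) (K.nonneg i j)

namespace ReversibleChain

variable {E : Type*} {X : ReversibleChain E} {f g : E → ℝ}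

theorem isL2_sub_const (X : ReversibleChain E) (hf : IsL2 X.π f) (c : ℝ) :
    IsL2 X.π fun i => f i - c :=
  hf.sub X.π_nonneg (isL2_const X.π_hasSum.summable c)

/-- Apply Nash to `f - π(f)`: its squared `L¹` norm is at most the variance `v`, so `v ≤ C D^{1/a}
v^{1/b}`. Divide by `v^{1/b}` and raise to the power `a`. -/
theorem Nash.poincare (h : X.Nash) : X.Poincare := by
  obtain ⟨C, a, b, hC, hab, hN⟩ := h
  have ha := hab.pos
  have hb := hab.symm.pos
  refine ⟨C ^ a, Real.rpow_pos_of_pos hC a, fun f hf hD => ?_⟩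
  set m := mean X.π f
  have hg := X.isL2_sub_const hf m
  have h1 := hN _ hg (by rwa [form_sub_const])
  rw [form_sub_const, variance_sub_const X.π_nonneg X.π_hasSum hf] at h1
  have h2 := normOne_sq_le X.π_nonneg X.π_hasSum hg
  rw [← variance_eq_ip_centered X.π_nonneg X.π_hasSum hf] at h2
  set v := variance X.π f
  set D := (form X.q X.π f).toReal
  have hD0 : 0 ≤ D := ENNReal.toReal_nonneg
  rcases (variance_nonneg X.π_nonneg X.π_hasSum hf).eq_or_lt with hv | hv
  · change v ≤ _
    rw [show v = 0 from hv.symm]; positivity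
  have hv : 0 < v := hv
  have h3 : normOne X.π (fun i => f i - m) ^ (2 / b) ≤ v ^ (1 / b) := by
    have := Real.rpow_le_rpow (sq_nonneg _) h2 (one_div_nonneg.2 hb.le)
    rw [← Real.rpow_natCast, ← Real.rpow_mul (normOne_nonneg X.π_nonneg)] at this
    convert this using 2
    push_cast; ring
  have h4 : v ≤ C * D ^ (1 / a) * v ^ (1 / b) :=
    h1.trans (mul_le_mul_of_nonneg_left h3 (by positivity))
  have h5 : v = v ^ (1 / a) * v ^ (1 / b) := by
    rw [← Real.rpow_add hv, show 1 / a + 1 / b = 1 by simpa using hab.inv_add_inv_eq_one,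
      Real.rpow_one]
  have h6 : v ^ (1 / a) ≤ C * D ^ (1 / a) := by
    refine le_of_mul_le_mul_right ?_ (Real.rpow_pos_of_pos hv (1 / b))
    rw [← h5]; exact h4
  have h7 := Real.rpow_le_rpow (by positivity) h6 ha.le
  rwa [Real.mul_rpow hC.le (by positivity), ← Real.rpow_mul hv.le, ← Real.rpow_mul hD0,
    one_div_mul_cancel ha.ne', Real.rpow_one, Real.rpow_one] at h7

/-- Poincaré is applied to `P_s f`, whose energy the regularization bound controls. This discrete
contraction replaces the differential inequality for the variance. -/
theorem variance_semigroup_add_le_of_poincare {C : ℝ} (hC : 0 < C)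
    (hP : ∀ f : E → ℝ, IsL2 X.π f → form X.q X.π f < ∞ →
      variance X.π f ≤ C * (form X.q X.π f).toReal) (hf : IsL2 X.π f) {s : ℝ} (hs : 0 < s) :
    (1 + 2 * s / C) * variance X.π (semigroup X.p s f) ≤ variance X.π f := by
  have h1 := X.toReal_form_semigroup_le hs hf
  have h2 := hP _ (X.isL2_semigroup hs.le hf) (X.form_semigroup_lt_top hs hf)
  have h3 : 2 * s / C * variance X.π (semigroup X.p s f) ≤
      2 * s * (form X.q X.π (semigroup X.p s f)).toReal := by
    rw [div_mul_eq_mul_div, div_le_iff₀ hC]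
    nlinarith
  linarith

/-- Iterate the contraction over unit time steps and apply it to `δ_x/π_x`. The rate is halved
because total variation is bounded by the root of the variance. -/
theorem Poincare.exponentiallyErgodic (h : X.Poincare) : X.ExponentiallyErgodic := by
  obtain ⟨C, hC, hP⟩ := h
  set r : ℝ := (1 + 2 / C)⁻¹ with hr
  have h2C : 0 < 2 / C := by positivity
  have hr0 : 0 < r := by positivity
  have hr1 : r < 1 := inv_lt_one_of_one_lt₀ (by linarith)
  have hdecay : ∀ f : E → ℝ, IsL2 X.π f → ∀ n : ℕ,
      variance X.π (semigroup X.p n f) ≤ r ^ n * variance X.π f := by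
    intro f hf n
    induction n with
    | zero => simp [X.semigroup_zero]
    | succ n ih =>
      have h1 := variance_semigroup_add_le_of_poincare hC hP
        (X.isL2_semigroup (Nat.cast_nonneg n) hf) one_pos
      rw [X.semigroup_add zero_le_one (Nat.cast_nonneg n) hf] at h1
      rw [show ((n + 1 : ℕ) : ℝ) = 1 + n by push_cast; ring, pow_succ]
      have h2 : variance X.π (semigroup X.p (1 + n) f) ≤ r * variance X.π (semigroup X.p n f) := by
        rw [hr, inv_mul_eq_div, le_div_iff₀ (by positivity), mul_comm]
        simpa using h1
      nlinarith
  refine ⟨-Real.log r / 2, by linarith [Real.log_neg hr0 hr1], fun x => Real.sqrt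
    (r⁻¹ * variance X.π fun z => (X.π x)⁻¹ * pointFn x z), fun x t ht => ?_⟩
  set f : E → ℝ := fun z => (X.π x)⁻¹ * pointFn x z
  have hf : IsL2 X.π f := (isL2_pointFn x).const_mul _
  have hv := variance_nonneg X.π_nonneg X.π_hasSum hf
  have h1 : variance X.π (semigroup X.p t f) ≤
      r⁻¹ * Real.exp (Real.log r * t) * variance X.π f :=
    ((X.variance_semigroup_antitone (Nat.cast_nonneg _) (Nat.floor_le ht) hf).trans
      (hdecay f hf _)).trans (mul_le_mul_of_nonneg_right (pow_floor_le_exp hr0 hr1.le t) hv)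
  refine abs_le_of_sq_le_sq' ?_ (by positivity) |>.2
  refine (X.tvNorm_sq_le ht x).trans (h1.trans (le_of_eq ?_))
  rw [mul_pow, Real.sq_sqrt (by positivity), ← Real.exp_nat_mul]
  have : ((2 : ℕ) : ℝ) * (-(-Real.log r / 2) * t) = Real.log r * t := by push_cast; ring
  rw [this]
  ring

theorem summable_abs_sub (X : ReversibleChain E) {t : ℝ} (ht : 0 ≤ t) (x : E) :
    Summable fun j => |X.p t x j - X.π j| :=
  ((X.isTransitionFunction.hasSum_row t ht x).sub X.π_hasSum).summable.abs

theorem tvNorm_le_two (X : ReversibleChain E) {t : ℝ} (ht : 0 ≤ t) (x : E) :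
    tvNorm (X.p t x) X.π ≤ 2 := by
  have h := (X.isTransitionFunction.hasSum_row t ht x).add X.π_hasSum
  refine (hasSum_le (fun j => ?_) (X.summable_abs_sub ht x).hasSum h).trans (by norm_num)
  have h1 := X.isTransitionFunction.nonneg t ht x j
  have h2 := X.π_nonneg j
  rw [abs_le]; constructor <;> linarith

theorem bddAbove_tvNorm (X : ReversibleChain E) {t : ℝ} (ht : 0 ≤ t) :
    BddAbove (Set.range fun x => tvNorm (X.p t x) X.π) :=
  ⟨2, by rintro _ ⟨x, rfl⟩; exact X.tvNorm_le_two ht x⟩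

theorem abs_semigroup_sub_mean_le (X : ReversibleChain E) {t M : ℝ} (ht : 0 ≤ t)
    (hf : ∀ i, |f i| ≤ M) (x : E) :
    |semigroup X.p t f x - mean X.π f| ≤ M * tvNorm (X.p t x) X.π := by
  have hL2 := isL2_of_bounded X.π_nonneg X.π_hasSum.summable hf
  have h := ((X.isReversibleKernel ht).hasSum_map hL2 x).sub
    (hL2.summable X.π_nonneg X.π_hasSum.summable).hasSum
  have h2 := tsum_of_norm_bounded ((X.summable_abs_sub ht x).hasSum.mul_left M)
    (f := fun j => X.p t x j * f j - X.π j * f j) fun j => by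
      rw [← sub_mul, Real.norm_eq_abs, abs_mul, mul_comm]
      exact mul_le_mul_of_nonneg_right (hf j) (abs_nonneg _)
  rw [h.tsum_eq] at h2
  exact h2

/-- By invariance of `π` and conservation of mass, `p_{s+t}(x, j) - π_j = ∑_k (p_s(x, k) - π_k)
(p_t(k, j) - π_j)`. Take absolute values and sum over `j` first. -/
theorem tvNorm_add_le (X : ReversibleChain E) {s t d : ℝ} (hs : 0 ≤ s) (ht : 0 ≤ t)
    (hd : ∀ y, tvNorm (X.p t y) X.π ≤ d) (x : E) :
    tvNorm (X.p (s + t) x) X.π ≤ d * tvNorm (X.p s x) X.π := by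
  have hA := X.summable_abs_sub hs x
  have hsum : Summable fun k => |X.p s x k - X.π k| * tvNorm (X.p t k) X.π :=
    Summable.of_nonneg_of_le (fun k => mul_nonneg (abs_nonneg _) tvNorm_nonneg)
      (fun k => mul_le_mul_of_nonneg_left (hd k) (abs_nonneg _)) (hA.mul_right d)
  have h0 : ∀ k, HasSum (fun j => |X.p s x k - X.π k| * |X.p t k j - X.π j|)
      (|X.p s x k - X.π k| * tvNorm (X.p t k) X.π) := fun k =>
    (X.summable_abs_sub ht k).hasSum.mul_left _
  have h1 : HasSum (fun z : E × E => |X.p s x z.1 - X.π z.1| * |X.p t z.1 z.2 - X.π z.2|)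
      (∑' k, |X.p s x k - X.π k| * tvNorm (X.p t k) X.π) := by
    refine hasSum_prod_of_nonneg
      (F := fun z : E × E => |X.p s x z.1 - X.π z.1| * |X.p t z.1 z.2 - X.π z.2|)
      (g := fun k => |X.p s x k - X.π k| * tvNorm (X.p t k) X.π) (fun z => ?_) h0 hsum.hasSum
    positivity
  have h2 : HasSum (fun z : E × E => |X.p s x z.2 - X.π z.2| * |X.p t z.2 z.1 - X.π z.1|)
      (∑' k, |X.p s x k - X.π k| * tvNorm (X.p t k) X.π) :=
    hasSum_prod_swap (F := fun k j => |X.p s x k - X.π k| * |X.p t k j - X.π j|) h1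
  have h5 : ∀ j, Summable fun k => |X.p s x k - X.π k| * |X.p t k j - X.π j| := fun j =>
    h2.summable.prod_factor j
  have h3 : HasSum (fun j => ∑' k, |X.p s x k - X.π k| * |X.p t k j - X.π j|)
      (∑' k, |X.p s x k - X.π k| * tvNorm (X.p t k) X.π) :=
    h2.prod_fiberwise fun j => (h5 j).hasSum
  have h4 : ∀ j, |X.p (s + t) x j - X.π j| ≤
      ∑' k, |X.p s x k - X.π k| * |X.p t k j - X.π j| := fun j => by
    have e1 := X.isTransitionFunction.chapman_kolmogorov s t hs ht x j
    have e2 : HasSum (fun k => X.π k * X.p t k j) (X.π j) := by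
      have := (X.isTransitionFunction.hasSum_row t ht j).mul_left (X.π j)
      exact hasSum_of_eq this (fun k => X.p_reversible t ht k j) (by ring)
    have e3 := (X.isTransitionFunction.hasSum_row s hs x).mul_right (X.π j)
    have e4 := X.π_hasSum.mul_right (X.π j)
    have e5 := hasSum_of_eq ((e1.sub e2).sub (e3.sub e4))
      (g := fun k => (X.p s x k - X.π k) * (X.p t k j - X.π j)) (fun k => by ring) rfl
    have e6 := tsum_of_norm_bounded (h5 j).hasSum
      (f := fun k => (X.p s x k - X.π k) * (X.p t k j - X.π j))
      (fun k => by rw [Real.norm_eq_abs, abs_mul])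
    rw [e5.tsum_eq] at e6
    simpa using e6
  calc tvNorm (X.p (s + t) x) X.π
      ≤ ∑' j, ∑' k, |X.p s x k - X.π k| * |X.p t k j - X.π j| :=
        (X.summable_abs_sub (add_nonneg hs ht) x).tsum_le_tsum h4 h3.summable
    _ = ∑' k, |X.p s x k - X.π k| * tvNorm (X.p t k) X.π := h3.tsum_eq
    _ ≤ ∑' k, |X.p s x k - X.π k| * d := hsum.tsum_le_tsum
        (fun k => mul_le_mul_of_nonneg_left (hd k) (abs_nonneg _)) (hA.mul_right d)
    _ = d * tvNorm (X.p s x) X.π := by rw [tsum_mul_right, mul_comm, tvNorm]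

/-- At some time `T` the worst distance is at most `1/2`; submultiplicativity then halves it every
`T` units of time. -/
theorem StronglyErgodic.exponentiallyErgodic (h : X.StronglyErgodic) :
    X.ExponentiallyErgodic := by
  obtain ⟨T, hT, hT0⟩ := ((h.eventually_lt_const (show (0 : ℝ) < 1 / 2 by norm_num)).and
    (eventually_gt_atTop 0)).exists
  have hd : ∀ y, tvNorm (X.p T y) X.π ≤ 1 / 2 := fun y =>
    (le_ciSup (X.bddAbove_tvNorm hT0.le) y).trans hT.le
  have hiter : ∀ (n : ℕ) (s : ℝ), 0 ≤ s → ∀ x,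
      tvNorm (X.p (s + n * T) x) X.π ≤ (1 / 2) ^ n * 2 := by
    intro n
    induction n with
    | zero => intro s hs x; simpa using X.tvNorm_le_two hs x
    | succ n ih =>
      intro s hs x
      have h1 := X.tvNorm_add_le (s := s + n * T) (by positivity) hT0.le hd x
      rw [show s + (n + 1 : ℕ) * T = s + n * T + T by push_cast; ring, pow_succ]
      linarith [ih s hs x]
  have hlog : Real.log (1 / 2) < 0 := Real.log_neg (by norm_num) (by norm_num)
  refine ⟨-Real.log (1 / 2) / T, div_pos (by linarith) hT0, fun _ => (1 / 2)⁻¹ * 2,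
    fun x t ht => ?_⟩
  have h1 := hiter ⌊t / T⌋₊ (t - ⌊t / T⌋₊ * T) (by
    have := Nat.floor_le (div_nonneg ht hT0.le)
    rw [le_div_iff₀ hT0] at this
    linarith) x
  rw [sub_add_cancel] at h1
  have h2 := pow_floor_le_exp (r := 1 / 2) (by norm_num) (by norm_num) (t / T)
  have h3 : Real.log (1 / 2) * (t / T) = -(-Real.log (1 / 2) / T) * t := by ring
  rw [h3] at h2
  linarith

theorem Poincare.l2AlgebraicallyErgodic (h : X.Poincare) : X.L2AlgebraicallyErgodic := by
  obtain ⟨C, hC, hP⟩ := h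
  have hvar : ∀ f : E → ℝ, IsL2 X.π f → ∀ c₁ c₂ : ℝ,
      variance X.π (fun i => c₁ * f i + c₂) = c₁ ^ 2 * variance X.π f := by
    intro f hf c₁ c₂
    have h1 := hf.const_mul c₁
    have h2 := variance_sub_const X.π_nonneg X.π_hasSum h1 (-c₂)
    simp only [sub_neg_eq_add] at h2
    rw [h2, variance_eq_ip, variance_eq_ip, ip_smul_left, ip_comm, ip_smul_left,
      mean_const_mul]
    ring
  -- The variance itself serves as `V`. A single contraction over the whole time `t` gives `(2t/C)
  -- Var (P_t f) ≤ Var f`, that is, decay of order `1/t`.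
  refine ⟨fun f => ENNReal.ofReal (variance X.π f), C / 2, 2, by positivity, by norm_num,
    fun f hf c₁ c₂ => ?_, fun _ _ => ENNReal.ofReal_lt_top, fun f hf t ht => ?_⟩
  · change ENNReal.ofReal (variance X.π fun i => c₁ * f i + c₂) = _
    rw [hvar f hf, ENNReal.ofReal_mul (sq_nonneg _)]
  · rw [show (2 : ℝ) - 1 = 1 by norm_num, Real.rpow_one, ← ENNReal.ofReal_mul (by positivity),
      ← ENNReal.ofReal_div_of_pos ht]
    refine ENNReal.ofReal_le_ofReal ?_
    have h1 := variance_semigroup_add_le_of_poincare hC hP hf ht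
    have h2 := variance_nonneg X.π_nonneg X.π_hasSum (X.isL2_semigroup ht.le hf)
    rw [le_div_iff₀ ht]
    have h3 : 2 * t / C * variance X.π (semigroup X.p t f) ≤ variance X.π f := by linarith
    rw [div_mul_eq_mul_div, div_le_iff₀ hC] at h3
    linarith

/-- The density `δ_x/π_x` has finite support, so `V` is finite there and the variance bound for it
tends to zero. -/
theorem L2AlgebraicallyErgodic.ordinarilyErgodic (h : X.L2AlgebraicallyErgodic) :
    X.OrdinarilyErgodic := by
  obtain ⟨V, C, b, hC, hb, -, hfin, hV⟩ := h
  intro x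
  set f : E → ℝ := fun z => (X.π x)⁻¹ * pointFn x z
  have hf : IsL2 X.π f := (isL2_pointFn x).const_mul _
  have hVf : V f < ∞ := hfin f ((pointFn_support_finite x).subset fun y hy => by
    simp only [Function.mem_support, f] at hy ⊢
    exact right_ne_zero_of_mul hy)
  have h1 : Tendsto (fun t : ℝ => C * (V f).toReal / t ^ (b - 1)) atTop (𝓝 0) :=
    (tendsto_rpow_atTop (by linarith)).const_div_atTop _
  have h2 : Tendsto (fun t : ℝ => Real.sqrt (C * (V f).toReal / t ^ (b - 1))) atTop (𝓝 0) := by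
    simpa using h1.sqrt
  refine squeeze_zero' (Eventually.of_forall fun t => tvNorm_nonneg) ?_ h2
  filter_upwards [eventually_gt_atTop 0] with t ht
  refine Real.le_sqrt_of_sq_le ((X.tvNorm_sq_le ht.le x).trans ?_)
  have h3 := hV f hf t ht
  have ht' : 0 < t ^ (b - 1) := Real.rpow_pos_of_pos ht _
  rw [← ENNReal.ofReal_toReal hVf.ne, ← ENNReal.ofReal_mul hC.le,
    ← ENNReal.ofReal_div_of_pos ht', ENNReal.ofReal_le_ofReal_iff (by positivity)] at h3
  exact h3

/-- The centered correlation of a finitely supported function inherits the rate of exponential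
ergodicity. -/
theorem exists_ip_semigroup_sub_le {ε : ℝ} {C : E → ℝ}
    (hE : ∀ x t, 0 ≤ t → tvNorm (X.p t x) X.π ≤ C x * Real.exp (-ε * t))
    (hf : f.support.Finite) :
    ∃ K, ∀ t, 0 ≤ t → ip X.π (semigroup X.p t f) f - mean X.π f ^ 2 ≤
      K * Real.exp (-ε * t) := by
  obtain ⟨M, hM0, hM⟩ : ∃ M, 0 ≤ M ∧ ∀ i, |f i| ≤ M := by
    refine ⟨∑ i ∈ hf.toFinset, |f i|, Finset.sum_nonneg fun i _ => abs_nonneg _, fun i => ?_⟩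
    by_cases hi : f i = 0
    · rw [hi, abs_zero]; exact Finset.sum_nonneg fun i _ => abs_nonneg _
    · exact Finset.single_le_sum (f := fun i => |f i|) (fun i _ => abs_nonneg _)
        (hf.mem_toFinset.2 hi)
  have hL2 : IsL2 X.π f := isL2_of_finite_support hf
  -- Pairing with `f` involves only the finitely many constants `C i` on its support, so no
  -- integrability of `C` is needed.
  refine ⟨∑ i ∈ hf.toFinset, X.π i * (M * C i * M), fun t ht => ?_⟩
  have h1 : ip X.π (semigroup X.p t f) f - mean X.π f ^ 2
      = ip X.π (fun i => semigroup X.p t f i - mean X.π f) f := by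
    rw [ip_sub_left X.π_nonneg (X.isL2_semigroup ht hL2)
      (isL2_const X.π_hasSum.summable _) hL2]
    have := ip_smul_left (π := X.π) (f := fun _ => 1) (g := f) (mean X.π f)
    simp only [mul_one] at this
    rw [this, ip_one_left, sq]
  have h2 : ip X.π (fun i => semigroup X.p t f i - mean X.π f) f
      = ∑ i ∈ hf.toFinset, X.π i * ((semigroup X.p t f i - mean X.π f) * f i) :=
    tsum_eq_sum fun i hi => by
      have : f i = 0 := by simpa using hi
      simp [this]
  rw [h1, h2, Finset.sum_mul]
  refine Finset.sum_le_sum fun i _ => ?_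
  rw [mul_assoc]
  refine mul_le_mul_of_nonneg_left ?_ (X.π_nonneg i)
  have h3 := X.abs_semigroup_sub_mean_le ht hM i
  calc (semigroup X.p t f i - mean X.π f) * f i ≤ |semigroup X.p t f i - mean X.π f| * |f i| := by
        rw [← abs_mul]; exact le_abs_self _
    _ ≤ (M * (C i * Real.exp (-ε * t))) * M :=
        mul_le_mul (h3.trans (mul_le_mul_of_nonneg_left (hE i t ht) hM0)) (hM i) (abs_nonneg _)
          (mul_nonneg hM0 (tvNorm_nonneg.trans (hE i t ht)))
    _ = M * C i * M * Real.exp (-ε * t) := by ring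

theorem ip_semigroup_centered (X : ReversibleChain E) {t : ℝ} (ht : 0 ≤ t) (hf : IsL2 X.π f) :
    ip X.π (semigroup X.p t fun i => f i - mean X.π f) (fun i => f i - mean X.π f) =
      ip X.π (semigroup X.p t f) f - mean X.π f ^ 2 := by
  set m := mean X.π f
  have hm := isL2_const X.π_hasSum.summable m
  have hPf := X.isL2_semigroup ht hf
  have h1 : semigroup X.p t (fun i => f i - m) = fun i => semigroup X.p t f i - m := by
    have e1 := (X.isReversibleKernel ht).map_sub hf hm
    have e2 := (X.isReversibleKernel ht).map_const m
    change kernelMap (X.p t) _ = fun i => kernelMap (X.p t) f i - m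
    rw [e1, e2]
  have h2 : ∀ g : E → ℝ, ip X.π (fun _ => m) g = m * mean X.π g := fun g => by
    have := ip_smul_left (π := X.π) (f := fun _ => 1) (g := g) m
    simp only [mul_one] at this
    rw [this, ip_one_left]
  rw [h1, ip_sub_left X.π_nonneg hPf hm (X.isL2_sub_const hf m), h2,
    ip_sub_right X.π_nonneg hf hm hPf, ip_comm (g := fun _ => m), h2, X.mean_semigroup ht hf,
    mean_sub_const X.π_hasSum (hf.summable X.π_nonneg X.π_hasSum.summable)]
  ring

/-- For the centered `g` the sequence `n ↦ ⟨P_{nh} g, g⟩` is log-convex by Cauchy–Schwarz, so its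
exponential rate holds from the first step. This removes the constant `K`, which depends on `f`. -/
theorem ip_semigroup_le_exp_of_finite_support {ε : ℝ} {C : E → ℝ}
    (hE : ∀ x t, 0 ≤ t → tvNorm (X.p t x) X.π ≤ C x * Real.exp (-ε * t))
    (hf : f.support.Finite) {h : ℝ} (hh : 0 ≤ h) :
    ip X.π (semigroup X.p h f) f - mean X.π f ^ 2 ≤ Real.exp (-ε * h) * variance X.π f := by
  have hL2 : IsL2 X.π f := isL2_of_finite_support hf
  obtain ⟨K, hK⟩ := exists_ip_semigroup_sub_le hE hf
  set g : E → ℝ := fun i => f i - mean X.π f with hgdef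
  have hg : IsL2 X.π g := X.isL2_sub_const hL2 _
  set a : ℕ → ℝ := fun n => ip X.π (semigroup X.p (n * h) g) g with ha
  have hsq : ∀ s t : ℝ, 0 ≤ s → 0 ≤ t → ip X.π (semigroup X.p (s + t) g) g
      = ip X.π (semigroup X.p t g) (semigroup X.p s g) := fun s t hs ht =>
    (X.ip_semigroup_semigroup ht hs hg hg).symm
  have key := le_of_logConvex_of_le_geometric (a := a) (K := K) (ρ := Real.exp (-ε * h))
    (fun n => by
      have h0 : (0 : ℝ) ≤ n * h / 2 := by positivity
      have := hsq _ _ h0 h0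
      rw [add_halves] at this
      simp only [ha]
      rw [this]; exact ip_self_nonneg X.π_nonneg)
    (fun n => by
      have h0 : (0 : ℝ) ≤ n * h / 2 := by positivity
      have h1 : (0 : ℝ) ≤ n * h / 2 + h := by positivity
      have e1 := hsq _ _ h0 h0
      have e2 := hsq _ _ h1 h1
      have e3 := hsq _ _ h1 h0
      rw [show (n : ℝ) * h / 2 + n * h / 2 = n * h by ring] at e1
      rw [show (n : ℝ) * h / 2 + h + (n * h / 2 + h) = (n + 2 : ℕ) * h by push_cast; ring] at e2
      rw [show (n : ℝ) * h / 2 + h + n * h / 2 = (n + 1 : ℕ) * h by push_cast; ring] at e3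
      simp only [ha]
      rw [e1, e2, e3]
      exact ip_mul_self_le X.π_nonneg (X.isL2_semigroup h0 hg) (X.isL2_semigroup h1 hg))
    (Real.exp_pos _)
    (fun n => by
      have := hK (n * h) (by positivity)
      simp only [ha]
      rw [hgdef, X.ip_semigroup_centered (by positivity) hL2, ← Real.exp_nat_mul]
      rwa [show (n : ℝ) * (-ε * h) = -ε * (n * h) by ring])
  simp only [ha, Nat.cast_one, one_mul, Nat.cast_zero, zero_mul, X.semigroup_zero] at key
  rw [hgdef, X.ip_semigroup_centered hh hL2,
    ← variance_eq_ip_centered X.π_nonneg X.π_hasSum hL2] at key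
  exact key

/-- With the variance as prefactor, the decay of correlations passes from finitely supported
functions to `L²` by dominated convergence. It is an equality at `t = 0`, so comparing slopes there
gives `ε Var f ≤ D(f)`. -/
theorem ExponentiallyErgodic.poincare (h : X.ExponentiallyErgodic) : X.Poincare := by
  obtain ⟨ε, hε, C, hE⟩ := h
  refine ⟨ε⁻¹, inv_pos.2 hε, fun f hf hD => ?_⟩
  have hdecay : ∀ t : ℝ, 0 ≤ t →
      ip X.π (semigroup X.p t f) f - mean X.π f ^ 2 ≤ Real.exp (-ε * t) * variance X.π f := by
    intro t ht
    set F : Finset E → E → ℝ := fun s => Set.indicator (s : Set E) f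
    have habs : IsL2 X.π fun i => |f i| := hf.mono X.π_nonneg fun i => by simp
    have hFle : ∀ s i, |F s i| ≤ |f i| := fun s i => by
      by_cases hi : i ∈ (s : Set E)
      · simp [F, Set.indicator_of_mem hi]
      · simp [F, Set.indicator_of_notMem hi]
    have hF : ∀ i, Tendsto (fun s => F s i) atTop (𝓝 (f i)) := fun i => by
      refine tendsto_const_nhds.congr' ?_
      filter_upwards [eventually_ge_atTop {i}] with s hs
      have : i ∈ (s : Set E) := by simpa using hs
      simp [F, Set.indicator_of_mem this]
    have h1 := (X.isReversibleKernel ht).tendsto_ip_map habs hFle hF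
    have h2 := tendsto_ip_of_dominated X.π_nonneg habs habs hFle hFle hF hF
    have h3 := tendsto_ip_of_dominated X.π_nonneg (isL2_const X.π_hasSum.summable 1) habs
      (F := fun (_ : Finset E) _ => 1) (f := fun _ => 1) (fun _ _ => by simp) hFle
      (fun _ => tendsto_const_nhds) hF
    simp only [ip_one_left] at h3
    have h4 := (h2.sub (h3.pow 2)).const_mul (Real.exp (-ε * t))
    rw [← variance_eq_ip] at h4
    refine le_of_tendsto_of_tendsto' (h1.sub (h3.pow 2)) h4 fun s => ?_
    rw [← variance_eq_ip]
    exact ip_semigroup_le_exp_of_finite_support hE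
      (s.finite_toSet.subset Set.support_indicator_subset) ht
  have hlim : Tendsto (fun t : ℝ => t⁻¹ * (1 - Real.exp (-ε * t)) * variance X.π f) (𝓝[>] 0)
      (𝓝 (ε * variance X.π f)) := by
    have hder : HasDerivAt (fun t : ℝ => 1 - Real.exp (-ε * t)) ε 0 := by
      have := (((hasDerivAt_id (0 : ℝ)).const_mul (-ε)).exp).const_sub 1
      simpa using this
    have := hder.hasDerivWithinAt (s := Set.Ioi 0)
    rw [hasDerivWithinAt_iff_tendsto_slope' (by simp)] at this
    refine (this.congr fun t => ?_).mul_const _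
    simp [slope_def_field, div_eq_inv_mul]
  have h1 := le_of_tendsto_of_tendsto hlim (X.tendsto_energy hf hD) (by
    filter_upwards [self_mem_nhdsWithin] with t ht
    have ht : 0 < t := ht
    rw [mul_assoc]
    refine mul_le_mul_of_nonneg_left ?_ (inv_nonneg.2 ht.le)
    have h1 := hdecay t ht.le
    have h2 := variance_eq_ip (π := X.π) (f := f)
    linarith)
  rw [inv_mul_eq_div, le_div_iff₀ hε]
  linarith

/-- Suppose `s^κ Var (P_s f) ≤ B` with `‖f‖₁ ≤ 1`. Nash for `P_{2s} f` gives `Var (P_{2s} f)^a ≤ C^a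
D(P_{2s} f)`, and regularization gives `2 s D(P_{2s} f) ≤ Var (P_s f)`. As `κ a = κ + 1`, the powers
of `s` match and the same bound holds at time `2s`. -/
theorem Nash.stronglyErgodic (h : X.Nash) : X.StronglyErgodic := by
  obtain ⟨C, a, b, hC, hab, hN⟩ := h
  have ha1 : 0 < a - 1 := by linarith [hab.lt]
  have ha := hab.pos
  set κ : ℝ := 1 / (a - 1) with hκ
  have hκ0 : 0 < κ := by positivity
  have hκa : κ * a = κ + 1 := by rw [hκ]; field_simp; ring
  -- The second entry gives `2^κ C^a ≤ B^(a-1)`, which closes the doubling step; the entry `1`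
  -- admits the start at small times.
  set B : ℝ := max 1 ((2 ^ κ * C ^ a) ^ (1 / (a - 1))) with hB
  have hB1 : 1 ≤ B := le_max_left _ _
  have hB0 : 0 < B := by linarith
  have hBa : 2 ^ κ * C ^ a ≤ B ^ (a - 1) := by
    have := Real.rpow_le_rpow (by positivity)
      (le_max_right 1 ((2 ^ κ * C ^ a) ^ (1 / (a - 1)))) ha1.le
    rwa [← Real.rpow_mul (by positivity), one_div_mul_cancel ha1.ne', Real.rpow_one] at this
  have hdouble : ∀ f : E → ℝ, IsL2 X.π f → normOne X.π f ≤ 1 → ∀ s : ℝ, 0 < s →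
      s ^ κ * variance X.π (semigroup X.p s f) ≤ B →
      (2 * s) ^ κ * variance X.π (semigroup X.p (2 * s) f) ≤ B := by
    intro f hf hf1 s hs hA
    have hs2 : 0 < 2 * s := by positivity
    have hg := X.isL2_semigroup hs.le hf
    have h1 := X.toReal_form_semigroup_le hs hg
    have h2 := hN _ (X.isL2_semigroup hs.le hg) (X.form_semigroup_lt_top hs hg)
    rw [X.semigroup_add hs.le hs.le hf, ← two_mul] at h1 h2
    set v := variance X.π (semigroup X.p s f)
    set w := variance X.π (semigroup X.p (2 * s) f)
    set D := (form X.q X.π (semigroup X.p (2 * s) f)).toReal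
    have hv : 0 ≤ v := variance_nonneg X.π_nonneg X.π_hasSum hg
    have hw : 0 ≤ w := variance_nonneg X.π_nonneg X.π_hasSum (X.isL2_semigroup hs2.le hf)
    have hD : 0 ≤ D := ENNReal.toReal_nonneg
    have h3 : normOne X.π (semigroup X.p (2 * s) f) ^ (2 / b) ≤ 1 :=
      Real.rpow_le_one (normOne_nonneg X.π_nonneg)
        (((X.isReversibleKernel hs2.le).normOne_map_le hf).trans hf1)
        (div_nonneg zero_le_two hab.symm.nonneg)
    have h4 : w ≤ C * D ^ (1 / a) :=
      h2.trans (mul_le_of_le_one_right (by positivity) h3)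
    have h5 : w ^ a ≤ C ^ a * D := by
      have := Real.rpow_le_rpow hw h4 ha.le
      rwa [Real.mul_rpow hC.le (by positivity), ← Real.rpow_mul hD,
        one_div_mul_cancel ha.ne', Real.rpow_one] at this
    have h6 : 2 * s * D ≤ v := by linarith
    have h7 : ((2 * s) ^ κ * w) ^ a ≤ B ^ a := by
      calc ((2 * s) ^ κ * w) ^ a = (2 * s) ^ κ * (2 * s) * w ^ a := by
            rw [Real.mul_rpow (by positivity) hw, ← Real.rpow_mul hs2.le, hκa,
              Real.rpow_add hs2, Real.rpow_one]
        _ ≤ (2 * s) ^ κ * (2 * s) * (C ^ a * D) := by gcongr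
        _ = 2 ^ κ * C ^ a * (s ^ κ * (2 * s * D)) := by
            rw [Real.mul_rpow zero_le_two hs.le]; ring
        _ ≤ B ^ (a - 1) * (s ^ κ * v) := by gcongr
        _ ≤ B ^ (a - 1) * B := by gcongr
        _ = B ^ a := by
            rw [← Real.rpow_add_one hB0.ne']; congr 1; ring
    exact (Real.rpow_le_rpow_iff (by positivity) hB0.le ha).1 h7
  have hbound : ∀ f : E → ℝ, IsL2 X.π f → normOne X.π f ≤ 1 → ∀ t : ℝ, 0 < t →
      t ^ κ * variance X.π (semigroup X.p t f) ≤ B := by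
    intro f hf hf1 t ht
    have hiter : ∀ (n : ℕ) (s : ℝ), 0 < s → s ^ κ * variance X.π (semigroup X.p s f) ≤ B →
        (2 ^ n * s) ^ κ * variance X.π (semigroup X.p (2 ^ n * s) f) ≤ B := by
      intro n
      induction n with
      | zero => intro s _ h; simpa using h
      | succ n ih =>
        intro s hs h
        have := hdouble f hf hf1 _ (by positivity) (ih s hs h)
        rwa [← mul_assoc, ← pow_succ'] at this
    -- Halving `t` often enough makes the bound trivial, because `s^κ Var f → 0`. The number of
    -- halvings depends on `f`, but `B` does not.
    have hlim : Tendsto (fun n : ℕ => (t * (1 / 2) ^ n) ^ κ * variance X.π f) atTop (𝓝 0) := by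
      have h1 : Tendsto (fun n : ℕ => t * (1 / 2 : ℝ) ^ n) atTop (𝓝 (t * 0)) :=
        (tendsto_pow_atTop_nhds_zero_of_lt_one (by norm_num) (by norm_num)).const_mul t
      rw [mul_zero] at h1
      have h2 := (h1.rpow_const (p := κ) (Or.inr hκ0.le)).mul_const (variance X.π f)
      simpa [Real.zero_rpow hκ0.ne'] using h2
    obtain ⟨n, hn⟩ := (hlim.eventually_le_const one_pos).exists
    have hs : 0 < t * (1 / 2 : ℝ) ^ n := by positivity
    have := hiter n _ hs (le_trans (le_trans (mul_le_mul_of_nonneg_left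
      ((X.isReversibleKernel hs.le).variance_map_le hf) (by positivity)) hn) hB1)
    rwa [show (2 : ℝ) ^ n * (t * (1 / 2) ^ n) = t by
      rw [mul_left_comm, ← mul_pow]; norm_num] at this
  -- Each `δ_x/π_x` has `L¹` norm one, so the bound is uniform in `x`.
  have htv : ∀ t : ℝ, 0 < t → ∀ x, tvNorm (X.p t x) X.π ≤ Real.sqrt (B / t ^ κ) := by
    intro t ht x
    refine Real.le_sqrt_of_sq_le ((X.tvNorm_sq_le ht.le x).trans ?_)
    have h1 : normOne X.π (fun z => (X.π x)⁻¹ * pointFn x z) ≤ 1 := by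
      have : normOne X.π (fun z => (X.π x)⁻¹ * pointFn x z)
          = (X.π x)⁻¹ * normOne X.π (pointFn x) := by
        rw [normOne, normOne, mean, mean, ← tsum_mul_left]
        refine tsum_congr fun z => ?_
        rw [abs_mul, abs_of_pos (inv_pos.2 (X.π_pos x))]; ring
      rw [this, normOne_pointFn, inv_mul_cancel₀ (X.π_pos x).ne']
    have := hbound _ ((isL2_pointFn x).const_mul _) h1 t ht
    rw [le_div_iff₀ (by positivity)]
    linarith
  have h1 : Tendsto (fun t : ℝ => Real.sqrt (B / t ^ κ)) atTop (𝓝 0) := by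
    simpa using ((tendsto_rpow_atTop hκ0).const_div_atTop B).sqrt
  refine squeeze_zero' (Eventually.of_forall fun t =>
    Real.iSup_nonneg fun x => tvNorm_nonneg) ?_ h1
  filter_upwards [eventually_gt_atTop 0] with t ht
  exact Real.iSup_le (htv t ht) (Real.sqrt_nonneg _)

end ReversibleChain

end MarkovChain

/-! ### The logarithmic Sobolev inequality: it follows from Nash and implies Poincaré -/

namespace MarkovChain

/-- The Taylor expansion at `0` is `2 s + 3 s² + O(s³)`. Lowering the coefficient `3` to `5/2`
absorbs the remainder in the given range. -/
theorem two_mul_sq_mul_log_ge {s : ℝ} (hs : |s| ≤ 1 / 20) :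
    2 * s + 5 / 2 * s ^ 2 ≤ (1 + s) ^ 2 * Real.log ((1 + s) ^ 2) := by
  have h1 := Real.abs_log_sub_add_sum_range_le (x := -s) (by rw [abs_neg]; linarith) 2
  simp only [Finset.sum_range_succ, Finset.sum_range_zero, abs_neg, sub_neg_eq_add] at h1
  norm_num at h1
  have h2 := (abs_le.1 h1).1
  have h3 : |s| ^ 3 / (1 - |s|) ≤ s ^ 2 / 19 := by
    rw [div_le_iff₀ (by linarith), ← sq_abs s]
    nlinarith [abs_nonneg s, sq_nonneg |s|]
  have hs' := abs_le.1 hs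
  have h4 : s - s ^ 2 / 2 - s ^ 2 / 19 ≤ Real.log (1 + s) := by linarith
  rw [Real.log_pow]
  push_cast
  have h5 := mul_le_mul_of_nonneg_left h4 (sq_nonneg (1 + s))
  nlinarith [sq_nonneg s, mul_nonneg (sq_nonneg s) (sub_nonneg.2 hs'.2),
    mul_nonneg (sq_nonneg s) (sub_nonneg.2 hs'.1), sq_nonneg (s ^ 2),
    mul_nonneg (sq_nonneg s) (mul_nonneg (sub_nonneg.2 hs'.2) (sub_nonneg.2 hs'.1))]

theorem mul_log_bound_nonneg {y : ℝ} (hy : 0 ≤ y) : 0 ≤ y * Real.log y - y + 1 := by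
  rcases hy.eq_or_lt with rfl | hy
  · simp
  · have := Real.one_sub_inv_le_log_of_pos hy
    have := mul_le_mul_of_nonneg_left this hy.le
    rw [mul_sub, mul_inv_cancel₀ hy.ne'] at this
    linarith

/-- The pointwise inequality behind the passage from centered to general functions in the
logarithmic Sobolev inequality. -/
theorem entropy_density_le {m g V : ℝ} (hV : 0 < V) :
    (m ^ 2 + V) * ((m + g) ^ 2 / (m ^ 2 + V) * Real.log ((m + g) ^ 2 / (m ^ 2 + V))
      - (m + g) ^ 2 / (m ^ 2 + V) + 1) ≤
      35 * (g ^ 2 + g ^ 2 * Real.posLog (g ^ 2 / V)) + 2 * V := by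
  set S := m ^ 2 + V with hS
  have hS0 : 0 < S := by positivity
  have hVS : V ≤ S := by rw [hS]; nlinarith [sq_nonneg m]
  set y := (m + g) ^ 2 / S with hy
  have hy0 : 0 ≤ y := by positivity
  have hSy : S * y = (m + g) ^ 2 := by rw [hy]; field_simp
  have hL : 0 ≤ g ^ 2 * Real.posLog (g ^ 2 / V) := mul_nonneg (sq_nonneg _) Real.posLog_nonneg
  -- For small `g` the density is at most `S (y - 1)²`, and `S (y - 1) = 2 m g + g² - V`. For large
  -- `g` the mean is dominated, `4 m² < g²`, so that `(m + g)² ≤ 9/4 g²` and the logarithm of `y` is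
  -- at most a constant plus that of `g² / V`.
  rcases le_or_gt (g ^ 2) (4 * S) with hg | hg
  · have h1 : y * Real.log y ≤ y * (y - 1) := by
      rcases hy0.eq_or_lt with h | h
      · rw [← h]; simp
      · exact mul_le_mul_of_nonneg_left (Real.log_le_sub_one_of_pos h) hy0
    have h2 : S * (y * Real.log y - y + 1) ≤ S * (y - 1) ^ 2 :=
      mul_le_mul_of_nonneg_left (by nlinarith) hS0.le
    have h3 : S * (S * (y - 1) ^ 2) ≤ S * (32 * g ^ 2 + 2 * V) := by
      have e1 : S * (S * (y - 1) ^ 2) = (2 * m * g + g ^ 2 - V) ^ 2 := by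
        have : S * (S * (y - 1) ^ 2) = (S * y - S) ^ 2 := by ring
        rw [this, hSy, hS]; ring
      rw [e1]
      have e2 : (2 * m * g + g ^ 2 - V) ^ 2 ≤ 2 * (g ^ 2 * (2 * m + g) ^ 2) + 2 * V ^ 2 := by
        nlinarith [sq_nonneg (2 * m * g + g ^ 2 + V)]
      have e3 : (2 * m + g) ^ 2 ≤ 16 * S := by nlinarith [sq_nonneg (2 * m - g)]
      have e4 := mul_le_mul_of_nonneg_left e3 (sq_nonneg g)
      have e5 := mul_le_mul_of_nonneg_left hVS hV.le
      nlinarith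
    have h4 := le_of_mul_le_mul_left h3 hS0
    nlinarith [sq_nonneg g]
  · have h1 : (m + g) ^ 2 ≤ 9 / 4 * g ^ 2 := by
      have : (2 * m) ^ 2 ≤ g ^ 2 := by nlinarith
      nlinarith [sq_nonneg (2 * m - g)]
    have h2 : Real.log y ≤ 5 / 4 + Real.posLog (g ^ 2 / V) := by
      have e1 : y ≤ 9 / 4 * (g ^ 2 / V) := by
        rw [hy, div_le_iff₀ hS0]
        calc (m + g) ^ 2 ≤ 9 / 4 * (g ^ 2 / V) * V := by
              rw [mul_assoc, div_mul_cancel₀ _ hV.ne']; exact h1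
          _ ≤ _ := mul_le_mul_of_nonneg_left hVS (by positivity)
      have e2 : Real.posLog (9 / 4 : ℝ) ≤ 5 / 4 := by
        rw [Real.posLog]
        refine max_le (by norm_num) ?_
        linarith [Real.log_le_sub_one_of_pos (show (0 : ℝ) < 9 / 4 by norm_num)]
      calc Real.log y ≤ Real.posLog y := le_max_right _ _
        _ ≤ Real.posLog (9 / 4 * (g ^ 2 / V)) := Real.posLog_le_posLog hy0 e1
        _ ≤ _ := Real.posLog_mul
        _ ≤ _ := by linarith
    have h3 : S * (y * Real.log y - y + 1) ≤ (m + g) ^ 2 * (5 / 4 + Real.posLog (g ^ 2 / V)) + S := by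
      have : S * (y * Real.log y - y + 1) = S * y * Real.log y - S * y + S := by ring
      rw [this, hSy]
      nlinarith [mul_le_mul_of_nonneg_left h2 (sq_nonneg (m + g)), sq_nonneg (m + g)]
    have h4 : (m + g) ^ 2 * (5 / 4 + Real.posLog (g ^ 2 / V)) ≤
        9 / 4 * g ^ 2 * (5 / 4 + Real.posLog (g ^ 2 / V)) :=
      mul_le_mul_of_nonneg_right h1 (by linarith [Real.posLog_nonneg (x := g ^ 2 / V)])
    nlinarith [sq_nonneg g]

/-- Truncation at heights `-M` and `M`. -/
noncomputable def clamp {E : Type*} (M : ℝ) (f : E → ℝ) (i : E) : ℝ := max (-M) (min M (f i))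

theorem abs_clamp_le {E : Type*} {M : ℝ} (hM : 0 ≤ M) (f : E → ℝ) (i : E) : |clamp M f i| ≤ M := by
  rw [abs_le, clamp]
  exact ⟨le_max_left _ _, max_le (by linarith) (min_le_left _ _)⟩

theorem abs_clamp_le_abs {E : Type*} {M : ℝ} (hM : 0 ≤ M) (f : E → ℝ) (i : E) :
    |clamp M f i| ≤ |f i| := by
  rw [clamp, abs_le]
  constructor
  · exact le_max_of_le_right (le_min (by linarith [abs_nonneg (f i)]) (neg_abs_le _))
  · exact max_le (by linarith [abs_nonneg (f i)]) ((min_le_right _ _).trans (le_abs_self _))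

theorem abs_clamp_sub_clamp_le {E : Type*} (M : ℝ) (f : E → ℝ) (i j : E) :
    |clamp M f j - clamp M f i| ≤ |f j - f i| := by
  refine (abs_max_sub_max_le_max _ _ _ _).trans ?_
  rw [sub_self, abs_zero]
  refine max_le (abs_nonneg _) ((abs_min_sub_min_le_max _ _ _ _).trans ?_)
  rw [sub_self, abs_zero]
  exact max_le (abs_nonneg _) le_rfl

theorem tendsto_clamp {E : Type*} (f : E → ℝ) (i : E) :
    Tendsto (fun n : ℕ => clamp n f i) atTop (𝓝 (f i)) := by
  refine tendsto_const_nhds.congr' ?_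
  filter_upwards [eventually_ge_atTop ⌈|f i|⌉₊] with n hn
  have h : |f i| ≤ n := (Nat.le_ceil _).trans (by exact_mod_cast hn)
  rw [clamp, min_eq_right ((le_abs_self _).trans h), max_eq_right (by linarith [neg_abs_le (f i)])]

namespace ReversibleChain

variable {E : Type*} {X : ReversibleChain E} {f g : E → ℝ}

/-- Truncation at heights `±n` does not increase the energy, and the variance of the truncations
converges by domination. -/
theorem poincare_of_bounded {C : ℝ} (hC : 0 < C)
    (h : ∀ (f : E → ℝ) (M : ℝ), (∀ i, |f i| ≤ M) → form X.q X.π f < ∞ →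
      variance X.π f ≤ C * (form X.q X.π f).toReal) : X.Poincare := by
  refine ⟨C, hC, fun f hf hD => ?_⟩
  have habs : IsL2 X.π fun i => |f i| := hf.mono X.π_nonneg fun i => by simp
  have hle : ∀ (n : ℕ) i, |clamp n f i| ≤ |f i| := fun n => abs_clamp_le_abs (Nat.cast_nonneg n) f
  have h2 := tendsto_ip_of_dominated X.π_nonneg habs habs hle hle (tendsto_clamp f)
    (tendsto_clamp f)
  have h3 := tendsto_ip_of_dominated X.π_nonneg (isL2_const X.π_hasSum.summable 1) habs
    (F := fun (_ : ℕ) _ => 1) (f := fun _ => 1) (fun _ _ => by simp) hle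
    (fun _ => tendsto_const_nhds) (tendsto_clamp f)
  simp only [ip_one_left] at h3
  have h4 := h2.sub (h3.pow 2)
  rw [← variance_eq_ip] at h4
  refine le_of_tendsto' h4 fun n => ?_
  rw [← variance_eq_ip]
  have hD' := form_mono X.isQMatrix X.π_nonneg (fun i j => abs_clamp_sub_clamp_le n f i j)
  refine (h _ n (abs_clamp_le (Nat.cast_nonneg n) f) (hD'.trans_lt hD)).trans ?_
  exact mul_le_mul_of_nonneg_left (ENNReal.toReal_mono hD.ne hD') hC.le

/-- Test the inequality with `u = 1 + ε f`, where `f` is bounded and centered. The linear term of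
the entropy has mean zero, so the entropy is at least a multiple of `ε² Var f`, while the energy is
`ε² D(f)`. -/
theorem LogSobolev.poincare (h : X.LogSobolev) : X.Poincare := by
  obtain ⟨C, hC, hL⟩ := h
  refine poincare_of_bounded hC fun f₀ M₀ hM₀ hD => ?_
  have hf₀ := isL2_of_bounded X.π_nonneg X.π_hasSum.summable hM₀
  set f : E → ℝ := fun i => f₀ i - mean X.π f₀ with hfdef
  have hf : IsL2 X.π f := X.isL2_sub_const hf₀ _
  have hDf : form X.q X.π f = form X.q X.π f₀ := form_sub_const _
  have hmf : mean X.π f = 0 := by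
    rw [hfdef, mean_sub_const X.π_hasSum (hf₀.summable X.π_nonneg X.π_hasSum.summable), sub_self]
  rw [variance_eq_ip_centered X.π_nonneg X.π_hasSum hf₀]
  change ip X.π f f ≤ _
  rw [← hDf]
  rw [← hDf] at hD
  obtain ⟨M, hM0, hM⟩ : ∃ M, 0 < M ∧ ∀ i, |f i| ≤ M := by
    refine ⟨|M₀| + |mean X.π f₀| + 1, by positivity, fun i => ?_⟩
    have h1 := abs_sub (f₀ i) (mean X.π f₀)
    have h2 := (hM₀ i).trans (le_abs_self M₀)
    simp only [hfdef]
    linarith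
  set V := ip X.π f f with hV
  have hV0 : 0 ≤ V := ip_self_nonneg X.π_nonneg
  have hVM : V ≤ M ^ 2 := by
    have h1 := mean_mono (g := fun _ => M ^ 2) hf (X.π_hasSum.summable.mul_right _) X.π_nonneg
      fun i => sq_le_sq' (abs_le.1 (hM i)).1 (abs_le.1 (hM i)).2
    rwa [mean_const X.π_hasSum, ← ip_self_eq] at h1
  -- A fixed `ε` suffices instead of a limit: `|ε f| ≤ 1/20` is the range of the pointwise
  -- expansion.
  set ε := 1 / (20 * M) with hε
  have hε0 : 0 < ε := by positivity
  have hεM : ε * M = 1 / 20 := by rw [hε]; field_simp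
  set u : E → ℝ := fun i => 1 + ε * f i with hu
  have h1L2 := isL2_const X.π_hasSum.summable (1 : ℝ)
  have huL2 : IsL2 X.π u := h1L2.add X.π_nonneg (hf.const_mul ε)
  have hDu : form X.q X.π u = ENNReal.ofReal (ε ^ 2) * form X.q X.π f := by
    rw [← form_const_mul, ← form_sub_const (f := u) 1]
    simp [hu]
  have hN : HasSum (fun i => X.π i * u i ^ 2) (1 + ε ^ 2 * V) := by
    have e1 := (hf.summable X.π_nonneg X.π_hasSum.summable).hasSum.mul_left (2 * ε)
    have e2 : HasSum (fun i => X.π i * f i ^ 2) V := by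
      rw [hV, ip_self_eq]; exact Summable.hasSum hf
    have e3 : ∑' i, X.π i * f i = 0 := hmf
    rw [e3] at e1
    exact hasSum_of_eq ((X.π_hasSum.add e1).add (e2.mul_left (ε ^ 2)))
      (fun i => by simp only [hu]; ring) (by ring)
  have hNeq : mean X.π (fun k => u k ^ 2) = 1 + ε ^ 2 * V := hN.tsum_eq
  obtain ⟨hs, hle⟩ := hL u huL2 (by rw [hDu]; exact ENNReal.mul_lt_top ENNReal.ofReal_lt_top hD)
  rw [hNeq] at hs hle
  rw [hDu, ENNReal.toReal_mul, ENNReal.toReal_ofReal (sq_nonneg _)] at hle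
  set N := 1 + ε ^ 2 * V with hNdef
  have hN0 : 0 < N := by positivity
  have hlogN : Real.log N ≤ ε ^ 2 * V := by
    have := Real.log_le_sub_one_of_pos hN0
    linarith
  -- Here `log N ≤ ε² V` bounds the normalization. The total `(5/2 - N) ε² V` is at least `ε² V`
  -- because `N ≤ 3/2`.
  have hlow : HasSum (fun i => X.π i * (2 * (ε * f i) + 5 / 2 * (ε * f i) ^ 2
      - u i ^ 2 * (ε ^ 2 * V))) (5 / 2 * (ε ^ 2 * V) - N * (ε ^ 2 * V)) := by
    have e1 := (hf.summable X.π_nonneg X.π_hasSum.summable).hasSum.mul_left (2 * ε)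
    have e2 : HasSum (fun i => X.π i * f i ^ 2) V := by
      rw [hV, ip_self_eq]; exact Summable.hasSum hf
    have e3 : ∑' i, X.π i * f i = 0 := hmf
    rw [e3] at e1
    exact hasSum_of_eq ((e1.add (e2.mul_left (5 / 2 * ε ^ 2))).sub (hN.mul_right (ε ^ 2 * V)))
      (fun i => by ring) (by ring)
  have hcmp := hasSum_le (fun i => mul_le_mul_of_nonneg_left (a := X.π i) (?_ : _ ≤
    u i ^ 2 * Real.log (u i ^ 2 / N)) (X.π_nonneg i)) hlow hs.hasSum
  · have h1 := hcmp.trans hle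
    have hNle : N ≤ 3 / 2 := by
      have : ε ^ 2 * V ≤ (ε * M) ^ 2 := by
        rw [mul_pow]; exact mul_le_mul_of_nonneg_left hVM (sq_nonneg _)
      rw [hεM] at this
      linarith
    have h2 : ε ^ 2 * V ≤ ε ^ 2 * (C * (form X.q X.π f).toReal) := by
      have : 0 ≤ ε ^ 2 * V := by positivity
      nlinarith
    exact le_of_mul_le_mul_left h2 (by positivity)
  · have hs1 : |ε * f i| ≤ 1 / 20 := by
      rw [abs_mul, abs_of_pos hε0, ← hεM]
      exact mul_le_mul_of_nonneg_left (hM i) hε0.le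
    have hs2 := abs_le.1 hs1
    have hu0 : 0 < u i := by simp only [hu]; linarith
    rw [Real.log_div (by positivity) hN0.ne', mul_sub]
    have h1 := two_mul_sq_mul_log_ge hs1
    have h2 := mul_le_mul_of_nonneg_left hlogN (sq_nonneg (u i))
    simp only [hu] at h2 ⊢
    linarith

theorem eq_mean_of_variance_eq_zero (X : ReversibleChain E) (hf : IsL2 X.π f)
    (h : variance X.π f = 0) (i : E) : f i = mean X.π f := by
  have hg := X.isL2_sub_const hf (mean X.π f)
  rw [variance_eq_ip_centered X.π_nonneg X.π_hasSum hf, ip_self_eq] at h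
  have h' : HasSum (fun i => X.π i * (f i - mean X.π f) ^ 2) 0 := by
    rw [← h]; exact Summable.hasSum hg
  have h1 := (hasSum_zero_iff_of_nonneg fun i =>
    mul_nonneg (X.π_nonneg i) (sq_nonneg (f i - mean X.π f))).1 h'
  have h2 := congrFun h1 i
  simp only [Pi.zero_apply, mul_eq_zero, (X.π_pos i).ne', false_or] at h2
  linarith [pow_eq_zero_iff (two_ne_zero) |>.1 h2]

/-- The Poincaré inequality together with a logarithmic bound for centered functions gives the
logarithmic Sobolev inequality. -/
theorem logSobolev_of_centered {C : ℝ} (hC : 0 < C)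
    (hP : ∀ f : E → ℝ, IsL2 X.π f → form X.q X.π f < ∞ →
      variance X.π f ≤ C * (form X.q X.π f).toReal)
    (hL : ∀ g : E → ℝ, IsL2 X.π g → form X.q X.π g < ∞ → mean X.π g = 0 → 0 < ip X.π g g →
      Summable (fun i => X.π i * (g i ^ 2 * Real.posLog (g i ^ 2 / ip X.π g g))) ∧
      mean X.π (fun i => g i ^ 2 * Real.posLog (g i ^ 2 / ip X.π g g))
        ≤ C * (form X.q X.π g).toReal) : X.LogSobolev := by
  -- The pointwise bound integrates to `35 (V + entropy term) + 2 V`, and both quantities are at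
  -- most `C D`; hence `35 + 35 + 2`.
  refine ⟨72 * C, by positivity, fun f hf hD => ?_⟩
  set m := mean X.π f with hm
  set V := variance X.π f with hV
  have hV0 : 0 ≤ V := variance_nonneg X.π_nonneg X.π_hasSum hf
  have hS : mean X.π (fun k => f k ^ 2) = m ^ 2 + V := by rw [hV, variance]; ring
  rw [hS]
  rcases hV0.eq_or_lt with hV0 | hV0
  · have hterm : ∀ i, X.π i * (f i ^ 2 * Real.log (f i ^ 2 / (m ^ 2 + V))) = 0 := fun i => by
      rw [X.eq_mean_of_variance_eq_zero hf hV0.symm i, ← hm, ← hV0, add_zero]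
      by_cases h : m = 0
      · simp [h]
      · rw [div_self (pow_ne_zero 2 h), Real.log_one, mul_zero, mul_zero]
    refine ⟨by simp only [hterm]; exact summable_zero, ?_⟩
    simp only [mean, hterm, tsum_zero]
    positivity
  set g : E → ℝ := fun i => f i - m with hg
  have hgL : IsL2 X.π g := X.isL2_sub_const hf m
  have hDg : form X.q X.π g = form X.q X.π f := form_sub_const m
  have hgV : ip X.π g g = V := (variance_eq_ip_centered X.π_nonneg X.π_hasSum hf).symm
  obtain ⟨hs, hle⟩ := hL g hgL (by rwa [hDg]) (by
    rw [hg, mean_sub_const X.π_hasSum (hf.summable X.π_nonneg X.π_hasSum.summable), sub_self])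
    (by rwa [hgV])
  rw [hgV] at hs hle
  rw [hDg] at hle
  have hS0 : 0 < m ^ 2 + V := by positivity
  set S := m ^ 2 + V with hSdef
  -- Since `f² / S` has mean one, the added terms integrate to zero and `ψ` has the entropy of `f²`
  -- as its mean. Unlike the original integrand it is nonnegative, so a majorant also gives
  -- summability.
  set ψ : E → ℝ := fun i => S * (f i ^ 2 / S * Real.log (f i ^ 2 / S) - f i ^ 2 / S + 1) with hψ
  have hψ0 : ∀ i, 0 ≤ ψ i := fun i => mul_nonneg hS0.le (mul_log_bound_nonneg (by positivity))
  have hψle : ∀ i, ψ i ≤ 35 * (g i ^ 2 + g i ^ 2 * Real.posLog (g i ^ 2 / V)) + 2 * V := fun i => by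
    have := entropy_density_le (m := m) (g := g i) hV0
    simp only [hg, add_sub_cancel] at this
    exact this
  have hgsum : HasSum (fun i => X.π i * g i ^ 2) V := by
    rw [← hgV, ip_self_eq]; exact Summable.hasSum hgL
  have hub : HasSum (fun i => X.π i * (35 * (g i ^ 2 + g i ^ 2 * Real.posLog (g i ^ 2 / V)) + 2 * V))
      (35 * (V + mean X.π (fun i => g i ^ 2 * Real.posLog (g i ^ 2 / V))) + 2 * V) :=
    hasSum_of_eq (((hgsum.add hs.hasSum).mul_left 35).add (X.π_hasSum.mul_right (2 * V)))
      (fun i => by ring) (by rw [one_mul]; rfl)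
  have hψs : Summable fun i => X.π i * ψ i :=
    Summable.of_nonneg_of_le (fun i => mul_nonneg (X.π_nonneg i) (hψ0 i))
      (fun i => mul_le_mul_of_nonneg_left (hψle i) (X.π_nonneg i)) hub.summable
  have hfS : HasSum (fun i => X.π i * f i ^ 2) S := by
    rw [← hS]; exact Summable.hasSum hf
  have hent : HasSum (fun i => X.π i * (f i ^ 2 * Real.log (f i ^ 2 / S)))
      (mean X.π ψ) := by
    refine hasSum_of_eq ((hψs.hasSum.add hfS).sub (X.π_hasSum.mul_right S)) (fun i => ?_)
      (by rw [one_mul, add_sub_cancel_right]; rfl)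
    have : f i ^ 2 / S * S = f i ^ 2 := div_mul_cancel₀ _ hS0.ne'
    simp only [hψ]
    calc X.π i * (f i ^ 2 * Real.log (f i ^ 2 / S))
        = X.π i * (f i ^ 2 / S * S * Real.log (f i ^ 2 / S) - f i ^ 2 / S * S + S)
          + X.π i * (f i ^ 2) - X.π i * S := by rw [this]; ring
      _ = _ := by ring
  refine ⟨hent.summable, ?_⟩
  have h1 : mean X.π ψ ≤ _ := hasSum_le
    (fun i => mul_le_mul_of_nonneg_left (hψle i) (X.π_nonneg i)) hψs.hasSum hub
  have h2 : mean X.π (fun i => f i ^ 2 * Real.log (f i ^ 2 / S)) = mean X.π ψ := hent.tsum_eq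
  rw [h2]
  have h3 := hP f hf hD
  linarith

/-- Cut `|g|` at the heights `2^k ‖g‖`. The part `h` above such a height has `L¹` norm small against
its `L²` norm, so Nash bounds `‖h‖²` by `K D(g) ρ^k`. On the layer `k` the logarithm grows only
linearly in `k`, and `∑ (k + 3) ρ^{k+1}` converges. -/
theorem Nash.logSobolev (h : X.Nash) : X.LogSobolev := by
  obtain ⟨CP, hCP, hP⟩ := h.poincare
  obtain ⟨C, a, b, hC, hab, hN⟩ := h
  have ha := hab.pos
  have hb := hab.symm.pos
  -- The factor `4^{-k}` in `‖h‖₁² ≤ 4^{-k} ‖h‖²` enters Nash to the power `1/b`, and solving for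
  -- `‖h‖²` raises it to the power `a`. The `4/3` in `K` comes from `Var h ≥ 3/4 ‖h‖²`.
  set ρ : ℝ := (1 / 4) ^ (a / b) with hρ
  have hρ0 : 0 < ρ := by positivity
  have hρ1 : ρ < 1 := Real.rpow_lt_one (by norm_num) (by norm_num) (by positivity)
  set K : ℝ := (4 / 3 * C) ^ a with hK
  have hK0 : 0 < K := by positivity
  have htail : ∀ g : E → ℝ, IsL2 X.π g → form X.q X.π g < ∞ → 0 < ip X.π g g → ∀ k : ℕ, 1 ≤ k →
      ip X.π (fun i => max (|g i| - 2 ^ k * Real.sqrt (ip X.π g g)) 0)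
        (fun i => max (|g i| - 2 ^ k * Real.sqrt (ip X.π g g)) 0) ≤
        K * (form X.q X.π g).toReal * ρ ^ k := by
    intro g hg hD hV k hk
    set V := ip X.π g g
    set T := 2 ^ k * Real.sqrt V with hT
    have hT0 : 0 < T := by have := Real.sqrt_pos.2 hV; positivity
    have hT2 : T ^ 2 = 4 ^ k * V := by
      rw [hT, mul_pow, Real.sq_sqrt hV.le, ← pow_mul, mul_comm k 2, pow_mul]; norm_num
    set h : E → ℝ := fun i => max (|g i| - T) 0 with hh
    have hh0 : ∀ i, 0 ≤ h i := fun i => le_max_right _ _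
    have hhle : ∀ i, h i ≤ |g i| := fun i => max_le (by linarith) (abs_nonneg _)
    have hhL : IsL2 X.π h := hg.mono X.π_nonneg fun i => by rw [abs_of_nonneg (hh0 i)]; exact hhle i
    have hga : IsL2 X.π fun i => |g i| := hg.mono X.π_nonneg fun i => by simp
    have hDh : form X.q X.π h ≤ form X.q X.π g := form_mono X.isQMatrix X.π_nonneg fun i j => by
      refine (abs_max_sub_max_le_abs _ _ _).trans ?_
      rw [sub_sub_sub_cancel_right]
      exact abs_abs_sub_abs_le_abs_sub _ _
    have hmean : mean X.π h = normOne X.π h := tsum_congr fun i => by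
      simp only [abs_of_nonneg (hh0 i)]
    set w := ip X.π h h with hw
    have hw0 : 0 ≤ w := ip_self_nonneg X.π_nonneg
    have hone : normOne X.π h ^ 2 ≤ w * (1 / 4) ^ k := by
      -- Where `h` does not vanish, `|g|` exceeds `T`. Cauchy–Schwarz then gives `T² ‖h‖₁² ≤ ‖h‖²
      -- V`.
      have h1 : T * normOne X.π h ≤ ip X.π h fun i => |g i| := by
        rw [← hmean, ← mean_const_mul]
        refine mean_mono ((hhL.const_mul T).summable X.π_nonneg X.π_hasSum.summable)
          (hhL.summable_mul X.π_nonneg hga) X.π_nonneg fun i => ?_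
        by_cases hi : |g i| ≤ T
        · have : h i = 0 := max_eq_right (by linarith)
          simp [this]
        · rw [mul_comm]
          exact mul_le_mul_of_nonneg_left (not_le.1 hi).le (hh0 i)
      have h2 := ip_mul_self_le X.π_nonneg hhL hga
      have h3 : ip X.π (fun i => |g i|) (fun i => |g i|) = V := tsum_congr fun i => by
        simp only [abs_mul_abs_self]
      rw [h3] at h2
      have h4 : (T * normOne X.π h) ^ 2 ≤ w * V :=
        (pow_le_pow_left₀ (mul_nonneg hT0.le (normOne_nonneg X.π_nonneg)) h1 2).trans h2
      rw [mul_pow, hT2] at h4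
      have h5 : (4 : ℝ) ^ k * normOne X.π h ^ 2 ≤ w := by
        refine le_of_mul_le_mul_right ?_ hV
        linarith
      rw [one_div, inv_pow, ← div_eq_mul_inv, le_div_iff₀ (by positivity)]
      linarith
    have hquarter : ((1 : ℝ) / 4) ^ k ≤ 1 / 4 := by
      simpa using pow_le_pow_of_le_one (a := (1 : ℝ) / 4) (by norm_num) (by norm_num) hk
    -- This is the reason for `1 ≤ k`: the squared mean of `h` is then at most a quarter of `w`.
    have hvar : 3 / 4 * w ≤ variance X.π h := by
      rw [variance_eq_ip, hmean]
      nlinarith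
    have hDh' : (form X.q X.π h).toReal ≤ (form X.q X.π g).toReal := ENNReal.toReal_mono hD.ne hDh
    have hNh := hN h hhL (hDh.trans_lt hD)
    set D := (form X.q X.π g).toReal
    have hD0 : 0 ≤ D := ENNReal.toReal_nonneg
    rcases hw0.eq_or_lt with hw0 | hw0
    · rw [← hw0]; positivity
    have h1 : normOne X.π h ^ (2 / b) ≤ (w * (1 / 4) ^ k) ^ (1 / b) := by
      have := Real.rpow_le_rpow (sq_nonneg _) hone (one_div_nonneg.2 hb.le)
      rw [← Real.rpow_natCast (normOne X.π h), ← Real.rpow_mul (normOne_nonneg X.π_nonneg)] at this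
      convert this using 2
      push_cast; ring
    have h2 : 3 / 4 * w ≤ C * D ^ (1 / a) * (w ^ (1 / b) * ((1 / 4) ^ k) ^ (1 / b)) := by
      rw [← Real.mul_rpow hw0.le (by positivity)]
      refine hvar.trans (hNh.trans ?_)
      gcongr
      exact Real.rpow_nonneg (normOne_nonneg X.π_nonneg) _
    have h5 : w = w ^ (1 / a) * w ^ (1 / b) := by
      rw [← Real.rpow_add hw0, show 1 / a + 1 / b = 1 by simpa using hab.inv_add_inv_eq_one,
        Real.rpow_one]
    have h6 : w ^ (1 / a) ≤ 4 / 3 * C * D ^ (1 / a) * ((1 / 4) ^ k) ^ (1 / b) := by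
      refine le_of_mul_le_mul_right ?_ (Real.rpow_pos_of_pos hw0 (1 / b))
      rw [← h5]
      linarith
    have h7 := Real.rpow_le_rpow (by positivity) h6 ha.le
    rw [Real.mul_rpow (by positivity) (by positivity), Real.mul_rpow (by positivity) (by positivity),
      ← Real.rpow_mul hw0.le, ← Real.rpow_mul hD0,
      one_div_mul_cancel ha.ne', Real.rpow_one, Real.rpow_one, ← Real.rpow_mul (by positivity),
      ← Real.rpow_natCast, ← Real.rpow_mul (by norm_num)] at h7
    refine h7.trans (le_of_eq ?_)
    rw [hρ, ← Real.rpow_natCast, ← Real.rpow_mul (by norm_num)]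
    congr 2
    ring
  have hZs : Summable fun k : ℕ => ((k : ℝ) + 3) * ρ ^ (k + 1) := by
    have h1 := summable_pow_mul_geometric_of_norm_lt_one 1
      (show ‖ρ‖ < 1 by rwa [Real.norm_of_nonneg hρ0.le])
    have h2 := summable_geometric_of_lt_one hρ0.le hρ1
    refine ((h1.mul_left ρ).add (h2.mul_left (3 * ρ))).congr fun k => ?_
    rw [pow_succ]; ring
  set Z := ∑' k : ℕ, ((k : ℝ) + 3) * ρ ^ (k + 1)
  have hZ0 : 0 ≤ Z := tsum_nonneg fun k => by positivity
  have hconst : CP ≤ 3 * CP + 8 * K * Z := by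
    have : 0 ≤ 8 * K * Z := by positivity
    linarith
  refine logSobolev_of_centered (C := 3 * CP + 8 * K * Z) (by positivity)
    (fun f hf hD => (hP f hf hD).trans (mul_le_mul_of_nonneg_right hconst ENNReal.toReal_nonneg))
    fun g hg hD hm hV => ?_
  have htail := htail g hg hD hV
  have hPg := hP g hg hD
  rw [variance_eq_ip, hm] at hPg
  set V := ip X.π g g with hVdef
  set D := (form X.q X.π g).toReal
  have hD0 : 0 ≤ D := ENNReal.toReal_nonneg
  set h : ℕ → E → ℝ := fun k i => max (|g i| - 2 ^ k * Real.sqrt V) 0 with hh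
  have hhL : ∀ k, IsL2 X.π (h k) := fun k => hg.mono X.π_nonneg fun i => by
    rw [abs_of_nonneg (le_max_right _ _)]
    exact max_le (by have : 0 ≤ 2 ^ k * Real.sqrt V := by positivity
                     linarith) (abs_nonneg _)
  have hrow : ∀ k : ℕ, HasSum (fun i => ((k : ℝ) + 3) * (X.π i * h (k + 1) i ^ 2))
      (((k : ℝ) + 3) * ip X.π (h (k + 1)) (h (k + 1))) := fun k => by
    rw [ip_self_eq]; exact (Summable.hasSum (hhL (k + 1))).mul_left _
  have hrle : ∀ k : ℕ, ((k : ℝ) + 3) * ip X.π (h (k + 1)) (h (k + 1)) ≤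
      K * D * (((k : ℝ) + 3) * ρ ^ (k + 1)) := fun k => by
    have := mul_le_mul_of_nonneg_left (htail (k + 1) (by omega)) (show 0 ≤ (k : ℝ) + 3 by positivity)
    linarith
  have hrs : Summable fun k : ℕ => ((k : ℝ) + 3) * ip X.π (h (k + 1)) (h (k + 1)) :=
    Summable.of_nonneg_of_le (fun k => mul_nonneg (by positivity) (ip_self_nonneg X.π_nonneg)) hrle
      (hZs.mul_left _)
  have hnn : ∀ (k : ℕ) (i : E), 0 ≤ ((k : ℝ) + 3) * (X.π i * h (k + 1) i ^ 2) := fun k i => by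
    have := X.π_nonneg i
    positivity
  have hprod := hasSum_prod_of_nonneg
    (F := fun z : ℕ × E => ((z.1 : ℝ) + 3) * (X.π z.2 * h (z.1 + 1) z.2 ^ 2))
    (fun z => hnn z.1 z.2) hrow hrs.hasSum
  have hswap := hasSum_prod_swap (F := fun (k : ℕ) (i : E) =>
    ((k : ℝ) + 3) * (X.π i * h (k + 1) i ^ 2)) hprod
  have hfib : ∀ i, Summable fun k : ℕ => ((k : ℝ) + 3) * (X.π i * h (k + 1) i ^ 2) := fun i =>
    hswap.summable.prod_factor i
  have hcol : HasSum (fun i => ∑' k : ℕ, ((k : ℝ) + 3) * (X.π i * h (k + 1) i ^ 2))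
      (∑' k : ℕ, ((k : ℝ) + 3) * ip X.π (h (k + 1)) (h (k + 1))) :=
    hswap.prod_fiberwise fun i => (hfib i).hasSum
  have hpt : ∀ i, X.π i * (g i ^ 2 * Real.posLog (g i ^ 2 / V)) ≤
      3 * (X.π i * g i ^ 2) + 8 * ∑' k : ℕ, ((k : ℝ) + 3) * (X.π i * h (k + 1) i ^ 2) := by
    intro i
    have hsum0 : 0 ≤ ∑' k : ℕ, ((k : ℝ) + 3) * (X.π i * h (k + 1) i ^ 2) :=
      tsum_nonneg fun k => hnn k i
    have hπ := X.π_nonneg i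
    have hsV := Real.sqrt_pos.2 hV
    set t := |g i| / Real.sqrt V with ht
    have htg : |g i| = t * Real.sqrt V := by rw [ht, div_mul_cancel₀ _ hsV.ne']
    have ht2 : g i ^ 2 / V = t ^ 2 := by rw [ht, div_pow, sq_abs, Real.sq_sqrt hV.le]
    have ht0 : 0 ≤ t := by positivity
    rw [ht2]
    by_cases ht4 : t < 4
    · have h1 : Real.posLog (t ^ 2) ≤ 3 := by
        have e1 : Real.posLog (t ^ 2) ≤ Real.posLog (2 ^ 4 : ℝ) :=
          Real.posLog_le_posLog (sq_nonneg t) (by nlinarith)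
        refine e1.trans (max_le (by norm_num) ?_)
        rw [Real.log_pow]
        have := Real.log_two_lt_d9
        push_cast
        linarith
      have := mul_le_mul_of_nonneg_left h1 (mul_nonneg hπ (sq_nonneg (g i)))
      linarith
    -- Choose `k` with `2^{k+2} ≤ t < 2^{k+3}`. The height `2^{k+1} √V` is then at most half of `|g
    -- i|`, so one truncation captures a quarter of `g i ^ 2`, and `log t² ≤ 2 (k + 3)`.
    · obtain ⟨n, hn1, hn2⟩ := exists_nat_pow_near (y := (2 : ℝ)) (x := t) (by linarith)
        (by norm_num)
      obtain ⟨k, rfl⟩ : ∃ k, n = k + 2 := by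
        refine ⟨n - 2, (Nat.sub_add_cancel ?_).symm⟩
        by_contra hlt
        have : (2 : ℝ) ^ (n + 1) ≤ 2 ^ 2 := pow_le_pow_right₀ (by norm_num) (by omega)
        linarith
      have h1 : g i ^ 2 ≤ 4 * h (k + 1) i ^ 2 := by
        have e1 : |g i| / 2 ≤ h (k + 1) i := by
          refine le_max_of_le_left ?_
          rw [htg]
          have : (2 : ℝ) ^ (k + 1) ≤ t / 2 := by
            rw [le_div_iff₀ two_pos, ← pow_succ]; exact hn1
          nlinarith
        have e2 := pow_le_pow_left₀ (by positivity) e1 2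
        rw [div_pow, sq_abs] at e2
        linarith
      have h2 : Real.posLog (t ^ 2) ≤ 2 * ((k : ℝ) + 3) := by
        have e1 : Real.posLog (t ^ 2) ≤ Real.posLog ((2 ^ (k + 2 + 1)) ^ 2 : ℝ) :=
          Real.posLog_le_posLog (sq_nonneg t) (pow_le_pow_left₀ ht0 hn2.le 2)
        refine e1.trans (max_le (by positivity) ?_)
        rw [Real.log_pow, Real.log_pow]
        have := Real.log_two_lt_d9
        push_cast
        nlinarith
      have h3 : ((k : ℝ) + 3) * (X.π i * h (k + 1) i ^ 2) ≤ _ :=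
        (hfib i).le_tsum k fun j _ => hnn j i
      have h4 : g i ^ 2 * Real.posLog (t ^ 2) ≤ 4 * h (k + 1) i ^ 2 * (2 * ((k : ℝ) + 3)) :=
        mul_le_mul h1 h2 Real.posLog_nonneg (by positivity)
      have h5 := mul_le_mul_of_nonneg_left h4 hπ
      have h6 : 0 ≤ X.π i * g i ^ 2 := by positivity
      linarith
  have hgs : HasSum (fun i => X.π i * g i ^ 2) V := by
    rw [hVdef, ip_self_eq]; exact Summable.hasSum hg
  have hub := (hgs.mul_left 3).add (hcol.mul_left 8)
  have hsum : Summable fun i => X.π i * (g i ^ 2 * Real.posLog (g i ^ 2 / V)) :=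
    Summable.of_nonneg_of_le (fun i => mul_nonneg (X.π_nonneg i)
      (mul_nonneg (sq_nonneg _) Real.posLog_nonneg)) hpt hub.summable
  refine ⟨hsum, ?_⟩
  have h1 : mean X.π (fun i => g i ^ 2 * Real.posLog (g i ^ 2 / V)) ≤ _ :=
    hasSum_le hpt hsum.hasSum hub
  have h2 : ∑' k : ℕ, ((k : ℝ) + 3) * ip X.π (h (k + 1)) (h (k + 1)) ≤ K * D * Z := by
    rw [← tsum_mul_left]
    exact hrs.tsum_le_tsum hrle (hZs.mul_left _)
  have h3 : V ≤ CP * D := by linarith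
  linarith

end ReversibleChain

end MarkovChain

/-! ### Rate matrices restricted to `[0, n)` and their exponentials on bounded functions -/

namespace MarkovChain

theorem add_mul_le_of_deriv_ge {φ φ' : ℝ → ℝ} (h : ∀ s, HasDerivAt φ (φ' s) s) {c t : ℝ}
    (ht : 0 ≤ t) (hc : ∀ s, 0 ≤ s → c ≤ φ' s) : φ 0 + c * t ≤ φ t := by
  have := (convex_Ici (0 : ℝ)).mul_sub_le_image_sub_of_le_deriv (f := φ) (C := c)
    (fun s _ => (h s).continuousAt.continuousWithinAt)
    (fun s _ => (h s).differentiableAt.differentiableWithinAt)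
    (fun s hs => by rw [(h s).deriv]; exact hc s (interior_subset hs)) 0 Set.self_mem_Ici t ht ht
  linarith

/-- Bounded functions on `ℕ`. -/
def BddFun : Type := BoundedContinuousFunction ℕ ℝ

namespace BddFun

noncomputable instance : NormedAddCommGroup BddFun :=
  inferInstanceAs (NormedAddCommGroup (BoundedContinuousFunction ℕ ℝ))

noncomputable instance : NormedSpace ℝ BddFun :=
  inferInstanceAs (NormedSpace ℝ (BoundedContinuousFunction ℕ ℝ))

instance : CompleteSpace BddFun := inferInstanceAs (CompleteSpace (BoundedContinuousFunction ℕ ℝ))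

instance : FunLike BddFun ℕ ℝ := inferInstanceAs (FunLike (BoundedContinuousFunction ℕ ℝ) ℕ ℝ)

/-- Evaluation at a point. -/
noncomputable def eval (i : ℕ) : BddFun →L[ℝ] ℝ :=
  BoundedContinuousFunction.evalCLM (α := ℕ) (β := ℝ) ℝ i

theorem smul_apply (c : ℝ) (u : BddFun) (i : ℕ) : (c • u) i = c * u i := rfl

theorem sum_apply {ι : Type*} (s : Finset ι) (f : ι → BddFun) (i : ℕ) :
    (∑ k ∈ s, f k) i = ∑ k ∈ s, f k i := map_sum (eval i) f s

theorem ext {u v : BddFun} (h : ∀ i, u i = v i) : u = v := DFunLike.ext _ _ h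

end BddFun

/-- The indicator of a point as a bounded function. -/
noncomputable def bddPoint (i : ℕ) : BddFun :=
  BoundedContinuousFunction.ofNormedAddCommGroupDiscrete (pointFn i) 1 fun j => by
    by_cases h : j = i
    · simp [h, pointFn_self]
    · simp [pointFn_of_ne h]

theorem bddPoint_apply (i j : ℕ) : bddPoint i j = pointFn i j := rfl

/-- The restriction of `f` to `[0, n)` as a bounded function. -/
noncomputable def bddRestrict (n : ℕ) (f : ℕ → ℝ) : BddFun :=
  ∑ j ∈ Finset.range n, f j • bddPoint j

theorem sum_range_mul_pointFn (n : ℕ) (f : ℕ → ℝ) (i : ℕ) :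
    ∑ j ∈ Finset.range n, f j * pointFn j i = if i < n then f i else 0 := by
  split_ifs with h
  · rw [Finset.sum_eq_single i]
    · rw [pointFn_self, mul_one]
    · intro j _ hj
      rw [pointFn_of_ne hj.symm, mul_zero]
    · intro h'; exact absurd (Finset.mem_range.2 h) h'
  · refine Finset.sum_eq_zero fun j hj => ?_
    rw [pointFn_of_ne (by have := Finset.mem_range.1 hj; omega), mul_zero]

theorem bddRestrict_apply (n : ℕ) (f : ℕ → ℝ) (i : ℕ) :
    bddRestrict n f i = if i < n then f i else 0 := by
  rw [← sum_range_mul_pointFn, bddRestrict, BddFun.sum_apply]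
  rfl

theorem bddRestrict_eq_self {n : ℕ} {u : BddFun} (hu : ∀ i, n ≤ i → u i = 0) :
    bddRestrict n u = u := by
  refine BddFun.ext fun i => ?_
  rw [bddRestrict_apply]
  split_ifs with h
  · rfl
  · exact (hu i (not_lt.1 h)).symm

/-- The restriction of the rate matrix `q` to `[0, n) × [0, n)`. -/
noncomputable def truncOp (q : ℕ → ℕ → ℝ) (n : ℕ) : BddFun →L[ℝ] BddFun :=
  ∑ i ∈ Finset.range n, ∑ j ∈ Finset.range n,
    q i j • (BddFun.eval j).smulRight (bddPoint i)

theorem truncOp_apply (q : ℕ → ℕ → ℝ) (n : ℕ) (u : BddFun) (i : ℕ) :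
    truncOp q n u i = if i < n then ∑ j ∈ Finset.range n, q i j * u j else 0 := by
  rw [← sum_range_mul_pointFn (f := fun i => ∑ j ∈ Finset.range n, q i j * u j)]
  have h : truncOp q n u = ∑ k ∈ Finset.range n, ∑ j ∈ Finset.range n,
      q k j • (u j • bddPoint k) := by
    simp only [truncOp, sum_apply]
    rfl
  rw [h, BddFun.sum_apply]
  refine Finset.sum_congr rfl fun k _ => ?_
  rw [Finset.sum_mul, BddFun.sum_apply]
  exact Finset.sum_congr rfl fun j _ => by
    rw [BddFun.smul_apply, BddFun.smul_apply, bddPoint_apply]; ring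

/-- Positivity preserving operators. -/
def IsPosOp (A : BddFun →L[ℝ] BddFun) : Prop := ∀ u : BddFun, (∀ i, 0 ≤ u i) → ∀ i, 0 ≤ A u i

/-- The functional `A ↦ (A u)(i)` on operators. -/
noncomputable def entryCLM (u : BddFun) (i : ℕ) : (BddFun →L[ℝ] BddFun) →L[ℝ] ℝ :=
  (BddFun.eval i).comp (ContinuousLinearMap.apply ℝ BddFun u)

theorem entryCLM_apply (u : BddFun) (i : ℕ) (A : BddFun →L[ℝ] BddFun) :
    entryCLM u i A = A u i := rfl

theorem hasSum_exp_apply (A : BddFun →L[ℝ] BddFun) (u : BddFun) (i : ℕ) :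
    HasSum (fun k : ℕ => ((k.factorial : ℝ)⁻¹) * (A ^ k) u i) (NormedSpace.exp A u i) := by
  have h := (entryCLM u i).hasSum (NormedSpace.exp_series_hasSum_exp' (𝕂 := ℝ) A)
  refine hasSum_of_eq h (fun k => ?_) rfl
  rw [map_smul, entryCLM_apply, smul_eq_mul]

/-- A rate matrix does not preserve positivity because of its diagonal, but a scalar shift of it
does, and the shift changes the exponential only by a positive factor. -/
theorem exp_smul_eq_shift (A : BddFun →L[ℝ] BddFun) (t c : ℝ) :
    NormedSpace.exp (t • A) = Real.exp (-(t * c)) •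
      NormedSpace.exp (t • (A + c • (1 : BddFun →L[ℝ] BddFun))) := by
  let +nondep : NormedAlgebra ℚ (BddFun →L[ℝ] BddFun) := .restrictScalars ℚ ℝ _
  have h1 : t • A = algebraMap ℝ (BddFun →L[ℝ] BddFun) (-(t * c)) +
      t • (A + c • (1 : BddFun →L[ℝ] BddFun)) := by
    rw [Algebra.algebraMap_eq_smul_one, smul_add, smul_smul]
    module
  rw [h1, NormedSpace.exp_add_of_commute (Algebra.commutes _ _), ← NormedSpace.algebraMap_exp_comm,
    ← Real.exp_eq_exp_ℝ, Algebra.algebraMap_eq_smul_one, smul_mul_assoc, one_mul]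

theorem IsPosOp.pow {A : BddFun →L[ℝ] BddFun} (hA : IsPosOp A) (k : ℕ) : IsPosOp (A ^ k) := by
  induction k with
  | zero => intro u hu i; simpa using hu i
  | succ k ih =>
    intro u hu i
    rw [pow_succ]
    exact ih _ (hA u hu) i

theorem IsPosOp.exp {A : BddFun →L[ℝ] BddFun} (hA : IsPosOp A) {t : ℝ} (ht : 0 ≤ t) :
    IsPosOp (NormedSpace.exp (t • A)) := by
  intro u hu i
  refine (hasSum_exp_apply _ u i).nonneg fun k => ?_
  rw [smul_pow]
  exact mul_nonneg (by positivity) (mul_nonneg (pow_nonneg ht k) (hA.pow k u hu i))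

theorem IsPosOp.mono {A : BddFun →L[ℝ] BddFun} (hA : IsPosOp A) {u v : BddFun}
    (h : ∀ i, u i ≤ v i) (i : ℕ) : A u i ≤ A v i := by
  have := hA (v - u) (fun i => sub_nonneg.2 (h i)) i
  rw [map_sub] at this
  exact sub_nonneg.1 this

/-- Compare the exponential series term by term, using `A^k (A u) ≤ B^k (A u) ≤ B^k (B u)`. The
invariant class `W` is needed because `A ≤ B` will hold only on nonnegative functions supported in
`[0, n)`. -/
theorem exp_apply_le_exp_apply {A B : BddFun →L[ℝ] BddFun} {W : BddFun → Prop} (hB : IsPosOp B)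
    (hW : ∀ u, W u → W (A u)) (hAB : ∀ u, W u → ∀ i, A u i ≤ B u i) {t : ℝ} (ht : 0 ≤ t)
    {u : BddFun} (hu : W u) (i : ℕ) :
    NormedSpace.exp (t • A) u i ≤ NormedSpace.exp (t • B) u i := by
  have hpow : ∀ (k : ℕ) (u : BddFun), W u → ∀ i, (A ^ k) u i ≤ (B ^ k) u i := by
    intro k
    induction k with
    | zero => intro u _ i; simp
    | succ k ih =>
      intro u hu i
      rw [pow_succ, pow_succ]
      exact (ih _ (hW u hu) i).trans ((hB.pow k).mono (hAB u hu) i)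
  refine hasSum_le (fun k => ?_) (hasSum_exp_apply _ u i) (hasSum_exp_apply _ u i)
  rw [smul_pow, smul_pow]
  exact mul_le_mul_of_nonneg_left (mul_le_mul_of_nonneg_left (hpow k u hu i) (pow_nonneg ht k))
    (by positivity)

/-- A conservative rate matrix on `ℕ` in detailed balance with a probability distribution. -/
structure IsReversibleRates (q : ℕ → ℕ → ℝ) (π : ℕ → ℝ) : Prop where
  isQMatrix : IsQMatrix q
  pos : ∀ i, 0 < π i
  hasSum : HasSum π 1
  balance : ∀ i j, π i * q i j = π j * q j i

/-- The semigroup generated by the restricted rate matrix. -/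
noncomputable def truncExp (q : ℕ → ℕ → ℝ) (n : ℕ) (t : ℝ) : BddFun →L[ℝ] BddFun :=
  NormedSpace.exp (t • truncOp q n)

theorem truncExp_zero (q : ℕ → ℕ → ℝ) (n : ℕ) : truncExp q n 0 = 1 := by
  rw [truncExp, zero_smul, NormedSpace.exp_zero]

theorem truncExp_add (q : ℕ → ℕ → ℝ) (n : ℕ) (s t : ℝ) :
    truncExp q n (s + t) = truncExp q n s * truncExp q n t := by
  let +nondep : NormedAlgebra ℚ (BddFun →L[ℝ] BddFun) := .restrictScalars ℚ ℝ _
  rw [truncExp, add_smul]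
  exact NormedSpace.exp_add_of_commute
    (((Commute.refl _).smul_left s).smul_right t)

theorem hasDerivAt_truncExp (q : ℕ → ℕ → ℝ) (n : ℕ) (u : BddFun) (i : ℕ) (t : ℝ) :
    HasDerivAt (fun t => truncExp q n t u i) (truncExp q n t (truncOp q n u) i) t := by
  have h := hasDerivAt_exp_smul_const (𝕂 := ℝ) (truncOp q n) t
  exact (entryCLM u i).hasFDerivAt.comp_hasDerivAt t h

theorem truncExp_apply_of_le (q : ℕ → ℕ → ℝ) (n : ℕ) (t : ℝ) (u : BddFun) {i : ℕ} (hi : n ≤ i) :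
    truncExp q n t u i = u i := by
  refine (hasSum_exp_apply _ u i).unique ?_
  have := hasSum_single (f := fun k : ℕ => ((k.factorial : ℝ)⁻¹) * ((t • truncOp q n) ^ k) u i) 0
    fun k hk => by
      obtain ⟨k, rfl⟩ := Nat.exists_eq_succ_of_ne_zero hk
      have : ((t • truncOp q n) ^ (k + 1)) u i = t * truncOp q n (((t • truncOp q n) ^ k) u) i := by
        rw [pow_succ']; rfl
      simp only [Nat.succ_eq_add_one]
      rw [this, truncOp_apply, if_neg (not_lt.2 hi), mul_zero, mul_zero]
  simpa using this

/-- The pairing of `L²(π)` restricted to `[0, n)`. -/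
noncomputable def truncIp (π : ℕ → ℝ) (n : ℕ) (u v : BddFun) : ℝ :=
  ∑ i ∈ Finset.range n, π i * (u i * v i)

namespace IsReversibleRates

variable {q : ℕ → ℕ → ℝ} {π : ℕ → ℝ}

theorem diag_nonpos (H : IsReversibleRates q π) (i : ℕ) : q i i ≤ 0 := by
  have h := (H.isQMatrix.hasSum_row i)
  have h1 := h.update i 0
  have h2 := h1.nonneg fun j => by
    by_cases hj : j = i
    · subst hj; simp
    · rw [Function.update_of_ne hj]; exact H.isQMatrix.nonneg_of_ne i j (Ne.symm hj)
  linarith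

theorem sum_range_row_nonpos (H : IsReversibleRates q π) {i n : ℕ} (hi : i < n) :
    ∑ j ∈ Finset.range n, q i j ≤ 0 := by
  refine (sum_le_hasSum _ (fun j hj => ?_) (H.isQMatrix.hasSum_row i))
  exact H.isQMatrix.nonneg_of_ne i j fun h => hj (Finset.mem_range.2 (h ▸ hi))

theorem isPosOp_shift (H : IsReversibleRates q π) {n : ℕ} {c : ℝ} (hc0 : 0 ≤ c)
    (hc : ∀ i < n, -q i i ≤ c) : IsPosOp (truncOp q n + c • (1 : BddFun →L[ℝ] BddFun)) := by
  intro u hu i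
  have h1 : (truncOp q n + c • (1 : BddFun →L[ℝ] BddFun)) u i = truncOp q n u i + c * u i := rfl
  rw [h1, truncOp_apply]
  split_ifs with h
  · rw [← Finset.add_sum_erase _ _ (Finset.mem_range.2 h)]
    have h2 : 0 ≤ ∑ j ∈ (Finset.range n).erase i, q i j * u j := Finset.sum_nonneg fun j hj =>
      mul_nonneg (H.isQMatrix.nonneg_of_ne i j (Finset.ne_of_mem_erase hj).symm) (hu j)
    have h3 := mul_nonneg (show 0 ≤ q i i + c by linarith [hc i h]) (hu i)
    linarith
  · have := mul_nonneg hc0 (hu i)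
    linarith

theorem exists_bound (q : ℕ → ℕ → ℝ) (n : ℕ) : ∃ c : ℝ, 0 ≤ c ∧ ∀ i < n, -q i i ≤ c :=
  ⟨∑ i ∈ Finset.range n, |q i i|, Finset.sum_nonneg fun _ _ => abs_nonneg _, fun _ hi =>
    (neg_le_abs _).trans (Finset.single_le_sum (f := fun i => |q i i|)
      (fun _ _ => abs_nonneg _) (Finset.mem_range.2 hi))⟩

theorem isPosOp_truncExp (H : IsReversibleRates q π) (n : ℕ) {t : ℝ} (ht : 0 ≤ t) :
    IsPosOp (truncExp q n t) := by
  obtain ⟨c, hc0, hc⟩ := exists_bound q n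
  intro u hu i
  rw [truncExp, exp_smul_eq_shift _ t c]
  exact mul_nonneg (Real.exp_pos _).le ((H.isPosOp_shift hc0 hc).exp ht u hu i)

/-- Enlarging the window only adds nonnegative off-diagonal rates, as seen by functions supported in
the smaller one. One shift `c` serves for both windows. -/
theorem truncExp_le_succ (H : IsReversibleRates q π) (n : ℕ) {t : ℝ} (ht : 0 ≤ t) {u : BddFun}
    (hu : ∀ i, 0 ≤ u i) (hun : ∀ i, n ≤ i → u i = 0) (i : ℕ) :
    truncExp q n t u i ≤ truncExp q (n + 1) t u i := by
  obtain ⟨c, hc0, hc⟩ := exists_bound q (n + 1)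
  have hpos : IsPosOp (truncOp q n + c • (1 : BddFun →L[ℝ] BddFun)) :=
    H.isPosOp_shift hc0 fun i hi => hc i (by omega)
  have happ : ∀ (m : ℕ) (u : BddFun) (i : ℕ),
    (truncOp q m + c • (1 : BddFun →L[ℝ] BddFun)) u i = truncOp q m u i + c * u i :=
    fun _ _ _ => rfl
  rw [truncExp, truncExp, exp_smul_eq_shift _ t c, exp_smul_eq_shift (truncOp q (n + 1)) t c]
  refine mul_le_mul_of_nonneg_left ?_ (Real.exp_pos _).le
  refine exp_apply_le_exp_apply (W := fun u => (∀ i, 0 ≤ u i) ∧ ∀ i, n ≤ i → u i = 0)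
    (H.isPosOp_shift hc0 hc) (fun u hu => ⟨hpos u hu.1, fun i hi => ?_⟩) (fun u hu i => ?_) ht
    ⟨hu, hun⟩ i
  · rw [happ, truncOp_apply, if_neg (not_lt.2 hi), hu.2 i hi, mul_zero, add_zero]
  · rw [happ, happ]
    refine add_le_add_left ?_ _
    rw [truncOp_apply, truncOp_apply]
    split_ifs with h1 h2 h2
    · rw [Finset.sum_range_succ, hu.2 n le_rfl, mul_zero, add_zero]
    · omega
    · rw [Finset.sum_range_succ, hu.2 n le_rfl, mul_zero, add_zero]
      exact Finset.sum_nonneg fun j hj => mul_nonneg (H.isQMatrix.nonneg_of_ne i j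
        (by have := Finset.mem_range.1 hj; omega)) (hu.1 j)
    · exact le_rfl

/-- Integrate the derivative `e^{sA} A u` of `e^{sA} u` over `[0, t]`. -/
theorem truncExp_le_add (q : ℕ → ℕ → ℝ) (n : ℕ) {u : BddFun} {i : ℕ} {K : ℝ}
    (hK : ∀ s, 0 ≤ s → truncExp q n s (truncOp q n u) i ≤ K) {t : ℝ} (ht : 0 ≤ t) :
    truncExp q n t u i ≤ u i + K * t := by
  have h := add_mul_le_of_deriv_ge (φ := fun t => -truncExp q n t u i) (c := -K)
    (fun s => (hasDerivAt_truncExp q n u i s).neg) ht fun s hs => neg_le_neg (hK s hs)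
  simp only [truncExp_zero] at h
  have h1 : (1 : BddFun →L[ℝ] BddFun) u i = u i := rfl
  rw [h1] at h
  linarith

/-- Restricted rows have nonpositive sums, so the generator sends `1_{[0,n)}` to a nonpositive
function: killing loses mass. -/
theorem truncExp_restrict_one_le (H : IsReversibleRates q π) (n : ℕ) {t : ℝ} (ht : 0 ≤ t) (i : ℕ) :
    truncExp q n t (bddRestrict n fun _ => 1) i ≤ 1 := by
  have h1 : ∀ j, truncOp q n (bddRestrict n fun _ => 1) j ≤ 0 := fun j => by
    rw [truncOp_apply]
    split_ifs with h
    · refine le_trans (le_of_eq (Finset.sum_congr rfl fun k hk => ?_)) (H.sum_range_row_nonpos h)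
      rw [bddRestrict_apply, if_pos (Finset.mem_range.1 hk), mul_one]
    · exact le_rfl
  have h2 := truncExp_le_add q n (u := bddRestrict n fun _ => 1) (i := i) (K := 0) (fun s hs => by
    have := (H.isPosOp_truncExp n hs).mono (v := 0) h1 i
    rw [map_zero] at this
    exact this) ht
  refine h2.trans ?_
  rw [zero_mul, add_zero, bddRestrict_apply]
  split_ifs <;> norm_num

/-- Positivity turns the drift bound `A u ≤ K` on the window into `e^{sA} A u ≤ K`, because the
killed semigroup is sub-Markov. -/
theorem truncExp_le_add_of_truncOp_le (H : IsReversibleRates q π) (n : ℕ) {u : BddFun} {K : ℝ}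
    (hK0 : 0 ≤ K) (hK : ∀ i < n, truncOp q n u i ≤ K) {t : ℝ} (ht : 0 ≤ t) (i : ℕ) :
    truncExp q n t u i ≤ u i + K * t := by
  refine truncExp_le_add q n (fun s hs => ?_) ht
  have h1 : ∀ j, truncOp q n u j ≤ (K • bddRestrict n fun _ => 1) j := fun j => by
    rw [BddFun.smul_apply, bddRestrict_apply]
    split_ifs with h
    · simpa using hK j h
    · rw [truncOp_apply, if_neg h, mul_zero]
  refine ((H.isPosOp_truncExp n hs).mono h1 i).trans ?_
  rw [map_smul, BddFun.smul_apply]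
  exact mul_le_of_le_one_right hK0 (H.truncExp_restrict_one_le n hs i)

theorem truncIp_truncOp_comm (H : IsReversibleRates q π) (n : ℕ) (u v : BddFun) :
    truncIp π n (truncOp q n u) v = truncIp π n u (truncOp q n v) := by
  have h : ∀ u v : BddFun, truncIp π n (truncOp q n u) v =
      ∑ i ∈ Finset.range n, ∑ j ∈ Finset.range n, π i * q i j * (u j * v i) := fun u v => by
    refine Finset.sum_congr rfl fun i hi => ?_
    rw [truncOp_apply, if_pos (Finset.mem_range.1 hi), Finset.sum_mul, Finset.mul_sum]
    exact Finset.sum_congr rfl fun j _ => by ring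
  have hc : ∀ u v : BddFun, truncIp π n u v = truncIp π n v u := fun u v =>
    Finset.sum_congr rfl fun i _ => by ring
  rw [hc u, h, h, Finset.sum_comm]
  refine Finset.sum_congr rfl fun i _ => Finset.sum_congr rfl fun j _ => ?_
  rw [H.balance]; ring

theorem truncIp_truncExp_comm (H : IsReversibleRates q π) (n : ℕ) (t : ℝ) (u v : BddFun) :
    truncIp π n (truncExp q n t u) v = truncIp π n u (truncExp q n t v) := by
  have hpow : ∀ (k : ℕ) (u v : BddFun), truncIp π n (((t • truncOp q n) ^ k) u) v
      = truncIp π n u (((t • truncOp q n) ^ k) v) := by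
    intro k
    induction k with
    | zero => intro u v; rfl
    | succ k ih =>
      intro u v
      have e1 : ((t • truncOp q n) ^ (k + 1)) u
        = ((t • truncOp q n) ^ k) ((t • truncOp q n) u) := by rw [pow_succ]; rfl
      have e2 : ((t • truncOp q n) ^ (k + 1)) v
        = (t • truncOp q n) (((t • truncOp q n) ^ k) v) := by rw [pow_succ']; rfl
      have e3 : ∀ u v : BddFun, truncIp π n ((t • truncOp q n) u) v
          = t * truncIp π n (truncOp q n u) v := fun u v => by
        rw [truncIp, truncIp, Finset.mul_sum]
        refine Finset.sum_congr rfl fun i _ => ?_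
        have : (t • truncOp q n) u i = t * truncOp q n u i := rfl
        rw [this]; ring
      have hc : ∀ u v : BddFun, truncIp π n u v = truncIp π n v u := fun u v =>
        Finset.sum_congr rfl fun i _ => by ring
      rw [e1, e2, ih, e3, hc u, e3, H.truncIp_truncOp_comm, hc]
  have h1 : HasSum (fun k : ℕ => ((k.factorial : ℝ)⁻¹) *
      truncIp π n (((t • truncOp q n) ^ k) u) v) (truncIp π n (truncExp q n t u) v) := by
    have := hasSum_sum (s := Finset.range n) fun i _ =>
      ((hasSum_exp_apply (t • truncOp q n) u i).mul_right (v i)).mul_left (π i)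
    refine hasSum_of_eq this (fun k => ?_) rfl
    rw [truncIp, Finset.mul_sum]
    exact Finset.sum_congr rfl fun i _ => by ring
  have h2 : HasSum (fun k : ℕ => ((k.factorial : ℝ)⁻¹) *
      truncIp π n u (((t • truncOp q n) ^ k) v)) (truncIp π n u (truncExp q n t v)) := by
    have := hasSum_sum (s := Finset.range n) fun i _ =>
      ((hasSum_exp_apply (t • truncOp q n) v i).mul_left (u i)).mul_left (π i)
    refine hasSum_of_eq this (fun k => ?_) rfl
    rw [truncIp, Finset.mul_sum]
    exact Finset.sum_congr rfl fun i _ => by ring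
  exact h1.unique (hasSum_of_eq h2 (fun k => by rw [hpow]) rfl)

theorem hasDerivAt_truncIp (q : ℕ → ℕ → ℝ) (π : ℕ → ℝ) (n : ℕ) (u v : BddFun) (t : ℝ) :
    HasDerivAt (fun t => truncIp π n (truncExp q n t u) v)
      (truncIp π n (truncExp q n t (truncOp q n u)) v) t := by
  have := HasDerivAt.fun_sum (u := Finset.range n) fun i _ =>
    ((hasDerivAt_truncExp q n u i t).mul_const (v i)).const_mul (π i)
  exact this

theorem truncIp_sub_truncExp_le (H : IsReversibleRates q π) (n : ℕ) (u : BddFun) {t : ℝ}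
    (ht : 0 ≤ t) :
    truncIp π n u u - truncIp π n (truncExp q n t u) u ≤ t * -truncIp π n (truncOp q n u) u := by
  have hcomm : ∀ s (v : BddFun), truncExp q n s (truncOp q n v) = truncOp q n (truncExp q n s v) := by
    intro s v
    have : Commute (truncExp q n s) (truncOp q n) :=
      ((Commute.refl (truncOp q n)).smul_left s).exp_left
    exact congrArg (fun A : BddFun →L[ℝ] BddFun => A v) this.eq
  -- This is the second derivative of `s ↦ ⟨e^{sA} u, u⟩`, equal to `‖e^{sA/2} A u‖²` by symmetry.
  -- Hence the first derivative never falls below its value `⟨A u, u⟩` at zero.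
  have hsq : ∀ s, 0 ≤ truncIp π n (truncExp q n s (truncOp q n (truncOp q n u))) u := by
    intro s
    have h1 : truncExp q n s (truncOp q n (truncOp q n u)) =
        truncOp q n (truncExp q n (s / 2) (truncExp q n (s / 2) (truncOp q n u))) := by
      rw [hcomm]
      have : truncExp q n s = truncExp q n (s / 2) * truncExp q n (s / 2) := by
        rw [← truncExp_add, add_halves]
      rw [this]; rfl
    rw [h1, H.truncIp_truncOp_comm, H.truncIp_truncExp_comm]
    exact Finset.sum_nonneg fun i _ => mul_nonneg (H.pos i).le (mul_self_nonneg _)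
  have h0 : ∀ v : BddFun, truncExp q n 0 v = v := fun v => by rw [truncExp_zero]; rfl
  have hψ : ∀ s, 0 ≤ s → truncIp π n (truncOp q n u) u ≤
      truncIp π n (truncExp q n s (truncOp q n u)) u := fun s hs => by
    have := add_mul_le_of_deriv_ge (c := 0)
      (fun s => hasDerivAt_truncIp q π n (truncOp q n u) u s) hs fun r _ => hsq r
    simpa [h0] using this
  have := add_mul_le_of_deriv_ge (fun s => hasDerivAt_truncIp q π n u u s) ht hψ
  rw [h0] at this
  linarith

end IsReversibleRates

end MarkovChain

/-! ### The minimal transition function: honesty and identification of its form -/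

namespace MarkovChain

/-- The transition function of the chain killed outside `[0, n)`. -/
noncomputable def killedFn (q : ℕ → ℕ → ℝ) (n : ℕ) (t : ℝ) (i j : ℕ) : ℝ :=
  if j < n then truncExp q n t (bddPoint j) i else 0

/-- The minimal transition function of the rate matrix `q`. -/
noncomputable def minimalFn (q : ℕ → ℕ → ℝ) (t : ℝ) (i j : ℕ) : ℝ := ⨆ n, killedFn q n t i j

theorem sum_killedFn_mul (q : ℕ → ℕ → ℝ) (n : ℕ) (t : ℝ) (i : ℕ) (f : ℕ → ℝ) :
    ∑ j ∈ Finset.range n, killedFn q n t i j * f j = truncExp q n t (bddRestrict n f) i := by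
  rw [bddRestrict, map_sum, BddFun.sum_apply]
  refine Finset.sum_congr rfl fun j hj => ?_
  rw [killedFn, if_pos (Finset.mem_range.1 hj), map_smul, BddFun.smul_apply, mul_comm]

theorem killedFn_zero (q : ℕ → ℕ → ℝ) {n j : ℕ} (hj : j < n) (i : ℕ) :
    killedFn q n 0 i j = pointFn j i := by
  rw [killedFn, if_pos hj, truncExp_zero]; rfl

theorem killedFn_of_le (q : ℕ → ℕ → ℝ) {n i : ℕ} (hi : n ≤ i) (t : ℝ) (j : ℕ) :
    killedFn q n t i j = 0 := by
  rw [killedFn]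
  split_ifs with h
  · rw [truncExp_apply_of_le q n t _ hi, bddPoint_apply, pointFn_of_ne (by omega)]
  · rfl

theorem killedFn_add (q : ℕ → ℕ → ℝ) (n : ℕ) (s t : ℝ) (i j : ℕ) :
    killedFn q n (s + t) i j =
      ∑ k ∈ Finset.range n, killedFn q n s i k * killedFn q n t k j := by
  by_cases hj : j < n
  · rw [sum_killedFn_mul]
    have h1 : bddRestrict n (fun k => killedFn q n t k j) = truncExp q n t (bddPoint j) := by
      rw [← bddRestrict_eq_self (n := n) (u := truncExp q n t (bddPoint j)) fun i hi => by
        rw [truncExp_apply_of_le q n t _ hi, bddPoint_apply, pointFn_of_ne (by omega)]]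
      congr 1
      funext k
      rw [killedFn, if_pos hj]
    rw [h1, killedFn, if_pos hj, truncExp_add]
    rfl
  · have : ∀ r k, killedFn q n r k j = 0 := fun r k => if_neg hj
    simp [this]

theorem tendsto_killedFn_div (q : ℕ → ℕ → ℝ) {n i j : ℕ} (hi : i < n) (hj : j < n) (hij : i ≠ j) :
    Tendsto (fun t => t⁻¹ * killedFn q n t i j) (𝓝[>] 0) (𝓝 (q i j)) := by
  have h := hasDerivAt_truncExp q n (bddPoint j) i 0
  have h1 : truncExp q n 0 (truncOp q n (bddPoint j)) i = q i j := by
    rw [truncExp_zero]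
    change truncOp q n (bddPoint j) i = q i j
    rw [truncOp_apply, if_pos hi, Finset.sum_eq_single j]
    · rw [bddPoint_apply, pointFn_self, mul_one]
    · intro k _ hk
      rw [bddPoint_apply, pointFn_of_ne hk, mul_zero]
    · intro h; exact absurd (Finset.mem_range.2 hj) h
  rw [h1] at h
  have h2 := h.hasDerivWithinAt (s := Set.Ioi 0)
  rw [hasDerivWithinAt_iff_tendsto_slope' (by simp)] at h2
  refine h2.congr fun t => ?_
  have h3 : truncExp q n 0 (bddPoint j) i = 0 := by
    rw [truncExp_zero]; exact pointFn_of_ne hij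
  rw [slope_def_field, h3, sub_zero, sub_zero, killedFn, if_pos hj, div_eq_inv_mul]

theorem form_le_add {E : Type*} {q : E → E → ℝ} {π f g h : E → ℝ} (hq : IsQMatrix q)
    (hπ : ∀ i, 0 ≤ π i) {a b : ℝ} (ha : 0 ≤ a) (hb : 0 ≤ b)
    (hle : ∀ i j, (h j - h i) ^ 2 ≤ a * (f j - f i) ^ 2 + b * (g j - g i) ^ 2) :
    form q π h ≤ ENNReal.ofReal a * form q π f + ENNReal.ofReal b * form q π g := by
  simp only [form]
  rw [mul_left_comm, mul_left_comm (ENNReal.ofReal b), ← mul_add]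
  refine mul_le_mul_right ?_ _
  rw [← ENNReal.tsum_mul_left, ← ENNReal.tsum_mul_left, ← ENNReal.tsum_add]
  refine ENNReal.tsum_le_tsum fun i => ?_
  rw [← ENNReal.tsum_mul_left, ← ENNReal.tsum_mul_left, ← ENNReal.tsum_add]
  refine ENNReal.tsum_le_tsum fun j => ?_
  by_cases hij : i = j
  · simp [hij]
  have hw := mul_nonneg (hπ i) (hq.nonneg_of_ne i j hij)
  rw [← ENNReal.ofReal_mul ha, ← ENNReal.ofReal_mul hb, ← ENNReal.ofReal_add (by positivity)
    (by positivity)]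
  refine ENNReal.ofReal_le_ofReal ?_
  have := mul_le_mul_of_nonneg_left (hle i j) hw
  linarith

namespace IsReversibleRates

variable {q : ℕ → ℕ → ℝ} {π : ℕ → ℝ}

theorem killedFn_nonneg (H : IsReversibleRates q π) (n : ℕ) {t : ℝ} (ht : 0 ≤ t) (i j : ℕ) :
    0 ≤ killedFn q n t i j := by
  rw [killedFn]
  split_ifs
  · exact H.isPosOp_truncExp n ht _ (fun i => pointFn_nonneg j i) i
  · exact le_rfl

theorem killedFn_mono (H : IsReversibleRates q π) {t : ℝ} (ht : 0 ≤ t) (i j : ℕ) :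
    Monotone fun n => killedFn q n t i j := by
  refine monotone_nat_of_le_succ fun n => ?_
  by_cases hj : j < n
  · simp only [killedFn]
    rw [if_pos hj, if_pos (by omega)]
    exact H.truncExp_le_succ n ht (fun i => pointFn_nonneg j i)
      (fun i hi => pointFn_of_ne (by omega)) i
  · have : killedFn q n t i j = 0 := if_neg hj
    rw [this]
    exact H.killedFn_nonneg _ ht i j

theorem sum_killedFn_le_one (H : IsReversibleRates q π) (n : ℕ) {t : ℝ} (ht : 0 ≤ t) (i : ℕ) :
    ∑ j ∈ Finset.range n, killedFn q n t i j ≤ 1 := by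
  have := sum_killedFn_mul q n t i fun _ => 1
  simp only [mul_one] at this
  rw [this]
  exact H.truncExp_restrict_one_le n ht i

theorem killedFn_le_one (H : IsReversibleRates q π) (n : ℕ) {t : ℝ} (ht : 0 ≤ t) (i j : ℕ) :
    killedFn q n t i j ≤ 1 := by
  by_cases hj : j < n
  · exact (Finset.single_le_sum (f := fun j => killedFn q n t i j)
      (fun j _ => H.killedFn_nonneg n ht i j) (Finset.mem_range.2 hj)).trans
      (H.sum_killedFn_le_one n ht i)
  · have : killedFn q n t i j = 0 := if_neg hj
    rw [this]; exact zero_le_one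

theorem bddAbove_killedFn (H : IsReversibleRates q π) {t : ℝ} (ht : 0 ≤ t) (i j : ℕ) :
    BddAbove (Set.range fun n => killedFn q n t i j) :=
  ⟨1, by rintro _ ⟨n, rfl⟩; exact H.killedFn_le_one n ht i j⟩

theorem tendsto_killedFn (H : IsReversibleRates q π) {t : ℝ} (ht : 0 ≤ t) (i j : ℕ) :
    Tendsto (fun n => killedFn q n t i j) atTop (𝓝 (minimalFn q t i j)) :=
  tendsto_atTop_ciSup (H.killedFn_mono ht i j) (H.bddAbove_killedFn ht i j)

theorem killedFn_le_minimalFn (H : IsReversibleRates q π) (n : ℕ) {t : ℝ} (ht : 0 ≤ t) (i j : ℕ) :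
    killedFn q n t i j ≤ minimalFn q t i j := le_ciSup (H.bddAbove_killedFn ht i j) n

theorem minimalFn_nonneg (H : IsReversibleRates q π) {t : ℝ} (ht : 0 ≤ t) (i j : ℕ) :
    0 ≤ minimalFn q t i j := (H.killedFn_nonneg 0 ht i j).trans (H.killedFn_le_minimalFn 0 ht i j)

theorem minimalFn_le_one (H : IsReversibleRates q π) {t : ℝ} (ht : 0 ≤ t) (i j : ℕ) :
    minimalFn q t i j ≤ 1 := ciSup_le fun n => H.killedFn_le_one n ht i j

theorem minimalFn_zero (H : IsReversibleRates q π) (i j : ℕ) :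
    minimalFn q 0 i j = pointFn j i := by
  refine tendsto_nhds_unique (H.tendsto_killedFn le_rfl i j) (tendsto_const_nhds.congr' ?_)
  filter_upwards [eventually_gt_atTop j] with n hn
  exact (killedFn_zero q hn i).symm

theorem minimalFn_balance (H : IsReversibleRates q π) {t : ℝ} (ht : 0 ≤ t) (i j : ℕ) :
    π i * minimalFn q t i j = π j * minimalFn q t j i := by
  refine tendsto_nhds_unique ((H.tendsto_killedFn ht i j).const_mul _)
    (((H.tendsto_killedFn ht j i).const_mul (π j)).congr' ?_)
  filter_upwards [eventually_gt_atTop i, eventually_gt_atTop j] with n hi hj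
  have h := H.truncIp_truncExp_comm n t (bddPoint i) (bddPoint j)
  have h1 : ∀ (u : BddFun) (k : ℕ), k < n → truncIp π n u (bddPoint k) = π k * u k := by
    intro u k hk
    rw [truncIp, Finset.sum_eq_single k]
    · rw [bddPoint_apply, pointFn_self, mul_one]
    · intro l _ hl
      rw [bddPoint_apply, pointFn_of_ne hl, mul_zero, mul_zero]
    · intro h; exact absurd (Finset.mem_range.2 hk) h
  have h2 : ∀ u v : BddFun, truncIp π n u v = truncIp π n v u := fun u v =>
    Finset.sum_congr rfl fun i _ => by ring
  rw [h1 _ j hj, h2, h1 _ i hi] at h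
  rw [killedFn, killedFn, if_pos hi, if_pos hj]
  exact h

theorem summable_minimalFn (H : IsReversibleRates q π) {t : ℝ} (ht : 0 ≤ t) (i : ℕ) :
    Summable (minimalFn q t i) ∧ ∑' j, minimalFn q t i j ≤ 1 := by
  have h : ∀ m, ∑ j ∈ Finset.range m, minimalFn q t i j ≤ 1 := fun m => by
    refine le_of_tendsto (tendsto_finsetSum _ fun j _ => H.tendsto_killedFn ht i j) ?_
    filter_upwards [eventually_ge_atTop m] with n hn
    exact (Finset.sum_le_sum_of_subset_of_nonneg (Finset.range_mono hn)
      fun j _ _ => H.killedFn_nonneg n ht i j).trans (H.sum_killedFn_le_one n ht i)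
  have hs := summable_of_sum_range_le (H.minimalFn_nonneg ht i) h
  exact ⟨hs, hs.tsum_le_of_sum_range_le h⟩

/-- Pass to the limit in the matrix identity for the killed functions, dominated by the summable row
`p_s(i, ·)`. -/
theorem minimalFn_add (H : IsReversibleRates q π) {s t : ℝ} (hs : 0 ≤ s) (ht : 0 ≤ t) (i j : ℕ) :
    HasSum (fun k => minimalFn q s i k * minimalFn q t k j) (minimalFn q (s + t) i j) := by
  have hsum : Summable fun k => minimalFn q s i k * minimalFn q t k j :=
    Summable.of_nonneg_of_le
      (fun k => mul_nonneg (H.minimalFn_nonneg hs i k) (H.minimalFn_nonneg ht k j))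
      (fun k => mul_le_of_le_one_right (H.minimalFn_nonneg hs i k) (H.minimalFn_le_one ht k j))
      (H.summable_minimalFn hs i).1
  have h1 : Tendsto (fun n => ∑' k, killedFn q n s i k * killedFn q n t k j) atTop
      (𝓝 (∑' k, minimalFn q s i k * minimalFn q t k j)) := by
    refine tendsto_tsum_of_dominated_convergence hsum
      (fun k => (H.tendsto_killedFn hs i k).mul (H.tendsto_killedFn ht k j))
      (Eventually.of_forall fun n k => ?_)
    rw [Real.norm_of_nonneg (mul_nonneg (H.killedFn_nonneg n hs i k) (H.killedFn_nonneg n ht k j))]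
    exact mul_le_mul (H.killedFn_le_minimalFn n hs i k) (H.killedFn_le_minimalFn n ht k j)
      (H.killedFn_nonneg n ht k j) (H.minimalFn_nonneg hs i k)
  have h2 : ∀ n, ∑' k, killedFn q n s i k * killedFn q n t k j = killedFn q n (s + t) i j :=
    fun n => by
      rw [killedFn_add]
      exact tsum_eq_sum fun k hk => by
        rw [killedFn_of_le q (by simpa using hk) t j, mul_zero]
  simp only [h2] at h1
  rw [tendsto_nhds_unique (H.tendsto_killedFn (add_nonneg hs ht) i j) h1]
  exact hsum.hasSum

/-- Squeezed between `1` and the killed function of the window `[0, i]`, which is continuous in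
time. -/
theorem tendsto_minimalFn_self (H : IsReversibleRates q π) (i : ℕ) :
    Tendsto (fun t => minimalFn q t i i) (𝓝[>] 0) (𝓝 1) := by
  have h := (hasDerivAt_truncExp q (i + 1) (bddPoint i) i 0).continuousAt.tendsto.mono_left
    (nhdsWithin_le_nhds (s := Set.Ioi 0))
  rw [truncExp_zero] at h
  have h1 : (1 : BddFun →L[ℝ] BddFun) (bddPoint i) i = 1 := pointFn_self i
  rw [h1] at h
  refine tendsto_of_tendsto_of_tendsto_of_le_of_le' h tendsto_const_nhds ?_ ?_
  · filter_upwards [self_mem_nhdsWithin] with t ht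
    have := H.killedFn_le_minimalFn (i + 1) (le_of_lt ht) i i
    rwa [killedFn, if_pos (Nat.lt_succ_self i)] at this
  · filter_upwards [self_mem_nhdsWithin] with t ht
    exact H.minimalFn_le_one (le_of_lt ht) i i

/-- The energy bound for functions vanishing outside `[0, N)`. -/
theorem sum_sub_sum_minimalFn_le (H : IsReversibleRates q π) {N : ℕ} {f : ℕ → ℝ}
    (hf : ∀ i, N ≤ i → f i = 0) {t : ℝ} (ht : 0 ≤ t) :
    ∑ i ∈ Finset.range N, π i * (f i * f i) - ∑ i ∈ Finset.range N, ∑ j ∈ Finset.range N,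
      π i * minimalFn q t i j * (f i * f j) ≤ t * (form q π f).toReal := by
  have hform := form_of_support_subset H.isQMatrix (fun i => (H.pos i).le) H.balance
    (Finset.range N) (f := f) fun i hi => hf i (by simpa using hi)
  have hlim : Tendsto (fun n => ∑ i ∈ Finset.range N, π i * (f i * f i)
      - ∑ i ∈ Finset.range N, ∑ j ∈ Finset.range N, π i * killedFn q n t i j * (f i * f j)) atTop
      (𝓝 (∑ i ∈ Finset.range N, π i * (f i * f i) - ∑ i ∈ Finset.range N, ∑ j ∈ Finset.range N,
        π i * minimalFn q t i j * (f i * f j))) :=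
    tendsto_const_nhds.sub (tendsto_finsetSum _ fun i _ => tendsto_finsetSum _ fun j _ =>
      ((H.tendsto_killedFn ht i j).const_mul _).mul_const _)
  refine le_of_tendsto hlim ?_
  filter_upwards [eventually_ge_atTop N] with n hn
  have hsub := Finset.range_mono hn
  have hu : ∀ i, bddRestrict n f i = f i := fun i => by
    rw [bddRestrict_apply]
    split_ifs with h
    · rfl
    · exact (hf i (by omega)).symm
  have hz : ∀ i, i ∉ Finset.range N → f i = 0 := fun i hi => hf i (by simpa using hi)
  have key := H.truncIp_sub_truncExp_le n (bddRestrict n f) ht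
  have e1 : truncIp π n (bddRestrict n f) (bddRestrict n f) =
      ∑ i ∈ Finset.range N, π i * (f i * f i) := by
    rw [truncIp, ← Finset.sum_subset hsub fun i _ hi => by rw [hu, hz i hi]; ring]
    exact Finset.sum_congr rfl fun i _ => by rw [hu]
  have e2 : truncIp π n (truncExp q n t (bddRestrict n f)) (bddRestrict n f) =
      ∑ i ∈ Finset.range N, ∑ j ∈ Finset.range N, π i * killedFn q n t i j * (f i * f j) := by
    rw [truncIp, ← Finset.sum_subset hsub fun i _ hi => by rw [hu, hz i hi]; ring]
    refine Finset.sum_congr rfl fun i _ => ?_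
    rw [hu, ← sum_killedFn_mul, ← Finset.sum_subset hsub fun j _ hj => by rw [hz j hj]; ring,
      Finset.sum_mul, Finset.mul_sum]
    exact Finset.sum_congr rfl fun j _ => by ring
  have e3 : truncIp π n (truncOp q n (bddRestrict n f)) (bddRestrict n f) =
      ∑ i ∈ Finset.range N, ∑ j ∈ Finset.range N, π i * q i j * (f i * f j) := by
    rw [truncIp, ← Finset.sum_subset hsub fun i _ hi => by rw [hu, hz i hi]; ring]
    refine Finset.sum_congr rfl fun i hi => ?_
    have hi' : i < n := Finset.mem_range.1 (hsub hi)
    rw [hu, truncOp_apply, if_pos hi', ← Finset.sum_subset hsub fun j _ hj => by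
      rw [hu, hz j hj, mul_zero], Finset.sum_mul, Finset.mul_sum]
    exact Finset.sum_congr rfl fun j _ => by rw [hu]; ring
  rw [e1, e2, e3] at key
  refine key.trans (mul_le_mul_of_nonneg_left ?_ ht)
  rw [hform, ENNReal.toReal_ofReal']
  exact le_max_left _ _

theorem hasSum_abs_row (H : IsReversibleRates q π) (i : ℕ) :
    HasSum (fun j => |q i j|) (-2 * q i i) := by
  have h1 := hasSum_single (f := fun j => -2 * q i i * pointFn i j) i fun j hj => by
    rw [pointFn_of_ne hj, mul_zero]
  rw [pointFn_self, mul_one] at h1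
  refine hasSum_of_eq ((H.isQMatrix.hasSum_row i).add h1) (fun j => ?_) (by ring)
  by_cases hij : j = i
  · subst hij
    rw [pointFn_self, abs_of_nonpos (H.diag_nonpos j)]; ring
  · rw [pointFn_of_ne hij, abs_of_nonneg (H.isQMatrix.nonneg_of_ne i j (Ne.symm hij))]; ring

/-- The cutoff function `1_{[0, n)}`. -/
noncomputable def cutoff (n : ℕ) (i : ℕ) : ℝ := if i < n then 1 else 0

/-- Finite mean rate makes `π_i q_ij` absolutely summable over all pairs, with total `0` by the zero
row sums. The energy of the cutoff is minus the partial sum over the square `[0, n)²`. -/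
theorem tendsto_form_cutoff (H : IsReversibleRates q π) (hfin : Summable fun i => π i * q i i) :
    Tendsto (fun n => (form q π (cutoff n)).toReal) atTop (𝓝 0) := by
  have habs : Summable fun x : ℕ × ℕ => π x.1 * |q x.1 x.2| :=
    (hasSum_prod_of_nonneg (F := fun x : ℕ × ℕ => π x.1 * |q x.1 x.2|)
      (g := fun i => π i * (-2 * q i i)) (fun x => mul_nonneg (H.pos _).le (abs_nonneg _))
      (fun i => (H.hasSum_abs_row i).mul_left (π i))
      ((hfin.mul_left (-2)).congr fun i => by ring).hasSum).summable
  have hs : Summable fun x : ℕ × ℕ => π x.1 * q x.1 x.2 := by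
    refine Summable.of_abs (habs.congr fun x => ?_)
    rw [abs_mul, abs_of_pos (H.pos _)]
  have hfib := hs.hasSum.prod_fiberwise fun i => (H.isQMatrix.hasSum_row i).mul_left (π i)
  simp only [mul_zero] at hfib
  have h0 : HasSum (fun x : ℕ × ℕ => π x.1 * q x.1 x.2) 0 := by
    rw [← hfib.unique hasSum_zero]; exact hs.hasSum
  have hsq : Tendsto (fun n => Finset.range n ×ˢ Finset.range n) atTop atTop :=
    tendsto_atTop_finset_of_monotone
      (fun m n hmn => Finset.product_subset_product (Finset.range_mono hmn) (Finset.range_mono hmn))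
      fun x => ⟨x.1 + x.2 + 1, by
        simp only [Finset.mem_product, Finset.mem_range]
        omega⟩
  have hlim := (ENNReal.continuous_ofReal.tendsto _).comp (Tendsto.neg (h0.comp hsq))
  have hlim2 := (ENNReal.tendsto_toReal ENNReal.ofReal_ne_top).comp hlim
  rw [neg_zero, ENNReal.ofReal_zero, ENNReal.toReal_zero] at hlim2
  refine hlim2.congr fun n => ?_
  rw [form_of_support_subset H.isQMatrix (fun i => (H.pos i).le) H.balance (Finset.range n)
    fun i hi => by rw [cutoff, if_neg (by simpa using hi)]]
  simp only [Function.comp]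
  rw [Finset.sum_product]
  congr 3
  refine Finset.sum_congr rfl fun i hi => Finset.sum_congr rfl fun j hj => ?_
  rw [cutoff, cutoff, if_pos (Finset.mem_range.1 hi), if_pos (Finset.mem_range.1 hj)]
  ring

/-- The minimal transition function is honest. -/
theorem hasSum_minimalFn (H : IsReversibleRates q π) (hfin : Summable fun i => π i * q i i)
    {t : ℝ} (ht : 0 ≤ t) (i : ℕ) : HasSum (minimalFn q t i) 1 := by
  obtain ⟨hs, hle⟩ := H.summable_minimalFn ht i
  have hpos := H.pos i
  have hlim := (H.tendsto_form_cutoff hfin).const_mul t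
  rw [mul_zero] at hlim
  -- For the cutoff the energy bound controls the weighted mass that leaves `[0, k)` by time `t`.
  -- This dominates the defect at `i`, and the energy tends to zero.
  have h1 : π i * (1 - ∑' j, minimalFn q t i j) ≤ 0 := by
    refine ge_of_tendsto hlim ?_
    filter_upwards [eventually_gt_atTop i] with k hk
    refine le_trans ?_ (H.sum_sub_sum_minimalFn_le (f := cutoff k) (N := k)
      (fun i hi => if_neg (not_lt.2 hi)) ht)
    have e : ∑ a ∈ Finset.range k, π a * (cutoff k a * cutoff k a) -
        ∑ a ∈ Finset.range k, ∑ b ∈ Finset.range k,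
          π a * minimalFn q t a b * (cutoff k a * cutoff k b) =
        ∑ a ∈ Finset.range k, π a * (1 - ∑ b ∈ Finset.range k, minimalFn q t a b) := by
      rw [← Finset.sum_sub_distrib]
      refine Finset.sum_congr rfl fun a ha => ?_
      rw [mul_sub, Finset.mul_sum]
      have ha' : cutoff k a = 1 := if_pos (Finset.mem_range.1 ha)
      congr 1
      · rw [ha']; ring
      · refine Finset.sum_congr rfl fun b hb => ?_
        have hb' : cutoff k b = 1 := if_pos (Finset.mem_range.1 hb)
        rw [ha', hb']; ring
    have hpart : ∀ a, ∑ b ∈ Finset.range k, minimalFn q t a b ≤ ∑' b, minimalFn q t a b :=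
      fun a => (H.summable_minimalFn ht a).1.sum_le_tsum _ fun b _ => H.minimalFn_nonneg ht a b
    rw [e]
    calc π i * (1 - ∑' j, minimalFn q t i j)
        ≤ π i * (1 - ∑ b ∈ Finset.range k, minimalFn q t i b) :=
          mul_le_mul_of_nonneg_left (sub_le_sub_left (hpart i) _) hpos.le
      _ ≤ _ := Finset.single_le_sum
          (f := fun a => π a * (1 - ∑ b ∈ Finset.range k, minimalFn q t a b))
          (fun a _ => mul_nonneg (H.pos a).le
            (sub_nonneg.2 ((hpart a).trans (H.summable_minimalFn ht a).2)))
          (Finset.mem_range.2 hk)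
  have h2 : 1 ≤ ∑' j, minimalFn q t i j := by nlinarith
  rw [← le_antisymm hle h2]
  exact hs.hasSum

theorem isReversibleKernel (H : IsReversibleRates q π) (hfin : Summable fun i => π i * q i i)
    {t : ℝ} (ht : 0 ≤ t) : IsReversibleKernel π (minimalFn q t) where
  pos := H.pos
  hasSum := H.hasSum
  nonneg := H.minimalFn_nonneg ht
  hasSum_row := H.hasSum_minimalFn hfin ht
  balance := H.minimalFn_balance ht

theorem isTransitionFunction (H : IsReversibleRates q π) (hfin : Summable fun i => π i * q i i) :
    IsTransitionFunction (minimalFn q) where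
  nonneg _ ht := H.minimalFn_nonneg ht
  hasSum_row _ ht := H.hasSum_minimalFn hfin ht
  zero_self i := by rw [H.minimalFn_zero, pointFn_self]
  zero_of_ne i j hij := by rw [H.minimalFn_zero, pointFn_of_ne hij]
  chapman_kolmogorov _ _ hs ht := H.minimalFn_add hs ht
  tendsto_zero := H.tendsto_minimalFn_self

theorem energy_le_of_support (H : IsReversibleRates q π) {N : ℕ} {f : ℕ → ℝ}
    (hf : ∀ i, N ≤ i → f i = 0) {t : ℝ} (ht : 0 ≤ t) :
    ip π f f - ip π (kernelMap (minimalFn q t) f) f ≤ t * (form q π f).toReal := by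
  refine le_trans (le_of_eq ?_) (H.sum_sub_sum_minimalFn_le hf ht)
  have hz : ∀ i, i ∉ Finset.range N → f i = 0 := fun i hi => hf i (by simpa using hi)
  congr 1
  · exact tsum_eq_sum fun i hi => by simp [hz i hi]
  · have : ip π (kernelMap (minimalFn q t) f) f =
        ∑ i ∈ Finset.range N, π i * (kernelMap (minimalFn q t) f i * f i) :=
      tsum_eq_sum fun i hi => by simp [hz i hi]
    rw [this]
    refine Finset.sum_congr rfl fun i _ => ?_
    have : kernelMap (minimalFn q t) f i = ∑ j ∈ Finset.range N, minimalFn q t i j * f j :=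
      tsum_eq_sum fun j hj => by simp [hz j hj]
    rw [this, Finset.sum_mul, Finset.mul_sum]
    exact Finset.sum_congr rfl fun j _ => by ring

/-- Approximate `f` by `χ f` with cutoffs `χ`. The product rule and Young's inequality give `D(χ f)
≤ (1 + ε) D(f) + (1 + ε⁻¹) M² D(χ)`; let the cutoff grow, then `ε → 0`. Vanishing cutoff energy is
what makes the maximal domain the right one. -/
theorem energy_le_of_bounded (H : IsReversibleRates q π) (hfin : Summable fun i => π i * q i i)
    {f : ℕ → ℝ} {M : ℝ} (hM : ∀ i, |f i| ≤ M) (hD : form q π f < ∞) {t : ℝ} (ht : 0 ≤ t) :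
    ip π f f - ip π (kernelMap (minimalFn q t) f) f ≤ t * (form q π f).toReal := by
  have hπ : ∀ i, 0 ≤ π i := fun i => (H.pos i).le
  have hL2 := isL2_of_bounded hπ H.hasSum.summable hM
  have habs : IsL2 π fun i => |f i| := hL2.mono hπ fun i => by simp
  set F : ℕ → ℕ → ℝ := fun n i => cutoff n i * f i with hF
  have hχ : ∀ n i, 0 ≤ cutoff n i ∧ cutoff n i ≤ 1 := fun n i => by
    rw [cutoff]; split_ifs <;> norm_num
  have hFle : ∀ n i, |F n i| ≤ |f i| := fun n i => by
    rw [hF, abs_mul, abs_of_nonneg (hχ n i).1]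
    exact mul_le_of_le_one_left (abs_nonneg _) (hχ n i).2
  have hFlim : ∀ i, Tendsto (fun n => F n i) atTop (𝓝 (f i)) := fun i => by
    refine tendsto_const_nhds.congr' ?_
    filter_upwards [eventually_gt_atTop i] with n hn
    simp only [hF]
    rw [cutoff, if_pos hn, one_mul]
  have h1 := (tendsto_ip_of_dominated hπ habs habs hFle hFle hFlim hFlim).sub
    ((H.isReversibleKernel hfin ht).tendsto_ip_map habs hFle hFlim)
  have key : ∀ ε : ℝ, 0 < ε → ip π f f - ip π (kernelMap (minimalFn q t) f) f ≤
      t * ((1 + ε) * (form q π f).toReal) := by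
    intro ε hε
    have h2 : Tendsto (fun n => t * ((1 + ε) * (form q π f).toReal +
        (1 + ε⁻¹) * M ^ 2 * (form q π (cutoff n)).toReal)) atTop
        (𝓝 (t * ((1 + ε) * (form q π f).toReal + (1 + ε⁻¹) * M ^ 2 * 0))) :=
      (((H.tendsto_form_cutoff hfin).const_mul _).const_add _).const_mul t
    rw [mul_zero, add_zero] at h2
    refine le_of_tendsto_of_tendsto' h1 h2 fun n => ?_
    refine (H.energy_le_of_support (N := n) (f := F n) (fun i hi => ?_) ht).trans
      (mul_le_mul_of_nonneg_left ?_ ht)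
    · simp only [hF]
      rw [cutoff, if_neg (not_lt.2 hi), zero_mul]
    · have hχD : form q π (cutoff n) < ∞ := by
        rw [form_of_support_subset H.isQMatrix hπ H.balance (Finset.range n)
          fun i hi => by rw [cutoff, if_neg (by simpa using hi)]]
        exact ENNReal.ofReal_lt_top
      have hle := form_le_add (f := f) (g := cutoff n) (h := F n) H.isQMatrix hπ (a := 1 + ε)
        (b := (1 + ε⁻¹) * M ^ 2) (by positivity) (by positivity) fun i j => by
          have e1 : F n j - F n i = cutoff n j * (f j - f i) + f i * (cutoff n j - cutoff n i) := by
            simp only [hF]; ring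
          set x := cutoff n j * (f j - f i)
          set y := f i * (cutoff n j - cutoff n i)
          have e2 : (x + y) ^ 2 ≤ (1 + ε) * x ^ 2 + (1 + ε⁻¹) * y ^ 2 := by
            have : 0 ≤ (ε * x - y) ^ 2 * ε⁻¹ := by positivity
            have h3 : (ε * x - y) ^ 2 * ε⁻¹ = ε * x ^ 2 - 2 * x * y + ε⁻¹ * y ^ 2 := by
              field_simp
              ring
            nlinarith
          have e3 : x ^ 2 ≤ (f j - f i) ^ 2 := by
            rw [mul_pow]
            exact mul_le_of_le_one_left (sq_nonneg _) (pow_le_one₀ (hχ n j).1 (hχ n j).2)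
          have e4 : y ^ 2 ≤ M ^ 2 * (cutoff n j - cutoff n i) ^ 2 := by
            rw [mul_pow]
            refine mul_le_mul_of_nonneg_right ?_ (sq_nonneg _)
            exact sq_le_sq' (abs_le.1 (hM i)).1 (abs_le.1 (hM i)).2
          rw [e1]
          refine e2.trans ?_
          rw [mul_assoc]
          exact add_le_add (mul_le_mul_of_nonneg_left e3 (by positivity))
            (mul_le_mul_of_nonneg_left e4 (by positivity))
      have hfin1 : ENNReal.ofReal (1 + ε) * form q π f ≠ ∞ :=
        (ENNReal.mul_lt_top ENNReal.ofReal_lt_top hD).ne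
      have hfin2 : ENNReal.ofReal ((1 + ε⁻¹) * M ^ 2) * form q π (cutoff n) ≠ ∞ :=
        (ENNReal.mul_lt_top ENNReal.ofReal_lt_top hχD).ne
      have := ENNReal.toReal_mono (ENNReal.add_ne_top.2 ⟨hfin1, hfin2⟩) hle
      rwa [ENNReal.toReal_add hfin1 hfin2, ENNReal.toReal_mul, ENNReal.toReal_mul,
        ENNReal.toReal_ofReal (by positivity), ENNReal.toReal_ofReal (by positivity)] at this
  have h3 : Tendsto (fun ε : ℝ => t * ((1 + ε) * (form q π f).toReal)) (𝓝[>] 0)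
      (𝓝 (t * ((1 + 0) * (form q π f).toReal))) :=
    (((continuous_const.add continuous_id).mul continuous_const).const_mul t).continuousAt.tendsto
      |>.mono_left nhdsWithin_le_nhds
  rw [add_zero, one_mul] at h3
  exact ge_of_tendsto h3 (eventually_nhdsWithin_of_forall fun ε hε => key ε hε)

theorem energy_le (H : IsReversibleRates q π) (hfin : Summable fun i => π i * q i i)
    {f : ℕ → ℝ} (hf : IsL2 π f) (hD : form q π f < ∞) {t : ℝ} (ht : 0 ≤ t) :
    ip π f f - ip π (kernelMap (minimalFn q t) f) f ≤ t * (form q π f).toReal := by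
  have hπ : ∀ i, 0 ≤ π i := fun i => (H.pos i).le
  have habs : IsL2 π fun i => |f i| := hf.mono hπ fun i => by simp
  have hle : ∀ (n : ℕ) i, |clamp n f i| ≤ |f i| := fun n => abs_clamp_le_abs (Nat.cast_nonneg n) f
  refine le_of_tendsto' ((tendsto_ip_of_dominated hπ habs habs hle hle (tendsto_clamp f)
    (tendsto_clamp f)).sub
    ((H.isReversibleKernel hfin ht).tendsto_ip_map habs hle (tendsto_clamp f))) fun n => ?_
  have hDn : form q π (clamp n f) ≤ form q π f :=
    form_mono H.isQMatrix hπ (abs_clamp_sub_clamp_le n f)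
  exact (H.energy_le_of_bounded hfin (abs_clamp_le (Nat.cast_nonneg n) f) (hDn.trans_lt hD)
    ht).trans (mul_le_mul_of_nonneg_left (ENNReal.toReal_mono hD.ne hDn) ht)

/-- From below, keep finitely many pairs and use that `p_t(i, j)/t` is at least its killed
counterpart, which tends to `q i j`. From above, use `energy_le`, or nothing if the form is
infinite. -/
theorem form_eq_limit (H : IsReversibleRates q π) (hfin : Summable fun i => π i * q i i)
    {f : ℕ → ℝ} (hf : IsL2 π f) :
    Tendsto (fun t : ℝ => ENNReal.ofReal
      (t⁻¹ * mean π fun i => (f i - semigroup (minimalFn q) t f i) * f i)) (𝓝[>] 0)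
      (𝓝 (form q π f)) := by
  have hπ : ∀ i, 0 ≤ π i := fun i => (H.pos i).le
  set G : ℝ → ℝ := fun t => mean π fun i => (f i - semigroup (minimalFn q) t f i) * f i with hG
  have hGip : ∀ t, 0 ≤ t → G t = ip π f f - ip π (kernelMap (minimalFn q t) f) f := fun t ht =>
    ip_sub_left hπ hf ((H.isReversibleKernel hfin ht).isL2_map hf) hf
  have hsum : ∀ t : ℝ, 0 < t → ENNReal.ofReal (t⁻¹ * G t) = 2⁻¹ * ∑' x : ℕ × ℕ,
      ENNReal.ofReal (t⁻¹ * (π x.1 * minimalFn q t x.1 x.2 * (f x.2 - f x.1) ^ 2)) := by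
    intro t ht
    have h1 := ((H.isReversibleKernel hfin ht.le).hasSum_energy hf).mul_left t⁻¹
    rw [← ENNReal.ofReal_tsum_of_nonneg (fun x => mul_nonneg (inv_nonneg.2 ht.le)
      (mul_nonneg (mul_nonneg (hπ _) (H.minimalFn_nonneg ht.le _ _)) (sq_nonneg _))) h1.summable,
      h1.tsum_eq]
    have h2 : (2⁻¹ : ℝ≥0∞) = ENNReal.ofReal 2⁻¹ := by
      rw [ENNReal.ofReal_inv_of_pos (by norm_num)]; simp
    rw [h2, ← ENNReal.ofReal_mul (by norm_num)]
    congr 1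
    change t⁻¹ * ip π (fun i => f i - kernelMap (minimalFn q t) f i) f = _
    ring
  refine tendsto_order.2 ⟨fun c hc => ?_, fun c hc => ?_⟩
  · have hform : form q π f = ⨆ s : Finset (ℕ × ℕ), 2⁻¹ * ∑ x ∈ s,
        ENNReal.ofReal (π x.1 * q x.1 x.2 * (f x.2 - f x.1) ^ 2) := by
      rw [form, ← ENNReal.mul_iSup, ← ENNReal.tsum_eq_iSup_sum, ENNReal.tsum_prod
        (f := fun i j => ENNReal.ofReal (π i * q i j * (f j - f i) ^ 2))]
    rw [hform, lt_iSup_iff] at hc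
    obtain ⟨s, hs⟩ := hc
    obtain ⟨n, hn⟩ : ∃ n, ∀ x ∈ s, x.1 < n ∧ x.2 < n := by
      refine ⟨s.sup (fun x => x.1 + x.2) + 1, fun x hx => ?_⟩
      have := Finset.le_sup (f := fun x : ℕ × ℕ => x.1 + x.2) hx
      omega
    have hterm : ∀ x ∈ s, Tendsto (fun t : ℝ => ENNReal.ofReal
        (t⁻¹ * (π x.1 * killedFn q n t x.1 x.2 * (f x.2 - f x.1) ^ 2))) (𝓝[>] 0)
        (𝓝 (ENNReal.ofReal (π x.1 * q x.1 x.2 * (f x.2 - f x.1) ^ 2))) := by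
      intro x hx
      refine ENNReal.tendsto_ofReal ?_
      by_cases hxx : x.1 = x.2
      · have h0 : f x.2 - f x.1 = 0 := by rw [hxx, sub_self]
        simp [h0]
      · have := ((tendsto_killedFn_div q (hn x hx).1 (hn x hx).2 hxx).const_mul (π x.1)).mul_const
          ((f x.2 - f x.1) ^ 2)
        refine this.congr fun t => by ring
    have hlim := ENNReal.Tendsto.const_mul (tendsto_finsetSum s hterm)
      (Or.inr (show (2⁻¹ : ℝ≥0∞) ≠ ∞ by norm_num))
    filter_upwards [hlim.eventually_const_lt hs, self_mem_nhdsWithin] with t ht ht0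
    have ht0 : 0 < t := ht0
    refine ht.trans_le ?_
    change _ ≤ ENNReal.ofReal (t⁻¹ * G t)
    rw [hsum t ht0]
    refine mul_le_mul_right ((Finset.sum_le_sum fun x _ => ?_).trans (ENNReal.sum_le_tsum s)) _
    refine ENNReal.ofReal_le_ofReal (mul_le_mul_of_nonneg_left ?_ (inv_nonneg.2 ht0.le))
    exact mul_le_mul_of_nonneg_right (mul_le_mul_of_nonneg_left
      (H.killedFn_le_minimalFn n ht0.le _ _) (hπ _)) (sq_nonneg _)
  · filter_upwards [self_mem_nhdsWithin] with t ht
    have ht : 0 < t := ht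
    refine lt_of_le_of_lt ?_ hc
    change ENNReal.ofReal (t⁻¹ * G t) ≤ _
    by_cases hD : form q π f < ∞
    · rw [← ENNReal.ofReal_toReal hD.ne]
      refine ENNReal.ofReal_le_ofReal ?_
      rw [inv_mul_le_iff₀ ht, hGip t ht.le]
      exact H.energy_le hfin hf hD ht.le
    · rw [not_lt_top_iff.1 hD]; exact le_top

/-- The reversible chain with a given rate matrix of finite mean rate. -/
noncomputable def toChain (H : IsReversibleRates q π) (hfin : Summable fun i => π i * q i i) :
    ReversibleChain ℕ where
  q := q
  π := π
  p := minimalFn q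
  isQMatrix := H.isQMatrix
  π_pos := H.pos
  π_hasSum := H.hasSum
  q_reversible := H.balance
  isTransitionFunction := H.isTransitionFunction hfin
  p_reversible _ ht := H.minimalFn_balance ht
  form_eq_limit _ hf := H.form_eq_limit hfin hf

/-- The drift bound for killed semigroups survives the monotone limit. It limits how fast a chain
can come down from far away. -/
theorem semigroup_le_add (H : IsReversibleRates q π) {u : ℕ → ℝ} {N : ℕ}
    (hu : ∀ i, N ≤ i → u i = 0) {K : ℝ} (hK0 : 0 ≤ K)
    (hK : ∀ i, ∑ j ∈ Finset.range N, q i j * u j ≤ K) {t : ℝ} (ht : 0 ≤ t) (x : ℕ) :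
    semigroup (minimalFn q) t u x ≤ u x + K * t := by
  have hz : ∀ i, i ∉ Finset.range N → u i = 0 := fun i hi => hu i (by simpa using hi)
  have h1 : semigroup (minimalFn q) t u x = ∑ j ∈ Finset.range N, minimalFn q t x j * u j :=
    tsum_eq_sum fun j hj => by simp [hz j hj]
  rw [h1]
  refine le_of_tendsto (tendsto_finsetSum _ fun j _ =>
    (H.tendsto_killedFn ht x j).mul_const (u j)) ?_
  filter_upwards [eventually_ge_atTop N] with n hn
  have hsub := Finset.range_mono hn
  have hun : ∀ i, bddRestrict n u i = u i := fun i => by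
    rw [bddRestrict_apply]
    split_ifs with h
    · rfl
    · exact (hu i (by omega)).symm
  rw [Finset.sum_subset hsub fun j _ hj => by rw [hz j hj, mul_zero], sum_killedFn_mul]
  have h2 := H.truncExp_le_add_of_truncOp_le n (u := bddRestrict n u) hK0 (fun i hi => by
    rw [truncOp_apply, if_pos hi, ← Finset.sum_subset hsub fun j _ hj => by
      rw [hun, hz j hj, mul_zero]]
    refine le_trans (le_of_eq (Finset.sum_congr rfl fun j _ => by rw [hun])) (hK i)) ht x
  rwa [hun] at h2

end IsReversibleRates

end MarkovChain

/-! ### Resampling from the geometric distribution: strongly ergodic without log-Sobolev -/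

namespace MarkovChain

/-- The geometric distribution with parameter `1/2`. -/
noncomputable def geo (i : ℕ) : ℝ := (1 / 2) ^ (i + 1)

theorem geo_pos (i : ℕ) : 0 < geo i := by rw [geo]; positivity

theorem geo_le_half (i : ℕ) : geo i ≤ 1 / 2 := by
  rw [geo, pow_succ]
  have : ((1 : ℝ) / 2) ^ i ≤ 1 := pow_le_one₀ (by norm_num) (by norm_num)
  linarith

theorem hasSum_geo : HasSum geo 1 :=
  hasSum_of_eq (hasSum_geometric_two.mul_right (1 / 2)) (fun i => by rw [geo, pow_succ])
    (by norm_num)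

theorem summable_geo_mul : Summable fun i : ℕ => geo i * ((i : ℝ) + 1) := by
  have h1 := summable_pow_mul_geometric_of_norm_lt_one 1 (r := (1 / 2 : ℝ)) (by norm_num)
  refine ((h1.mul_left (1 / 2)).add hasSum_geo.summable).congr fun i => ?_
  rw [geo, pow_succ]; ring

theorem pointFn_eq_ite (i j : ℕ) : pointFn i j = if j = i then 1 else 0 := by
  split_ifs with h
  · rw [h, pointFn_self]
  · exact pointFn_of_ne h

theorem hasSum_pointFn_mul (i : ℕ) (f : ℕ → ℝ) : HasSum (fun j => pointFn i j * f j) (f i) := by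
  have := hasSum_single (f := fun j => pointFn i j * f j) i fun j hj => by
    rw [pointFn_of_ne hj, zero_mul]
  rwa [pointFn_self, one_mul] at this

theorem hasSum_pointFn (i : ℕ) : HasSum (pointFn i) 1 := by
  simpa using hasSum_pointFn_mul i fun _ => 1

theorem variance_pointFn {E : Type*} (π : E → ℝ) (i : E) :
    variance π (pointFn i) = π i - π i ^ 2 := by
  rw [variance_eq_ip, ip_pointFn_right, pointFn_self, mean_pointFn, mul_one]

section Resampling

/-- The transition function of the chain that jumps to a fresh sample of `geo` at rate one. -/
noncomputable def resampleFn (t : ℝ) (i j : ℕ) : ℝ :=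
  Real.exp (-t) * pointFn i j + (1 - Real.exp (-t)) * geo j

theorem isTransitionFunction_resampleFn : IsTransitionFunction resampleFn where
  nonneg t ht i j := by
    have h1 : Real.exp (-t) ≤ 1 := Real.exp_le_one_iff.2 (by linarith)
    exact add_nonneg (mul_nonneg (Real.exp_pos _).le (pointFn_nonneg i j))
      (mul_nonneg (by linarith) (geo_pos j).le)
  hasSum_row t _ i := hasSum_of_eq
    (((hasSum_pointFn i).mul_left (Real.exp (-t))).add (hasSum_geo.mul_left (1 - Real.exp (-t))))
    (fun j => rfl) (by ring)
  zero_self i := by simp [resampleFn, pointFn_self]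
  zero_of_ne i j hij := by simp [resampleFn, pointFn_of_ne hij.symm]
  chapman_kolmogorov s t _ _ i j := by
    have h1 := (hasSum_pointFn_mul i fun k => resampleFn t k j).mul_left (Real.exp (-s))
    have h2 : HasSum (fun k => geo k * resampleFn t k j) (geo j) := by
      have e1 := (hasSum_pointFn_mul j geo).mul_left (Real.exp (-t))
      have e2 := (hasSum_geo.mul_right (geo j)).mul_left (1 - Real.exp (-t))
      refine hasSum_of_eq (e1.add e2) (fun k => ?_) (by ring)
      have : pointFn k j = pointFn j k := by
        rw [pointFn_eq_ite, pointFn_eq_ite]; simp only [eq_comm]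
      rw [resampleFn, this]; ring
    refine hasSum_of_eq (h1.add (h2.mul_left (1 - Real.exp (-s)))) (fun k => ?_) ?_
    · simp only [resampleFn]; ring
    · have : Real.exp (-(s + t)) = Real.exp (-s) * Real.exp (-t) := by
        rw [← Real.exp_add]; congr 1; ring
      simp only [resampleFn]
      rw [this]; ring
  tendsto_zero i := by
    have h : Continuous fun t => resampleFn t i i := by
      unfold resampleFn; fun_prop
    have := h.tendsto 0
    have h0 : resampleFn 0 i i = 1 := by simp [resampleFn, pointFn_self]
    rw [h0] at this
    exact this.mono_left nhdsWithin_le_nhds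

theorem mul_pointFn_comm (a : ℕ → ℝ) (i j : ℕ) : a i * pointFn i j = a j * pointFn j i := by
  by_cases h : j = i
  · rw [h]
  · rw [pointFn_of_ne h, pointFn_of_ne (Ne.symm h), mul_zero, mul_zero]

/-- The chain that jumps to a fresh sample of `geo` at rate one. -/
noncomputable def resampleChain : ReversibleChain ℕ where
  q i j := geo j - pointFn i j
  π := geo
  p := resampleFn
  isQMatrix :=
    { nonneg_of_ne := fun i j hij => by
        rw [pointFn_of_ne hij.symm, sub_zero]; exact (geo_pos j).le
      hasSum_row := fun i => by simpa using hasSum_geo.sub (hasSum_pointFn i) }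
  π_pos := geo_pos
  π_hasSum := hasSum_geo
  q_reversible i j := by
    have := mul_pointFn_comm geo i j
    linarith
  isTransitionFunction := isTransitionFunction_resampleFn
  p_reversible t _ i j := by
    have := mul_pointFn_comm geo i j
    simp only [resampleFn]
    linear_combination Real.exp (-t) * this
  form_eq_limit f hf := by
    have hπ : ∀ i, 0 ≤ geo i := fun i => (geo_pos i).le
    have K : IsReversibleKernel geo fun _ j => geo j :=
      { pos := geo_pos
        hasSum := hasSum_geo
        nonneg := fun _ j => hπ j
        hasSum_row := fun _ => hasSum_geo
        balance := fun i j => mul_comm _ _ }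
    have hfm : HasSum (fun j => geo j * f j) (mean geo f) :=
      (hf.summable hπ hasSum_geo.summable).hasSum
    have hvar : ip geo (fun i => f i - kernelMap (fun _ j => geo j) f i) f = variance geo f := by
      change ip geo (fun i => f i - mean geo f) f = _
      have h1 := ip_smul_left (π := geo) (f := fun _ => 1) (g := f) (mean geo f)
      simp only [mul_one] at h1
      rw [ip_sub_left hπ hf (isL2_const hasSum_geo.summable _) hf, variance_eq_ip, h1, ip_one_left,
        sq]
    -- The form of this chain is exactly the variance, and `⟨f - P_t f, f⟩ = (1 - e^{-t}) Var f`, so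
    -- the limit is a derivative at zero.
    have hform : form (fun i j => geo j - pointFn i j) geo f = ENNReal.ofReal (variance geo f) := by
      have h1 := K.hasSum_energy hf
      rw [hvar] at h1
      have h2 : (2⁻¹ : ℝ≥0∞) = ENNReal.ofReal 2⁻¹ := by
        rw [ENNReal.ofReal_inv_of_pos (by norm_num)]; simp
      have h3 : variance geo f = 2⁻¹ * ∑' x : ℕ × ℕ, geo x.1 * geo x.2 * (f x.2 - f x.1) ^ 2 := by
        rw [h1.tsum_eq]; ring
      rw [h3, ENNReal.ofReal_mul (by norm_num), ← h2, ENNReal.ofReal_tsum_of_nonneg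
        (fun x => mul_nonneg (mul_nonneg (hπ _) (hπ _)) (sq_nonneg _)) h1.summable,
        ENNReal.tsum_prod (f := fun i j => ENNReal.ofReal (geo i * geo j * (f j - f i) ^ 2)), form]
      congr 1
      refine tsum_congr fun i => tsum_congr fun j => ?_
      congr 1
      by_cases h : j = i
      · simp [h]
      · rw [pointFn_of_ne h, sub_zero]
    have hmap : ∀ t i, semigroup resampleFn t f i =
        Real.exp (-t) * f i + (1 - Real.exp (-t)) * mean geo f := fun t i => by
      have := ((hasSum_pointFn_mul i f).mul_left (Real.exp (-t))).add
        (hfm.mul_left (1 - Real.exp (-t)))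
      exact (hasSum_of_eq this (fun j => by rw [resampleFn]; ring) rfl).tsum_eq
    have hG : ∀ t : ℝ, (mean geo fun i => (f i - semigroup resampleFn t f i) * f i) =
        (1 - Real.exp (-t)) * variance geo f := fun t => by
      rw [← hvar, ← ip_smul_left]
      change ip geo (fun i => f i - semigroup resampleFn t f i) f = _
      congr 1
      funext i
      rw [hmap]
      have : kernelMap (fun _ j => geo j) f i = mean geo f := rfl
      rw [this]; ring
    rw [hform]
    refine ENNReal.tendsto_ofReal ?_
    have hder : HasDerivAt (fun t : ℝ => 1 - Real.exp (-t)) 1 0 := by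
      have := ((hasDerivAt_id (0 : ℝ)).neg.exp).const_sub 1
      simpa using this
    have h := hder.hasDerivWithinAt (s := Set.Ioi 0)
    rw [hasDerivWithinAt_iff_tendsto_slope' (by simp)] at h
    have h' := h.mul_const (variance geo f)
    rw [one_mul] at h'
    refine h'.congr fun t => ?_
    rw [hG, slope_def_field]
    simp [div_eq_inv_mul, mul_assoc]

theorem stronglyErgodic_resampleChain : resampleChain.StronglyErgodic := by
  have htv : ∀ t : ℝ, ∀ x, tvNorm (resampleChain.p t x) resampleChain.π ≤
      2 * Real.exp (-t) := by
    intro t x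
    have h1 : tvNorm (resampleChain.p t x) resampleChain.π
        = Real.exp (-t) * tvNorm (resampleChain.p 0 x) resampleChain.π := by
      rw [tvNorm, tvNorm, ← tsum_mul_left]
      refine tsum_congr fun j => ?_
      have e1 : resampleChain.p t x j - resampleChain.π j =
          Real.exp (-t) * (pointFn x j - geo j) := by
        change resampleFn t x j - geo j = _
        rw [resampleFn]; ring
      have e2 : resampleChain.p 0 x j - resampleChain.π j = pointFn x j - geo j := by
        change resampleFn 0 x j - geo j = _
        simp [resampleFn]
      rw [e1, e2, abs_mul, abs_of_pos (Real.exp_pos _)]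
    have h2 := resampleChain.tvNorm_le_two le_rfl x
    rw [h1, mul_comm]
    exact mul_le_mul_of_nonneg_right h2 (Real.exp_pos _).le
  have hlim : Tendsto (fun t : ℝ => 2 * Real.exp (-t)) atTop (𝓝 0) := by
    simpa using Real.tendsto_exp_neg_atTop_nhds_zero.const_mul 2
  exact squeeze_zero (fun t => Real.iSup_nonneg fun x => ReversibleChain.tvNorm_nonneg)
    (fun t => Real.iSup_le (htv t) (by positivity)) hlim

/-- The indicator of `i` has entropy `π_i log (1/π_i)` and energy at most `π_i`, while `log (1/π_i)
= (i + 1) log 2` is unbounded. -/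
theorem not_logSobolev_resampleChain : ¬ resampleChain.LogSobolev := by
  rintro ⟨C, hC, h⟩
  have key : ∀ i : ℕ, ((i : ℝ) + 1) * Real.log 2 ≤ C := by
    intro i
    have hgi := geo_pos i
    have hsq : (fun k => pointFn i k ^ 2) = pointFn i := by
      funext k
      rw [pointFn_eq_ite]; split_ifs <;> norm_num
    have hD : form resampleChain.q resampleChain.π (pointFn i)
        = ENNReal.ofReal (geo i * -(geo i - pointFn i i)) :=
      form_pointFn resampleChain.isQMatrix resampleChain.π_nonneg resampleChain.q_reversible i
    have h1 := (h (pointFn i) (isL2_pointFn i) (by rw [hD]; exact ENNReal.ofReal_lt_top)).2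
    have e1 : mean resampleChain.π (fun k => pointFn i k ^ 2) = geo i := by
      rw [hsq, mean_pointFn]; rfl
    have e2 : (fun k => pointFn i k ^ 2 * Real.log (pointFn i k ^ 2 / geo i)) =
        fun k => Real.log (1 / geo i) * pointFn i k := by
      funext k
      by_cases hk : k = i
      · rw [hk, pointFn_self]; norm_num
      · rw [pointFn_of_ne hk]; norm_num
    rw [e1, e2, mean_const_mul, mean_pointFn, hD, pointFn_self, ENNReal.toReal_ofReal
      (by nlinarith [geo_le_half i])] at h1
    have h2 : Real.log (1 / geo i) * geo i ≤ C * (geo i * -(geo i - 1)) := h1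
    have h3 : Real.log (1 / geo i) * geo i ≤ C * geo i := by
      refine h2.trans (mul_le_mul_of_nonneg_left ?_ hC.le)
      nlinarith
    have h4 := le_of_mul_le_mul_right h3 hgi
    rw [geo, one_div_pow, one_div_one_div, Real.log_pow] at h4
    push_cast at h4
    exact h4
  obtain ⟨n, hn⟩ := exists_nat_gt (C / Real.log 2)
  have hl := Real.log_pos one_lt_two
  rw [div_lt_iff₀ hl] at hn
  nlinarith [key n]

end Resampling

/-! ### Resampling with site-dependent speeds: failure of Poincaré and of algebraic ergodicity -/

section Trap

/-- The rates of a resampling chain with speed `l i` at `i`. -/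
noncomputable def trapRate (l : ℕ → ℝ) (i j : ℕ) : ℝ :=
  l i * (geo j * l j - (∑' k, geo k * l k) * pointFn i j)

variable {l : ℕ → ℝ}

theorem summable_geo_mul_speed (h0 : ∀ i, 0 < l i) (h1 : ∀ i, l i ≤ 1) :
    Summable fun k => geo k * l k :=
  Summable.of_nonneg_of_le (fun k => mul_nonneg (geo_pos k).le (h0 k).le)
    (fun k => mul_le_of_le_one_right (geo_pos k).le (h1 k)) hasSum_geo.summable

theorem tsum_geo_mul_speed_le (h0 : ∀ i, 0 < l i) (h1 : ∀ i, l i ≤ 1) :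
    ∑' k, geo k * l k ≤ 1 := by
  rw [← hasSum_geo.tsum_eq]
  exact (summable_geo_mul_speed h0 h1).tsum_le_tsum
    (fun k => mul_le_of_le_one_right (geo_pos k).le (h1 k)) hasSum_geo.summable

theorem isReversibleRates_trapRate (h0 : ∀ i, 0 < l i) (h1 : ∀ i, l i ≤ 1) :
    IsReversibleRates (trapRate l) geo where
  isQMatrix :=
    { nonneg_of_ne := fun i j hij => by
        rw [trapRate, pointFn_of_ne hij.symm, mul_zero, sub_zero]
        exact mul_nonneg (h0 i).le (mul_nonneg (geo_pos j).le (h0 j).le)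
      hasSum_row := fun i => hasSum_of_eq (((summable_geo_mul_speed h0 h1).hasSum.sub
        ((hasSum_pointFn i).mul_left (∑' k, geo k * l k))).mul_left (l i)) (fun j => rfl)
        (by ring) }
  pos := geo_pos
  hasSum := hasSum_geo
  balance i j := by
    have : geo i * l i * pointFn i j = geo j * l j * pointFn j i :=
      mul_pointFn_comm (fun i => geo i * l i) i j
    rw [trapRate, trapRate]
    linear_combination (-(∑' k, geo k * l k)) * this

theorem neg_trapRate_self_le (h0 : ∀ i, 0 < l i) (h1 : ∀ i, l i ≤ 1) (i : ℕ) :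
    -trapRate l i i ≤ l i := by
  rw [trapRate, pointFn_self]
  have h2 := tsum_geo_mul_speed_le h0 h1
  have h3 := mul_nonneg (geo_pos i).le (h0 i).le
  nlinarith [h0 i]

theorem summable_geo_mul_trapRate (h0 : ∀ i, 0 < l i) (h1 : ∀ i, l i ≤ 1) :
    Summable fun i => geo i * trapRate l i i := by
  refine Summable.of_norm_bounded hasSum_geo.summable fun i => ?_
  have h2 := (isReversibleRates_trapRate h0 h1).diag_nonpos i
  rw [Real.norm_eq_abs, abs_mul, abs_of_pos (geo_pos i), abs_of_nonpos h2]
  exact mul_le_of_le_one_right (geo_pos i).le ((neg_trapRate_self_le h0 h1 i).trans (h1 i))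

/-- The resampling chain with speeds `l`. -/
noncomputable def trapChain (h0 : ∀ i, 0 < l i) (h1 : ∀ i, l i ≤ 1) : ReversibleChain ℕ :=
  (isReversibleRates_trapRate h0 h1).toChain (summable_geo_mul_trapRate h0 h1)

theorem trapChain_q (h0 : ∀ i, 0 < l i) (h1 : ∀ i, l i ≤ 1) :
    (trapChain h0 h1).q = trapRate l := rfl

theorem trapChain_π (h0 : ∀ i, 0 < l i) (h1 : ∀ i, l i ≤ 1) : (trapChain h0 h1).π = geo := rfl

theorem toReal_form_pointFn_trapChain_le (h0 : ∀ i, 0 < l i) (h1 : ∀ i, l i ≤ 1) (i : ℕ) :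
    (form (trapChain h0 h1).q (trapChain h0 h1).π (pointFn i)).toReal ≤ geo i * l i := by
  have H := isReversibleRates_trapRate h0 h1
  rw [trapChain_q, trapChain_π, form_pointFn H.isQMatrix (fun i => (geo_pos i).le) H.balance,
    ENNReal.toReal_ofReal (mul_nonneg (geo_pos i).le (neg_nonneg.2 (H.diag_nonpos i)))]
  exact mul_le_mul_of_nonneg_left (neg_trapRate_self_le h0 h1 i) (geo_pos i).le

/-- The indicator of `i` has variance at least `π_i / 2` but energy at most `π_i l_i`. -/
theorem not_poincare_trapChain (h0 : ∀ i, 0 < l i) (h1 : ∀ i, l i ≤ 1)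
    (hl : Tendsto l atTop (𝓝 0)) : ¬ (trapChain h0 h1).Poincare := by
  rintro ⟨C, hC, h⟩
  have key : ∀ i, 1 / 2 ≤ C * l i := fun i => by
    have h2 := h (pointFn i) (isL2_pointFn i) ((trapChain h0 h1).form_pointFn_lt_top i)
    rw [variance_pointFn] at h2
    have h3 := h2.trans (mul_le_mul_of_nonneg_left (toReal_form_pointFn_trapChain_le h0 h1 i) hC.le)
    rw [trapChain_π] at h3
    have hg := geo_pos i
    refine le_of_mul_le_mul_left ?_ hg
    nlinarith [geo_le_half i]
  have h2 := ge_of_tendsto' (hl.const_mul C) key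
  norm_num at h2

/-- Since `D(P_t f) ≤ Var f / (2t)`, the difference of `P_t f` across any edge of positive rate
tends to zero. All sites are joined to `o`, and for `f = δ_x/π_x` these differences are bounded, so
the variance of `P_t f` tends to zero by dominated convergence. -/
theorem ReversibleChain.ordinarilyErgodic_of_pos {E : Type*} (X : ReversibleChain E) (o : E)
    (ho : ∀ i, i ≠ o → 0 < X.q o i) : X.OrdinarilyErgodic := by
  intro x
  set f : E → ℝ := fun z => (X.π x)⁻¹ * pointFn x z with hfdef
  have hf : IsL2 X.π f := (isL2_pointFn x).const_mul _
  have hx := inv_pos.2 (X.π_pos x)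
  have hf0 : ∀ i, 0 ≤ f i := fun i => mul_nonneg hx.le (pointFn_nonneg x i)
  have hf1 : ∀ i, f i ≤ (X.π x)⁻¹ := fun i => by
    refine mul_le_of_le_one_right hx.le ?_
    by_cases h : i = x
    · rw [h, pointFn_self]
    · rw [pointFn_of_ne h]; exact zero_le_one
  -- The absolute value of `t` makes the domination hold for every real index, not only eventually.
  set F : ℝ → E → ℝ := fun t i => semigroup X.p |t| f i - semigroup X.p |t| f o with hF
  have hFle : ∀ t i, |F t i| ≤ (X.π x)⁻¹ := fun t i => by
    have K := X.isReversibleKernel (abs_nonneg t)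
    have a1 := K.map_le_of_le hf hf1 i
    have a2 := K.map_le_of_le hf hf1 o
    have a3 := K.le_map_of_le hf hf0 i
    have a4 := K.le_map_of_le hf hf0 o
    have e : F t i = kernelMap (X.p |t|) f i - kernelMap (X.p |t|) f o := rfl
    rw [e, abs_le]
    constructor <;> linarith
  have hFlim : ∀ i, Tendsto (fun t => F t i) atTop (𝓝 0) := fun i => by
    by_cases hi : i = o
    · simp [hF, hi]
    have hw := mul_pos (X.π_pos o) (ho i hi)
    have h1 : Tendsto (fun t : ℝ => Real.sqrt (variance X.π f / (2 * t) / (X.π o * X.q o i))) atTop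
        (𝓝 0) := by
      have e1 : Tendsto (fun t : ℝ => 2 * t) atTop atTop :=
        tendsto_id.const_mul_atTop two_pos
      simpa using ((e1.const_div_atTop (variance X.π f)).div_const (X.π o * X.q o i)).sqrt
    refine squeeze_zero_norm' ?_ h1
    filter_upwards [eventually_gt_atTop 0] with t ht
    rw [Real.norm_eq_abs]
    refine Real.abs_le_sqrt ?_
    have e : F t i = semigroup X.p t f i - semigroup X.p t f o := by
      simp only [hF]; rw [abs_of_pos ht]
    rw [e, le_div_iff₀ hw]
    have h2 := (ofReal_term_le_form (f := semigroup X.p t f) o i X.q_reversible).trans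
      (X.form_semigroup_le ht hf)
    have hv := variance_nonneg X.π_nonneg X.π_hasSum (X.isL2_semigroup ht.le hf)
    have hv0 := variance_nonneg X.π_nonneg X.π_hasSum hf
    have h3 : ENNReal.ofReal ((variance X.π f - variance X.π (semigroup X.p t f)) / (2 * t)) ≤
        ENNReal.ofReal (variance X.π f / (2 * t)) := by
      refine ENNReal.ofReal_le_ofReal ?_
      gcongr
      linarith
    have h4 := (ENNReal.ofReal_le_ofReal_iff (by positivity)).1 (h2.trans h3)
    linarith
  have hB : IsL2 X.π fun _ => (X.π x)⁻¹ := isL2_const X.π_hasSum.summable _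
  have hlim := tendsto_ip_of_dominated X.π_nonneg hB hB hFle hFle hFlim hFlim
  have h0 : ip X.π (fun _ => (0 : ℝ)) (fun _ => 0) = 0 := by simp [ip, mean]
  rw [h0] at hlim
  have hlim2 := hlim.sqrt
  rw [Real.sqrt_zero] at hlim2
  refine squeeze_zero' (Eventually.of_forall fun t => tvNorm_nonneg) ?_ hlim2
  filter_upwards [eventually_gt_atTop 0] with t ht
  refine Real.le_sqrt_of_sq_le ((X.tvNorm_sq_le ht.le x).trans ?_)
  have := variance_le_ip_sub_const X.π_nonneg X.π_hasSum (X.isL2_semigroup ht.le hf)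
    (semigroup X.p t f o)
  have e : F t = fun i => semigroup X.p t f i - semigroup X.p t f o := by
    funext i
    simp only [hF]; rw [abs_of_pos ht]
  rw [e]
  exact this

theorem ordinarilyErgodic_trapChain (h0 : ∀ i, 0 < l i) (h1 : ∀ i, l i ≤ 1) :
    (trapChain h0 h1).OrdinarilyErgodic :=
  (trapChain h0 h1).ordinarilyErgodic_of_pos 0 fun i hi => by
    rw [trapChain_q, trapRate, pointFn_of_ne hi, mul_zero, sub_zero]
    exact mul_pos (h0 0) (mul_pos (geo_pos i) (h0 i))

/-- By time `1/(4 l_i)` a chain started at `i` has left with probability at most `1/4`. So `P_t 1_0`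
is at most `1/4` at `i`, although its mean is `π_0 = 1/2`, and this single site contributes `π_i /
16` to the variance. -/
theorem le_variance_semigroup_trapChain (h0 : ∀ i, 0 < l i) (h1 : ∀ i, l i ≤ 1) {i : ℕ}
    (hi : i ≠ 0) : geo i / 16 ≤ variance geo
      (semigroup (trapChain h0 h1).p (1 / (4 * l i)) (pointFn 0)) := by
  set X := trapChain h0 h1 with hX
  have hπ : X.π = geo := rfl
  set t := 1 / (4 * l i) with ht
  have hli := h0 i
  have ht0 : 0 < t := by positivity
  have hg := geo_pos i
  have hpi : 1 - X.p t i i ≤ 1 / 4 := by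
    have h2 := X.ip_sub_semigroup_le ht0 (isL2_pointFn i) (X.form_pointFn_lt_top i)
    have h3 := h2.trans (mul_le_mul_of_nonneg_left (toReal_form_pointFn_trapChain_le h0 h1 i) ht0.le)
    rw [ip_pointFn_right, ip_pointFn_right, pointFn_self, hπ] at h3
    have e : semigroup X.p t (pointFn i) i = X.p t i i := kernelMap_pointFn _ _ _
    rw [e] at h3
    have e2 : t * (geo i * l i) = geo i * (1 / 4) := by rw [ht]; field_simp
    rw [e2] at h3
    refine le_of_mul_le_mul_left ?_ hg
    linarith
  have hp0 : X.p t i 0 ≤ 1 / 4 := by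
    have h2 := (X.isTransitionFunction.hasSum_row t ht0.le i)
    have h3 := sum_le_hasSum {i, 0} (fun j _ => X.isTransitionFunction.nonneg t ht0.le i j) h2
    rw [Finset.sum_pair hi] at h3
    linarith
  have hL := X.isL2_semigroup ht0.le (isL2_pointFn (π := X.π) 0)
  have hm : mean X.π (semigroup X.p t (pointFn 0)) = 1 / 2 := by
    rw [X.mean_semigroup ht0.le (isL2_pointFn 0), mean_pointFn, hπ, geo]; norm_num
  have hcs := ip_mul_self_le X.π_nonneg (X.isL2_sub_const hL (1 / 2)) (isL2_pointFn i)
  rw [ip_pointFn_right, ip_pointFn_right, pointFn_self, ← hm,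
    ← variance_eq_ip_centered X.π_nonneg X.π_hasSum hL, hm, hπ, mul_one] at hcs
  have e : semigroup X.p t (pointFn 0) i = X.p t i 0 := kernelMap_pointFn _ _ _
  rw [e] at hcs
  have h5 : geo i * (X.p t i 0 - 1 / 2) ^ 2 ≤ variance geo (semigroup X.p t (pointFn 0)) := by
    refine le_of_mul_le_mul_right ?_ hg
    linarith
  have h6 : 1 / 16 ≤ (X.p t i 0 - 1 / 2) ^ 2 := by nlinarith
  nlinarith

/-- Speeds decaying faster than every power of the stationary distribution. -/
noncomputable def fastSpeed (i : ℕ) : ℝ := (1 / 2) ^ ((i + 1) * (i + 1))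

theorem fastSpeed_pos (i : ℕ) : 0 < fastSpeed i := by rw [fastSpeed]; positivity

theorem fastSpeed_le_one (i : ℕ) : fastSpeed i ≤ 1 := pow_le_one₀ (by norm_num) (by norm_num)

/-- Algebraic decay of order `β` at the times `1/(4 l_i)` would force `π_i ≤ K l_i^β`, whereas `l_i
= π_i^{i+1}` beats every power. -/
theorem not_l2AlgebraicallyErgodic_trapChain :
    ¬ (trapChain fastSpeed_pos fastSpeed_le_one).L2AlgebraicallyErgodic := by
  rintro ⟨V, C, b, hC, hb, -, hfin, h⟩
  set X := trapChain fastSpeed_pos fastSpeed_le_one with hX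
  have hV := hfin (pointFn 0) (pointFn_support_finite 0)
  set A := C * (V (pointFn 0)).toReal with hA
  have hA0 : 0 ≤ A := mul_nonneg hC.le ENNReal.toReal_nonneg
  set β := b - 1 with hβ
  have hβ0 : 0 < β := by rw [hβ]; linarith
  have hup : ∀ t : ℝ, 0 < t → variance geo (semigroup X.p t (pointFn 0)) ≤ A / t ^ β := by
    intro t ht
    have h3 := h (pointFn 0) (isL2_pointFn 0) t ht
    have ht' : 0 < t ^ β := Real.rpow_pos_of_pos ht _
    rw [← ENNReal.ofReal_toReal hV.ne, ← ENNReal.ofReal_mul hC.le,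
      ← ENNReal.ofReal_div_of_pos ht', ENNReal.ofReal_le_ofReal_iff (by positivity)] at h3
    exact h3
  have key : ∀ i : ℕ, i ≠ 0 → geo i ≤ 16 * A * 4 ^ β * fastSpeed i ^ β := by
    intro i hi
    have hl := fastSpeed_pos i
    have h1 := (le_variance_semigroup_trapChain fastSpeed_pos fastSpeed_le_one hi).trans
      (hup (1 / (4 * fastSpeed i)) (by positivity))
    rw [Real.div_rpow zero_le_one (by positivity), Real.one_rpow, div_div_eq_mul_div, div_one,
      Real.mul_rpow (by norm_num) hl.le] at h1
    linarith
  set K := 16 * A * 4 ^ β with hK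
  have hK0 : 0 ≤ K := by positivity
  -- From `m > 2/β` one gets `l_m^β ≤ π_m²`, hence `1 ≤ K π_m`; this contradicts `1/π_m = 2^{m+1} >
  -- m > K`.
  obtain ⟨m, hm⟩ := exists_nat_gt (max K (2 / β))
  have hmK : K < m := (le_max_left _ _).trans_lt hm
  have hmβ : 2 / β < m := (le_max_right _ _).trans_lt hm
  have hm0 : m ≠ 0 := by
    rintro rfl
    have : 0 < 2 / β := by positivity
    push_cast at hmβ
    linarith
  have h1 := key m hm0
  set n := m + 1 with hn
  have hgeo : geo m = (1 / 2) ^ n := rfl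
  have hsp : fastSpeed m ^ β ≤ (1 / 2) ^ (2 * n) := by
    have e1 : fastSpeed m = (1 / 2 : ℝ) ^ (((n * n : ℕ) : ℝ)) := by
      rw [fastSpeed, Real.rpow_natCast]
    rw [e1, ← Real.rpow_mul (by norm_num), ← Real.rpow_natCast (1 / 2 : ℝ) (2 * n)]
    refine Real.rpow_le_rpow_of_exponent_ge (by norm_num) (by norm_num) ?_
    rw [div_lt_iff₀ hβ0] at hmβ
    have e2 : (m : ℝ) ≤ n := by exact_mod_cast Nat.le_succ m
    have e3 : (0 : ℝ) ≤ n := Nat.cast_nonneg n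
    push_cast
    nlinarith
  have h2 : (1 / 2 : ℝ) ^ n ≤ K * ((1 / 2) ^ n * (1 / 2) ^ n) := by
    rw [← pow_add, ← two_mul, ← hgeo]
    exact h1.trans (mul_le_mul_of_nonneg_left hsp hK0)
  have hp : (0 : ℝ) < (1 / 2) ^ n := by positivity
  have h3 : 1 ≤ K * (1 / 2) ^ n := by
    refine le_of_mul_le_mul_right ?_ hp
    linarith
  have h4 : (n : ℝ) < 2 ^ n := by exact_mod_cast Nat.lt_two_pow_self
  have h5 : (2 : ℝ) ^ n * (1 / 2) ^ n = 1 := by rw [← mul_pow]; norm_num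
  have h6 : (m : ℝ) ≤ n := by exact_mod_cast Nat.le_succ m
  nlinarith

/-- Speeds decaying slower than the stationary distribution. -/
noncomputable def slowSpeed (i : ℕ) : ℝ := 1 / ((i : ℝ) + 1)

theorem slowSpeed_pos (i : ℕ) : 0 < slowSpeed i := by rw [slowSpeed]; positivity

theorem slowSpeed_le_one (i : ℕ) : slowSpeed i ≤ 1 := by
  rw [slowSpeed, div_le_one (by positivity)]
  linarith [Nat.cast_nonneg (α := ℝ) i]

/-- A Nash type inequality with the oscillation in place of the `L¹` norm. -/
theorem variance_sq_le_trapChain {g : ℕ → ℝ} {O : ℝ} (hO : ∀ i j, |g i - g j| ≤ O)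
    (hD : form (trapRate slowSpeed) geo g < ∞) :
    variance geo g ^ 2 ≤
      8 * (∑' i : ℕ, geo i * ((i : ℝ) + 1)) * O ^ 2 * (form (trapRate slowSpeed) geo g).toReal := by
  have hπ : ∀ i, 0 ≤ geo i := fun i => (geo_pos i).le
  have H := isReversibleRates_trapRate slowSpeed_pos slowSpeed_le_one
  set W := ∑' i : ℕ, geo i * ((i : ℝ) + 1)
  set D := (form (trapRate slowSpeed) geo g).toReal
  have hg : IsL2 geo g := by
    refine isL2_of_bounded hπ hasSum_geo.summable (M := O + |g 0|) fun i => ?_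
    have := abs_sub_abs_le_abs_sub (g i) (g 0)
    linarith [hO i 0]
  -- Only the jumps out of `0` are used. As `l_0 = 1` and `π_0 = 1/2`, row zero of the form already
  -- gives `∑ π_i l_i w_i² ≤ 4 D`.
  set w : ℕ → ℝ := fun i => g i - g 0 with hw
  have hwO : ∀ i, w i ^ 2 ≤ O ^ 2 := fun i => sq_le_sq' (abs_le.1 (hO i 0)).1 (abs_le.1 (hO i 0)).2
  set a : ℕ → ℝ := fun i => geo i * (slowSpeed i * w i ^ 2) with ha
  have ha0 : ∀ i, 0 ≤ a i := fun i =>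
    mul_nonneg (hπ i) (mul_nonneg (slowSpeed_pos i).le (sq_nonneg _))
  have hrow : ∑' i, ENNReal.ofReal (1 / 2 * a i) ≤ 2 * form (trapRate slowSpeed) geo g := by
    rw [form, ← mul_assoc, ENNReal.mul_inv_cancel (by norm_num) (by norm_num), one_mul]
    refine le_trans (ENNReal.tsum_le_tsum fun j => ?_) (ENNReal.le_tsum 0)
    refine ENNReal.ofReal_le_ofReal (le_of_eq ?_)
    by_cases hj : j = 0
    · simp [ha, hw, hj]
    · rw [trapRate, pointFn_of_ne hj]
      simp only [ha, hw, geo, slowSpeed]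
      push_cast
      ring
  have hfin : ∑' i, ENNReal.ofReal (1 / 2 * a i) ≠ ∞ :=
    (hrow.trans_lt (ENNReal.mul_lt_top (by norm_num) hD)).ne
  have has' : Summable fun i => 1 / 2 * a i :=
    (ENNReal.summable_toReal hfin).congr fun i =>
      ENNReal.toReal_ofReal (by have := ha0 i; positivity)
  have has : Summable a := (has'.mul_left 2).congr fun i => by ring
  have hale : ∑' i, a i ≤ 4 * D := by
    have h1 := ENNReal.toReal_mono (ENNReal.mul_lt_top (by norm_num) hD).ne hrow
    rw [← ENNReal.ofReal_tsum_of_nonneg (fun i => by have := ha0 i; positivity) has',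
      ENNReal.toReal_ofReal (tsum_nonneg fun i => by have := ha0 i; positivity), tsum_mul_left,
      ENNReal.toReal_mul] at h1
    norm_num at h1
    change _ ≤ 2 * D at h1
    linarith
  -- Cauchy–Schwarz for `w² = (√l w) (w/√l)`. The second factor is controlled by the oscillation
  -- because `∑ π_i / l_i` is finite.
  set u : ℕ → ℝ := fun i => Real.sqrt (slowSpeed i) * w i with hu
  set v : ℕ → ℝ := fun i => w i / Real.sqrt (slowSpeed i) with hv
  have husq : ∀ i, u i ^ 2 = slowSpeed i * w i ^ 2 := fun i => by
    rw [hu, mul_pow, Real.sq_sqrt (slowSpeed_pos i).le]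
  have hvsq : ∀ i, v i ^ 2 = ((i : ℝ) + 1) * w i ^ 2 := fun i => by
    rw [hv, div_pow, Real.sq_sqrt (slowSpeed_pos i).le, slowSpeed]
    field_simp
  have huL : IsL2 geo u := has.congr fun i => by rw [husq]
  have hvle : ∀ i, geo i * v i ^ 2 ≤ geo i * ((i : ℝ) + 1) * O ^ 2 := fun i => by
    rw [hvsq, mul_assoc]
    exact mul_le_mul_of_nonneg_left (mul_le_mul_of_nonneg_left (hwO i) (by positivity)) (hπ i)
  have hvL : IsL2 geo v := Summable.of_nonneg_of_le (fun i => mul_nonneg (hπ i) (sq_nonneg _)) hvle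
    (summable_geo_mul.mul_right _)
  have h1 := ip_mul_self_le hπ huL hvL
  have e1 : ip geo u v = ip geo w w := tsum_congr fun i => by
    have := (Real.sqrt_pos.2 (slowSpeed_pos i)).ne'
    simp only [hu, hv]
    field_simp
  have e2 : ip geo u u ≤ 4 * D := by
    refine le_trans (le_of_eq ?_) hale
    rw [ip_self_eq]
    exact tsum_congr fun i => by change geo i * u i ^ 2 = a i; rw [husq]
  have e3 : ip geo v v ≤ W * O ^ 2 := by
    rw [ip_self_eq, ← tsum_mul_right]
    exact Summable.tsum_le_tsum hvle hvL (summable_geo_mul.mul_right _)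
  have h2 := variance_le_ip_sub_const hπ hasSum_geo hg (g 0)
  have h3 := variance_nonneg hπ hasSum_geo hg
  have hD0 : 0 ≤ D := ENNReal.toReal_nonneg
  have hW0 : 0 ≤ W := tsum_nonneg fun i => mul_nonneg (hπ i) (by positivity)
  calc variance geo g ^ 2 ≤ ip geo w w ^ 2 := pow_le_pow_left₀ h3 h2 2
    _ ≤ ip geo u u * ip geo v v := by rw [← e1]; exact h1
    _ ≤ 4 * D * (W * O ^ 2) := mul_le_mul e2 e3 (ip_self_nonneg hπ) (by positivity)
    _ ≤ 8 * W * O ^ 2 * D := by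
      have : 0 ≤ W * O ^ 2 * D := by positivity
      nlinarith

/-- Take for `V` the squared oscillation, infinite for unbounded functions. The semigroup does not
increase the oscillation `O`, so the variance `v` of `P_t f` satisfies `v² ≤ 8 W O² D(P_t f)`; with
`2 t D(P_t f) ≤ Var f ≤ O²` this gives decay of order `t^{-1/2}`. -/
theorem l2AlgebraicallyErgodic_trapChain :
    (trapChain slowSpeed_pos slowSpeed_le_one).L2AlgebraicallyErgodic := by
  set X := trapChain slowSpeed_pos slowSpeed_le_one with hX
  set W := ∑' i : ℕ, geo i * ((i : ℝ) + 1) with hW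
  have hW0 : 0 < W := by
    refine lt_of_lt_of_le (mul_pos (geo_pos 0) (show (0 : ℝ) < (0 : ℕ) + 1 by norm_num))
      (summable_geo_mul.le_tsum 0 fun i _ => mul_nonneg (geo_pos i).le (by positivity))
  refine ⟨fun f => (⨆ i, ⨆ j, ENNReal.ofReal |f i - f j|) ^ 2, Real.sqrt (4 * W), 3 / 2,
    Real.sqrt_pos.2 (by positivity), by norm_num, fun f _ c₁ c₂ => ?_, fun f hf => ?_,
    fun f hf t ht => ?_⟩
  · have h1 : ∀ i j, ENNReal.ofReal |c₁ * f i + c₂ - (c₁ * f j + c₂)| =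
        ENNReal.ofReal |c₁| * ENNReal.ofReal |f i - f j| := fun i j => by
      rw [← ENNReal.ofReal_mul (abs_nonneg _), ← abs_mul]
      congr 2; ring
    simp only [h1]
    rw [← sq_abs c₁, ENNReal.ofReal_pow (abs_nonneg _), ← mul_pow]
    simp only [ENNReal.mul_iSup]
  · refine ENNReal.pow_lt_top ?_
    set M := ∑ i ∈ hf.toFinset, |f i|
    have hM : ∀ i, |f i| ≤ M := fun i => by
      by_cases hi : f i = 0
      · rw [hi, abs_zero]; exact Finset.sum_nonneg fun i _ => abs_nonneg _
      · exact Finset.single_le_sum (f := fun i => |f i|) (fun i _ => abs_nonneg _)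
          (hf.mem_toFinset.2 hi)
    refine lt_of_le_of_lt (iSup_le fun i => iSup_le fun j => ENNReal.ofReal_le_ofReal ?_)
      (ENNReal.ofReal_lt_top (r := M + M))
    exact (abs_sub _ _).trans (add_le_add (hM i) (hM j))
  · set S := ⨆ i, ⨆ j, ENNReal.ofReal |f i - f j| with hS
    have hC : 0 < Real.sqrt (4 * W) := Real.sqrt_pos.2 (by positivity)
    have ht' : 0 < t ^ ((3 : ℝ) / 2 - 1) := Real.rpow_pos_of_pos ht _
    change _ ≤ ENNReal.ofReal (Real.sqrt (4 * W)) * S ^ 2 / ENNReal.ofReal (t ^ ((3:ℝ)/2 - 1))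
    by_cases hSt : S = ∞
    · rw [hSt, ENNReal.top_pow two_ne_zero, ENNReal.mul_top (by simpa using hC),
        ENNReal.top_div_of_ne_top ENNReal.ofReal_ne_top]
      exact le_top
    set O := S.toReal with hO
    have hOle : ∀ i j, |f i - f j| ≤ O := fun i j => by
      have : ENNReal.ofReal |f i - f j| ≤ S :=
        le_iSup_of_le i (le_iSup (fun j => ENNReal.ofReal |f i - f j|) j)
      exact (ENNReal.ofReal_le_iff_le_toReal hSt).1 this
    have hO0 : 0 ≤ O := ENNReal.toReal_nonneg
    rw [← ENNReal.ofReal_toReal hSt, ← ENNReal.ofReal_pow hO0, ← ENNReal.ofReal_mul hC.le,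
      ← ENNReal.ofReal_div_of_pos ht']
    refine ENNReal.ofReal_le_ofReal ?_
    have K := X.isReversibleKernel ht.le
    have hosc : ∀ i j, |semigroup X.p t f i - semigroup X.p t f j| ≤ O := by
      have h1 : ∀ i j, semigroup X.p t f i - semigroup X.p t f j ≤ O := fun i j => by
        have h2 : ∀ k, semigroup X.p t f i - O ≤ f k := fun k => by
          have := K.map_le_of_le hf (c := f k + O) (fun m => by
            have := (abs_le.1 (hOle m k)).2
            linarith) i
          change semigroup X.p t f i ≤ _ at this
          linarith
        have h3 := K.le_map_of_le hf h2 j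
        change _ ≤ semigroup X.p t f j at h3
        linarith
      intro i j
      rw [abs_le]
      exact ⟨by linarith [h1 j i], h1 i j⟩
    have h1 := variance_sq_le_trapChain hosc (X.form_semigroup_lt_top ht hf)
    have h2 := X.toReal_form_semigroup_le ht hf
    have h3 : 0 ≤ variance X.π (semigroup X.p t f) :=
      variance_nonneg X.π_nonneg X.π_hasSum (X.isL2_semigroup ht.le hf)
    have h4 : variance X.π f ≤ O ^ 2 := by
      have e1 := variance_le_ip_sub_const X.π_nonneg X.π_hasSum hf (f 0)
      have e2 := mean_mono (g := fun _ => O ^ 2) (X.isL2_sub_const hf (f 0))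
        (X.π_hasSum.summable.mul_right _) X.π_nonneg
        fun i => sq_le_sq' (abs_le.1 (hOle i 0)).1 (abs_le.1 (hOle i 0)).2
      rw [mean_const X.π_hasSum, ← ip_self_eq] at e2
      exact e1.trans e2
    change variance X.π (semigroup X.p t f) ^ 2 ≤
      8 * W * O ^ 2 * (form X.q X.π (semigroup X.p t f)).toReal at h1
    set v := variance X.π (semigroup X.p t f)
    set D := (form X.q X.π (semigroup X.p t f)).toReal
    have h5 : v ^ 2 * t ≤ 4 * W * O ^ 4 := by
      have e1 : 2 * t * D ≤ O ^ 2 := by linarith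
      have e2 := mul_le_mul_of_nonneg_right h1 ht.le
      have e3 := mul_le_mul_of_nonneg_left e1 (show 0 ≤ 4 * W * O ^ 2 by positivity)
      nlinarith
    change v ≤ _
    rw [show (3 : ℝ) / 2 - 1 = 1 / 2 by norm_num, ← Real.sqrt_eq_rpow,
      le_div_iff₀ (Real.sqrt_pos.2 ht)]
    refine abs_le_of_sq_le_sq' ?_ (by positivity) |>.2
    rw [mul_pow, mul_pow, Real.sq_sqrt ht.le, Real.sq_sqrt (by positivity)]
    calc v ^ 2 * t ≤ 4 * W * O ^ 4 := h5
      _ = 4 * W * (O ^ 2) ^ 2 := by ring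

end Trap

end MarkovChain

/-! ### A linear birth–death chain: log-Sobolev without strong ergodicity -/

namespace MarkovChain

section LinearBirthDeath

/-- The birth–death chain on `ℕ` with birth rates `i + 1` and death rates `2 i`. -/
noncomputable def birthDeathRate (i j : ℕ) : ℝ :=
  ((i : ℝ) + 1) * pointFn (i + 1) j + 2 * i * pointFn (i - 1) j - (3 * i + 1) * pointFn i j

theorem birthDeathRate_succ (i : ℕ) : birthDeathRate i (i + 1) = (i : ℝ) + 1 := by
  rw [birthDeathRate, pointFn_self, pointFn_of_ne (by omega : i + 1 ≠ i - 1),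
    pointFn_of_ne (by omega : i + 1 ≠ i)]
  ring

theorem birthDeathRate_pred (i : ℕ) : birthDeathRate (i + 1) i = 2 * ((i : ℝ) + 1) := by
  rw [birthDeathRate, Nat.add_sub_cancel, pointFn_self, pointFn_of_ne (by omega : i ≠ i + 1 + 1),
    pointFn_of_ne (by omega : i ≠ i + 1)]
  push_cast
  ring

theorem birthDeathRate_of_far {i j : ℕ} (h1 : j ≠ i) (h2 : j ≠ i + 1) (h3 : i ≠ j + 1) :
    birthDeathRate i j = 0 := by
  rw [birthDeathRate, pointFn_of_ne h1, pointFn_of_ne h2, pointFn_of_ne (by omega : j ≠ i - 1)]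
  ring

/-- At `i = 0` truncated subtraction places the downward jump on the diagonal, but its rate `2 i`
vanishes. -/
theorem birthDeathRate_self (i : ℕ) : birthDeathRate i i = -(3 * i + 1) := by
  rw [birthDeathRate, pointFn_self, pointFn_of_ne (by omega : i ≠ i + 1)]
  rcases i with _ | i
  · simp
  · rw [pointFn_of_ne (by omega : i + 1 ≠ i + 1 - 1)]
    ring

theorem hasSum_birthDeathRate_mul (i : ℕ) (u : ℕ → ℝ) :
    HasSum (fun j => birthDeathRate i j * u j)
      ((i + 1) * u (i + 1) + 2 * i * u (i - 1) - (3 * i + 1) * u i) :=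
  hasSum_of_eq ((((hasSum_pointFn_mul (i + 1) u).mul_left ((i : ℝ) + 1)).add
    ((hasSum_pointFn_mul (i - 1) u).mul_left (2 * (i : ℝ)))).sub
    ((hasSum_pointFn_mul i u).mul_left (3 * (i : ℝ) + 1)))
    (fun j => by rw [birthDeathRate]; ring) rfl

theorem geo_succ (i : ℕ) : geo (i + 1) = geo i / 2 := by
  rw [geo, geo, pow_succ]; ring

theorem isReversibleRates_birthDeathRate : IsReversibleRates birthDeathRate geo where
  isQMatrix :=
    { nonneg_of_ne := fun i j hij => by
        rw [birthDeathRate, pointFn_of_ne hij.symm, mul_zero, sub_zero]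
        have := pointFn_nonneg (i + 1) j
        have := pointFn_nonneg (i - 1) j
        positivity
      hasSum_row := fun i =>
        hasSum_of_eq (hasSum_birthDeathRate_mul i fun _ => 1) (fun j => (mul_one _).symm) (by ring) }
  pos := geo_pos
  hasSum := hasSum_geo
  balance i j := by
    by_cases h1 : j = i
    · rw [h1]
    by_cases h2 : j = i + 1
    · rw [h2, birthDeathRate_succ, birthDeathRate_pred, geo_succ]; ring
    by_cases h3 : i = j + 1
    · rw [h3, birthDeathRate_succ, birthDeathRate_pred, geo_succ]; ring
    rw [birthDeathRate_of_far h1 h2 h3, birthDeathRate_of_far (Ne.symm h1) h3 h2]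
    ring

theorem summable_geo_mul_birthDeathRate : Summable fun i => geo i * birthDeathRate i i :=
  ((summable_geo_mul.mul_left (-3)).add (hasSum_geo.summable.mul_left 2)).congr fun i => by
    rw [birthDeathRate_self]; ring

/-- The reversible birth–death chain with birth rates `i + 1` and death rates `2 i`. -/
noncomputable def birthDeathChain : ReversibleChain ℕ :=
  isReversibleRates_birthDeathRate.toChain summable_geo_mul_birthDeathRate

theorem sum_increments_le_form {f : ℕ → ℝ} (hD : form birthDeathRate geo f < ∞) (n : ℕ) :
    ∑ i ∈ Finset.range n, geo i * ((i : ℝ) + 1) * (f (i + 1) - f i) ^ 2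
      ≤ 2 * (form birthDeathRate geo f).toReal := by
  have h0 : ∀ i : ℕ, 0 ≤ geo i * ((i : ℝ) + 1) * (f (i + 1) - f i) ^ 2 := fun i => by
    have := (geo_pos i).le
    positivity
  have h : ∑ i ∈ Finset.range n, ENNReal.ofReal (geo i * ((i : ℝ) + 1) * (f (i + 1) - f i) ^ 2)
      ≤ 2 * form birthDeathRate geo f := by
    rw [form, ← mul_assoc, ENNReal.mul_inv_cancel (by norm_num) (by norm_num), one_mul]
    refine le_trans (Finset.sum_le_sum fun i _ => ?_) (ENNReal.sum_le_tsum _)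
    refine le_trans (le_of_eq ?_) (ENNReal.le_tsum (i + 1))
    rw [birthDeathRate_succ]
  rw [← ENNReal.ofReal_sum_of_nonneg fun i _ => h0 i] at h
  have h2 := ENNReal.toReal_mono (ENNReal.mul_lt_top (by norm_num) hD).ne h
  rwa [ENNReal.toReal_ofReal (Finset.sum_nonneg fun i _ => h0 i), ENNReal.toReal_mul,
    ENNReal.toReal_ofNat] at h2

/-- A weighted Hardy inequality for the birth–death chain. -/
theorem sum_weighted_le_form {f : ℕ → ℝ} (hD : form birthDeathRate geo f < ∞) (n : ℕ) :
    ∑ i ∈ Finset.range n, geo i * (((i : ℝ) + 1) * (f i - f 0) ^ 2)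
      ≤ 112 * (form birthDeathRate geo f).toReal := by
  set a : ℕ → ℝ := fun i => geo i * (((i : ℝ) + 1) * (f i - f 0) ^ 2) with ha
  have ha0 : ∀ i, 0 ≤ a i := fun i => by
    have := (geo_pos i).le
    positivity
  -- For `i ≥ 1` the weight shrinks by `(i + 2) / (2 (i + 1)) ≤ 3/4`, and Young's factor `7/6`
  -- leaves `7/8 < 1`. At `i = 0` the term is zero. Summing and absorbing gives `8 · 7 · 2 = 112`.
  have hstep : ∀ i, a (i + 1) ≤
      7 / 8 * a i + 7 * (geo i * ((i : ℝ) + 1) * (f (i + 1) - f i) ^ 2) := fun i => by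
    simp only [ha, geo_succ]
    set w := f i - f 0 with hw
    set d := f (i + 1) - f i
    have e : f (i + 1) - f 0 = w + d := by ring
    rw [e]
    have hwd : (w + d) ^ 2 ≤ 7 / 6 * w ^ 2 + 7 * d ^ 2 := by nlinarith [sq_nonneg (w - 6 * d)]
    have key : ((i : ℝ) + 1 + 1) / 2 * (w + d) ^ 2
        ≤ 7 / 8 * (((i : ℝ) + 1) * w ^ 2) + 7 * (((i : ℝ) + 1) * d ^ 2) := by
      rcases Nat.eq_zero_or_pos i with h | h
      · have hw0 : w = 0 := by rw [hw, h, sub_self]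
        rw [hw0, h]
        push_cast
        nlinarith [sq_nonneg d]
      · have h1 : (1 : ℝ) ≤ i := by exact_mod_cast h
        calc ((i : ℝ) + 1 + 1) / 2 * (w + d) ^ 2
            ≤ 3 / 4 * ((i : ℝ) + 1) * (w + d) ^ 2 :=
              mul_le_mul_of_nonneg_right (by linarith) (sq_nonneg _)
          _ ≤ 3 / 4 * ((i : ℝ) + 1) * (7 / 6 * w ^ 2 + 7 * d ^ 2) :=
              mul_le_mul_of_nonneg_left hwd (by positivity)
          _ ≤ _ := by
              have : 0 ≤ ((i : ℝ) + 1) * d ^ 2 := by positivity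
              nlinarith
    have := mul_le_mul_of_nonneg_left key (geo_pos i).le
    push_cast
    linarith
  have h1 : ∑ i ∈ Finset.range n, a i ≤ ∑ i ∈ Finset.range (n + 1), a i := by
    rw [Finset.sum_range_succ]; linarith [ha0 n]
  have h2 : ∑ i ∈ Finset.range (n + 1), a i = ∑ i ∈ Finset.range n, a (i + 1) := by
    rw [Finset.sum_range_succ']
    simp [ha]
  have h3 := Finset.sum_le_sum fun i (_ : i ∈ Finset.range n) => hstep i
  rw [Finset.sum_add_distrib, ← Finset.mul_sum, ← Finset.mul_sum] at h3
  linarith [sum_increments_le_form hD n]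

theorem summable_weighted_birthDeath {f : ℕ → ℝ} (hD : form birthDeathRate geo f < ∞) :
    Summable fun i : ℕ => geo i * (((i : ℝ) + 1) * (f i - f 0) ^ 2) :=
  summable_of_sum_range_le (fun i => by have := (geo_pos i).le; positivity)
    (sum_weighted_le_form hD)

theorem tsum_weighted_le_form {f : ℕ → ℝ} (hD : form birthDeathRate geo f < ∞) :
    ∑' i : ℕ, geo i * (((i : ℝ) + 1) * (f i - f 0) ^ 2)
      ≤ 112 * (form birthDeathRate geo f).toReal :=
  Real.tsum_le_of_sum_range_le (fun i => by have := (geo_pos i).le; positivity)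
    (sum_weighted_le_form hD)

theorem variance_le_birthDeath {f : ℕ → ℝ} (hf : IsL2 geo f)
    (hD : form birthDeathRate geo f < ∞) :
    variance geo f ≤ 112 * (form birthDeathRate geo f).toReal := by
  have hπ : ∀ i, 0 ≤ geo i := fun i => (geo_pos i).le
  refine (variance_le_ip_sub_const hπ hasSum_geo hf (f 0)).trans
    (le_trans ?_ (tsum_weighted_le_form hD))
  rw [ip_self_eq]
  have hw : IsL2 geo fun i => f i - f 0 := hf.sub hπ (isL2_const hasSum_geo.summable _)
  refine Summable.tsum_le_tsum (fun i => mul_le_mul_of_nonneg_left ?_ (hπ i)) hw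
    (summable_weighted_birthDeath hD)
  exact le_mul_of_one_le_left (sq_nonneg _) (le_add_of_nonneg_left i.cast_nonneg)

/-- A single site carries at most the whole norm, so the ratio is at most `1/π_i = 2^{i+1}`. The
logarithm is thus dominated by the Hardy weight. -/
theorem posLog_div_ip_le {g : ℕ → ℝ} (hg : IsL2 geo g) (hV : 0 < ip geo g g) (i : ℕ) :
    Real.posLog (g i ^ 2 / ip geo g g) ≤ (i : ℝ) + 1 := by
  have h1 : geo i * g i ^ 2 ≤ ip geo g g := by
    rw [ip_self_eq]
    exact hg.le_tsum i fun j _ => mul_nonneg (geo_pos j).le (sq_nonneg _)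
  have h2 : g i ^ 2 / ip geo g g ≤ 2 ^ (i + 1) := by
    rw [div_le_iff₀ hV]
    have h3 : (2 : ℝ) ^ (i + 1) * geo i = 1 := by
      rw [geo, ← mul_pow]; norm_num
    calc g i ^ 2 = 2 ^ (i + 1) * (geo i * g i ^ 2) := by rw [← mul_assoc, h3, one_mul]
      _ ≤ _ := mul_le_mul_of_nonneg_left h1 (by positivity)
  refine (Real.posLog_le_posLog (by positivity) h2).trans ?_
  rw [Real.posLog_eq_log (by rw [abs_of_pos (by positivity)]; exact one_le_pow₀ (by norm_num)),
    Real.log_pow]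
  have : Real.log 2 ≤ 1 := by have := Real.log_le_sub_one_of_pos (x := 2) (by norm_num); linarith
  push_cast
  exact mul_le_of_le_one_right (by positivity) this

/-- The weight `i + 1` replaces the logarithm, and `g` is split into `g - g 0` and `g 0`. Hardy
bounds the first part by `2 · 112 D`. The second contributes `2 W (g 0)²` with `(g 0)² ≤ 2 ‖g‖² ≤
224 D`. -/
theorem logSobolev_birthDeathChain : birthDeathChain.LogSobolev := by
  set W := ∑' i : ℕ, geo i * ((i : ℝ) + 1) with hW
  have hπ : ∀ i, 0 ≤ geo i := fun i => (geo_pos i).le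
  have hW0 : 0 ≤ W := tsum_nonneg fun i => mul_nonneg (hπ i) (by positivity)
  refine ReversibleChain.logSobolev_of_centered (X := birthDeathChain) (C := 224 + 448 * W)
    (by positivity) (fun f hf hD => ?_) fun g hg hD hm hV => ?_
  · refine (variance_le_birthDeath hf hD).trans
      (mul_le_mul_of_nonneg_right (by linarith) ENNReal.toReal_nonneg)
  · change IsL2 geo g at hg
    change form birthDeathRate geo g < ∞ at hD
    change mean geo g = 0 at hm
    change 0 < ip geo g g at hV
    change Summable (fun i => geo i * (g i ^ 2 * Real.posLog (g i ^ 2 / ip geo g g))) ∧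
      mean geo (fun i => g i ^ 2 * Real.posLog (g i ^ 2 / ip geo g g))
        ≤ (224 + 448 * W) * (form birthDeathRate geo g).toReal
    set D := (form birthDeathRate geo g).toReal
    have hVD : ip geo g g ≤ 112 * D := by
      have h := variance_le_birthDeath hg hD
      rwa [variance_eq_ip, hm, zero_pow two_ne_zero, sub_zero] at h
    have hg0 : g 0 ^ 2 ≤ 224 * D := by
      have h1 : geo 0 * g 0 ^ 2 ≤ ip geo g g := by
        rw [ip_self_eq]
        exact hg.le_tsum 0 fun j _ => mul_nonneg (hπ j) (sq_nonneg _)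
      have h2 : geo 0 = 1 / 2 := by rw [geo]; norm_num
      rw [h2] at h1
      linarith
    set b : ℕ → ℝ := fun i => 2 * (geo i * (((i : ℝ) + 1) * (g i - g 0) ^ 2)) +
      geo i * ((i : ℝ) + 1) * (2 * g 0 ^ 2) with hb
    have hle : ∀ i, geo i * (g i ^ 2 * Real.posLog (g i ^ 2 / ip geo g g)) ≤ b i := fun i => by
      have h1 : g i ^ 2 ≤ 2 * (g i - g 0) ^ 2 + 2 * g 0 ^ 2 := by
        nlinarith [sq_nonneg (g i - 2 * g 0)]
      have h2 : g i ^ 2 * Real.posLog (g i ^ 2 / ip geo g g) ≤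
          (2 * (g i - g 0) ^ 2 + 2 * g 0 ^ 2) * ((i : ℝ) + 1) :=
        mul_le_mul h1 (posLog_div_ip_le hg hV i) Real.posLog_nonneg (by positivity)
      have h3 := mul_le_mul_of_nonneg_left h2 (hπ i)
      simp only [hb]
      linarith
    have hbs : Summable b :=
      ((summable_weighted_birthDeath hD).mul_left 2).add (summable_geo_mul.mul_right _)
    have hs : Summable fun i => geo i * (g i ^ 2 * Real.posLog (g i ^ 2 / ip geo g g)) :=
      Summable.of_nonneg_of_le
        (fun i => mul_nonneg (hπ i) (mul_nonneg (sq_nonneg _) Real.posLog_nonneg)) hle hbs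
    refine ⟨hs, (hs.tsum_le_tsum hle hbs).trans ?_⟩
    rw [hb, ((summable_weighted_birthDeath hD).mul_left 2).tsum_add (summable_geo_mul.mul_right _),
      tsum_mul_left, tsum_mul_right]
    have h1 := tsum_weighted_le_form hD
    have h2 := mul_le_mul_of_nonneg_left hg0 hW0
    change _ ≤ 112 * D at h1
    change _ + W * _ ≤ _
    linarith

/-- A logarithmic profile has bounded drift: deaths at rate `2 i` raise `-log (i + 1)` by at most
`1/i` each, and births only lower it. So from a far start `P_t u` is at most `2 t`, no matter how
large `π(u)` is. -/
theorem not_stronglyErgodic_birthDeathChain : ¬ birthDeathChain.StronglyErgodic := by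
  intro h
  obtain ⟨t, hsup, ht⟩ := ((h.eventually (gt_mem_nhds (show (0 : ℝ) < 1 / 4 by norm_num))).and
    (eventually_ge_atTop 0)).exists
  -- Chosen so that `π(u) ≥ n/2` and distance below `1/4` would force `P_t u > n/4 > 2 t` at `N`,
  -- where `u` vanishes.
  set n : ℝ := 8 * t + 1 with hn
  have hn0 : 0 < n := by positivity
  set u : ℕ → ℝ := fun i => max (n - Real.log ((i : ℝ) + 1)) 0 with hu
  have hu0 : ∀ i, 0 ≤ u i := fun i => le_max_right _ _
  have hlog0 : ∀ i : ℕ, 0 ≤ Real.log ((i : ℝ) + 1) := fun i =>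
    Real.log_nonneg (le_add_of_nonneg_left i.cast_nonneg)
  have hun : ∀ i, |u i| ≤ n := fun i => by
    rw [abs_of_nonneg (hu0 i)]
    exact max_le (by linarith [hlog0 i]) hn0.le
  set N := ⌈Real.exp n⌉₊
  have hN : ∀ i, N ≤ i → u i = 0 := fun i hi => by
    refine max_eq_right ?_
    have h1 : Real.exp n ≤ (i : ℝ) + 1 :=
      (Nat.le_ceil _).trans ((Nat.cast_le.2 hi).trans (by linarith))
    have := (Real.le_log_iff_exp_le (by positivity)).2 h1
    linarith
  have hanti : ∀ i, u (i + 1) ≤ u i := fun i => by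
    refine max_le_max_right 0 (sub_le_sub_left (Real.log_le_log (by positivity) ?_) _)
    push_cast
    linarith
  have hgap : ∀ i : ℕ, u i - u (i + 1) ≤ 1 / ((i : ℝ) + 1) := fun i => by
    have h1 : Real.log (((i : ℝ) + 1 + 1) / (i + 1)) ≤ ((i : ℝ) + 1 + 1) / (i + 1) - 1 :=
      Real.log_le_sub_one_of_pos (by positivity)
    rw [Real.log_div (by positivity) (by positivity)] at h1
    have h2 : ((i : ℝ) + 1 + 1) / (i + 1) - 1 = 1 / ((i : ℝ) + 1) := by field_simp; ring
    have h3 : n - Real.log ((i : ℝ) + 1 + 1) ≤ u (i + 1) := by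
      refine le_trans (le_of_eq ?_) (le_max_left _ _)
      push_cast
      rfl
    have h4 : 0 ≤ 1 / ((i : ℝ) + 1) := by positivity
    rw [sub_le_iff_le_add]
    exact max_le (by linarith) (by linarith [hu0 (i + 1)])
  have hK : ∀ i, ∑ j ∈ Finset.range N, birthDeathRate i j * u j ≤ 2 := fun i => by
    have h1 := hasSum_sum_of_ne_finset_zero (f := fun j => birthDeathRate i j * u j)
      (s := Finset.range N) (L := .unconditional ℕ) fun j hj => by
        rw [hN j (by simpa using hj), mul_zero]
    rw [h1.unique (hasSum_birthDeathRate_mul i u)]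
    have h2 := mul_le_mul_of_nonneg_left (hanti i) (by positivity : (0 : ℝ) ≤ i + 1)
    rcases i with _ | i
    · push_cast at h2 ⊢
      linarith
    · have h3 := mul_le_mul_of_nonneg_left (hgap i) (by positivity : (0 : ℝ) ≤ i + 1)
      rw [mul_one_div_cancel (by positivity)] at h3
      rw [Nat.add_sub_cancel]
      push_cast at h2 ⊢
      linarith
  have h1 := isReversibleRates_birthDeathRate.semigroup_le_add hN (by norm_num) hK ht N
  rw [hN N le_rfl, zero_add] at h1
  change semigroup birthDeathChain.p t u N ≤ 2 * t at h1
  have h2 := (abs_le.1 (birthDeathChain.abs_semigroup_sub_mean_le ht hun N)).1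
  have h3 : tvNorm (birthDeathChain.p t N) birthDeathChain.π < 1 / 4 :=
    (le_ciSup (birthDeathChain.bddAbove_tvNorm ht) N).trans_lt hsup
  have h4 : n / 2 ≤ mean birthDeathChain.π u := by
    have hs : Summable fun i => geo i * u i :=
      (isL2_of_bounded (fun i => (geo_pos i).le) hasSum_geo.summable hun).summable
        (fun i => (geo_pos i).le) hasSum_geo.summable
    refine le_trans (le_of_eq ?_)
      (hs.le_tsum 0 fun i _ => mul_nonneg (geo_pos i).le (hu0 i))
    have : u 0 = n := by simp [hu, hn0.le]
    rw [this, geo]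
    ring
  have h5 := mul_lt_mul_of_pos_left h3 hn0
  linarith

end LinearBirthDeath

end MarkovChain

/-! ### Assembling the diagram -/

theorem mainTheorem5 :
    -- the implications of the diagram
    (∀ (E : Type*) [Countable E] (X : MarkovChain.ReversibleChain E),
      (X.Nash → X.LogSobolev) ∧
      (X.Nash → X.StronglyErgodic) ∧
      (X.LogSobolev → X.Poincare) ∧
      (X.StronglyErgodic → X.ExponentiallyErgodic) ∧
      (X.Poincare ↔ X.ExponentiallyErgodic) ∧
      (X.Poincare → X.L2AlgebraicallyErgodic) ∧
      (X.L2AlgebraicallyErgodic → X.OrdinarilyErgodic)) ∧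
    -- no one-way implication can be reversed
    (∃ X : MarkovChain.ReversibleChain ℕ, X.LogSobolev ∧ ¬ X.Nash) ∧
    (∃ X : MarkovChain.ReversibleChain ℕ, X.StronglyErgodic ∧ ¬ X.Nash) ∧
    (∃ X : MarkovChain.ReversibleChain ℕ, X.Poincare ∧ ¬ X.LogSobolev) ∧
    (∃ X : MarkovChain.ReversibleChain ℕ, X.ExponentiallyErgodic ∧ ¬ X.StronglyErgodic) ∧
    (∃ X : MarkovChain.ReversibleChain ℕ, X.L2AlgebraicallyErgodic ∧ ¬ X.Poincare) ∧
    (∃ X : MarkovChain.ReversibleChain ℕ, X.OrdinarilyErgodic ∧ ¬ X.L2AlgebraicallyErgodic) ∧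
    -- the logarithmic Sobolev inequality and strong ergodicity are not comparable
    (∃ X : MarkovChain.ReversibleChain ℕ, X.LogSobolev ∧ ¬ X.StronglyErgodic) ∧
    (∃ X : MarkovChain.ReversibleChain ℕ, X.StronglyErgodic ∧ ¬ X.LogSobolev) := by
  refine ⟨fun E _ X => ⟨fun h => h.logSobolev, fun h => h.stronglyErgodic, fun h => h.poincare,
    fun h => h.exponentiallyErgodic, ⟨fun h => h.exponentiallyErgodic, fun h => h.poincare⟩,
    fun h => h.l2AlgebraicallyErgodic, fun h => h.ordinarilyErgodic⟩, ?_⟩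
  have hL := MarkovChain.logSobolev_birthDeathChain
  have hnS := MarkovChain.not_stronglyErgodic_birthDeathChain
  have hS := MarkovChain.stronglyErgodic_resampleChain
  have hnL := MarkovChain.not_logSobolev_resampleChain
  -- The birth–death and resampling chains settle six of the eight claims through the implications
  -- already proved; the two families of speeds settle the others.
  exact ⟨⟨_, hL, fun h => hnS h.stronglyErgodic⟩, ⟨_, hS, fun h => hnL h.logSobolev⟩,
    ⟨_, hS.exponentiallyErgodic.poincare, hnL⟩, ⟨_, hL.poincare.exponentiallyErgodic, hnS⟩,
    ⟨_, MarkovChain.l2AlgebraicallyErgodic_trapChain, MarkovChain.not_poincare_trapChain _ _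
      tendsto_one_div_add_atTop_nhds_zero_nat⟩,
    ⟨_, MarkovChain.ordinarilyErgodic_trapChain _ _,
      MarkovChain.not_l2AlgebraicallyErgodic_trapChain⟩,
    ⟨_, hL, hnS⟩, ⟨_, hS, hnL⟩⟩
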